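/- **Setting.** Let $\pi\colon E\to M$ be a smooth bundle, $\dim M=m\ge 1$, with fibres of dimension $n$, and let $\omega$ be a volume form on $M$ (the same letter denotes its pull-backs). Let $J^1\pi$ be the first jet bundle, $\mathcal M\pi$ the bundle over $E$ of $m$-forms on $E$ that vanish by contraction with two $\pi$-vertical vectors, $J^{1*}\pi=\mathcal M\pi/\pi^*\Lambda^m T^*M$, and $$\mathcal P=J^1\pi\times_M\Lambda^{m-1}T^*M,\qquad \mathcal P^*=J^{1*}\pi\times_M\Lambda^{m-1}T^*M,\qquad \mathcal W=(J^1\pi\times_E\mathcal M\pi)\times_M\Lambda^{m-1}T^*M,$$ with coordinates $(x^\mu,y^A,y^A_\mu,s^\mu)$, $(x^\mu,y^A,p^\mu_A,s^\mu)$, $(x^\mu,y^A,y^A_\mu,p^\mu_A,p,s^\mu)$ (taken so that $\omega=d^mx$) and projections $\tau\colon\mathcal P\to M$, $\overline\tau\colon\mathcal P^*\to M$. Put $d^{m-1}x_\mu=i(\partial/\partial x^\mu)d^mx$. Let $L\in C^\infty(\mathcal P)$ be a regular Lagrangian function ($\partial^2L/\partial y^A_\mu\partial y^B_\nu$ is everywhere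 nondegenerate), and $\mathcal L=L\omega$. Its extended Legendre map is $\widetilde{\mathcal{FL}}$: $p^\mu_A=\partial L/\partial y^A_\mu$, $p=L-y^A_\mu\,\partial L/\partial y^A_\mu$ ($x^\mu,y^A,s^\mu$ unchanged), and its Legendre map $\mathcal{FL}\colon\mathcal P\to\mathcal P^*$ is the composition with the quotient map; it is a local diffeomorphism, and a diffeomorphism if $L$ is hyperregular. Let $$\Theta_{\mathcal L}=-\frac{\partial L}{\partial y^A_\mu}(dy^A-y^A_\nu dx^\nu)\wedge d^{m-1}x_\mu-L\,d^mx+ds^\mu\wedge d^{m-1}x_\mu ,$$ $$\Theta_{\mathcal W}=-p^\mu_A\,dy^A\wedge d^{m-1}x_\mu-p\,d^mx+ds^\mu\wedge d^{m-1}x_\mu .$$ Let $\mathcal W_\circ=\{p+p^\mu_Ay^A_\mu=L\}\subset\mathcal W$, let $\Theta_\circ$ be the restriction of $\Theta_{\mathcal W}$ to $\mathcal W_\circ$, and let $\mathrm{pr}_\circ\colon\mathcal W_\circ\to\mathcal P$, $\overline{\mathrm{pr}}_\circ\colon\mathcal W_\circ\to\mathcal P^*$, $\rho^\circ_M\colon\mathcal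 W_\circ\to M$ be the projections. Let $\mathcal W_1\subset\mathcal W_\circ$ be the set of points where $i(Y)d\Theta_\circ=0$ for every $\overline{\mathrm{pr}}_\circ$-vertical vector $Y$ tangent to $\mathcal W_\circ$. Let $U\subset\mathcal P$ be open (one may take $U=\mathcal P$). Whenever $\mathcal P^*$ is involved, assume that $\mathcal{FL}$ is injective on $U$, so that $\mathcal{FL}\colon U\to\mathcal{FL}(U)$ is a diffeomorphism (if $L$ is hyperregular, $U=\mathcal P$ is allowed and $\mathcal{FL}(U)=\mathcal P^*$; if $L$ is only regular, every point of $\mathcal P$ has such a neighbourhood $U$). Let $\Theta_{\mathcal H}$ be the form on $\mathcal{FL}(U)$ given by the formula for $\Theta_{\mathcal W}$ with $p$ replaced by its value under $\widetilde{\mathcal{FL}}\circ(\mathcal{FL}|_U)^{-1}$. For a form $\Theta$ among $\Theta_\circ,\Theta_{\mathcal L},\Theta_{\mathcal H}$, the field equations for an $m$-multivector field $\mathbf X$ are $$i(\mathbf X)\Theta=0,\qquad i(\mathbf X)(d\Theta+\sigma_\Theta\wedge\Theta)=0 ,$$ where the dissipation form $\sigma_\Theta$ is the one-form with $\sigma_\Theta\wedge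 i(R)\Theta=i(R)d\Theta$ for all Reeb vectors $R$, that is, all $R\in\ker\omega$ such that $i(Z)i(R)d\Theta=0$ for all $Z\in\ker\omega$ (here $\ker\omega=\{Z: i(Z)\omega=0\}$). A locally decomposable multivector field $\mathbf X$ is transverse if $i(\mathbf X)\omega$ has no zeros, and integrable if it has an integral section through each point; on $\mathcal P$ it is holonomic if it is transverse and integrable and all its integral sections satisfy $\partial y^A/\partial x^\mu=y^A_\mu$. A *unified solution over $U$* is an integrable $\rho^\circ_M$-transverse $m$-multivector field $\mathbf X_\circ$ of $\mathcal W_\circ$, given and tangent to $\mathcal W_1$ along $\mathcal W_1\cap\mathrm{pr}_\circ^{-1}(U)$ (in particular with its integral sections in $\mathcal W_1$), that satisfies the field equations of $\Theta_\circ$ at the points of $\mathcal W_1\cap\mathrm{pr}_\circ^{-1}(U)$. **Theorem.** The map $\mathrm{pr}_1=\mathrm{pr}_\circ|_{\mathcal W_1}\colon\mathcal W_1\to\mathcal P$ is bijective, its inverse being $\bar{\mathsf p}\mapsto(\bar{\mathsf p},\widetilde{\mathcal{FL}}(\bar{\mathsf p}))$; write $\overline{\mathrm{pr}}_1=\mathcal{FL}\circ\mathrm{pr}_1$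 for the restriction of $\overline{\mathrm{pr}}_\circ$ to $\mathcal W_1\cap\mathrm{pr}_\circ^{-1}(U)$. Moreover: 1. If $\mathbf X_\circ$ is a unified solution over $U$, then its push-forward $\mathbf X_{\mathcal L}=(\mathrm{pr}_\circ)_*\mathbf X_\circ$ is a holonomic multivector field on $U$ that solves the Lagrangian equations (the field equations of $\Theta_{\mathcal L}$), and, if $\mathcal{FL}|_U$ is injective, its push-forward $\mathbf X_{\mathcal H}=(\overline{\mathrm{pr}}_\circ)_*\mathbf X_\circ$ is a $\overline\tau$-transverse and integrable multivector field on $\mathcal{FL}(U)$ that solves the Hamilton–de Donder–Weyl equations (the field equations of $\Theta_{\mathcal H}$). 2. Conversely, for every holonomic solution $\mathbf X_{\mathcal L}$ of the Lagrangian equations on $U$ there is a unified solution $\mathbf X_\circ$ over $U$ that equals $(\mathrm{pr}_1^{-1})_*\mathbf X_{\mathcal L}$ along $\mathcal W_1$, and then $(\mathrm{pr}_\circ)_*\mathbf X_\circ=\mathbf X_{\mathcal L}$. If $\mathcal{FL}|_U$ is injective, then for every $\overline\tau$-transverse and integrable solution $\mathbf X_{\mathcal H}$ of the Hamilton–de Donder–Weyl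 equations on $\mathcal{FL}(U)$ there is a unified solution $\mathbf X_\circ$ over $U$ that equals $(\overline{\mathrm{pr}}_1^{-1})_*\mathbf X_{\mathcal H}$ along $\mathcal W_1$, and then $(\overline{\mathrm{pr}}_\circ)_*\mathbf X_\circ=\mathbf X_{\mathcal H}$. If moreover $\mathbf X_{\mathcal H}=\mathcal{FL}_*\mathbf X_{\mathcal L}$ on $\mathcal{FL}(U)$, both are lifted to a common $\mathbf X_\circ=(\mathrm{pr}_1^{-1})_*\mathbf X_{\mathcal L}=(\overline{\mathrm{pr}}_1^{-1})_*\mathbf X_{\mathcal H}$. -/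

import Mathlib

open Set
open scoped Manifold ContDiff

noncomputable section

namespace Multicontact

/-! ### Multivectors and forms on a vector space -/

section LinearAlgebra

variable {V V' : Type*} [NormedAddCommGroup V] [NormedSpace ℝ V]
  [NormedAddCommGroup V'] [NormedSpace ℝ V']

/-- Multivectors of degree `r` on a finite-dimensional space `V`, as the dual space of the
space of `r`-forms: `Λʳ V = (Λʳ V*)*`. The value of `X` on an `r`-form `α` is `i(X) α`. -/
abbrev Multivector (r : ℕ) (V : Type*) [NormedAddCommGroup V] [NormedSpace ℝ V] : Type _ :=
  (V [⋀^Fin r]→L[ℝ] ℝ) →ₗ[ℝ] ℝ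

/-- The decomposable multivector `u₁ ∧ ⋯ ∧ u_r`. -/
def wedgeVec {r : ℕ} (u : Fin r → V) : Multivector r V where
  toFun α := α u
  map_add' _ _ := rfl
  map_smul' _ _ := rfl

/-- `Λʳ A : Λʳ V → Λʳ V'` for a linear map `A : V → V'`. -/
def Multivector.map {r : ℕ} (A : V →L[ℝ] V') (X : Multivector r V) : Multivector r V' :=
  X.comp (ContinuousAlternatingMap.compContinuousLinearMapₗ A)

/-- The contraction `i(X) Ω` of an `r`-multivector with an `(r+1)`-form, a one-form. For
`X = u₁ ∧ ⋯ ∧ u_r` it is `v ↦ Ω (u₁, …, u_r, v) = (-1)ʳ Ω (v, u₁, …, u_r)`. -/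
def Multivector.contract {r : ℕ} (X : Multivector r V) (Ω : V [⋀^Fin (r + 1)]→L[ℝ] ℝ) (v : V) :
    ℝ :=
  (-1) ^ r * X (Ω.curryLeft v)

/-- The exterior product `σ ∧ β` of a one-form with a `k`-form. -/
def wedgeOne {r : ℕ} (σ : V →L[ℝ] ℝ) (β : V [⋀^Fin r]→L[ℝ] ℝ) : V [⋀^Fin (r + 1)]→L[ℝ] ℝ :=
  ContinuousAlternatingMap.alternatizeUncurryFin (σ.smulRight β)

/-- The Reeb space of the pair `(Θ, vol)` at a point, from the values of `Θ`, `dΘ` and `vol` there: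
all `R ∈ ker vol` such that `i(R) dΘ` is annihilated by every vector of `ker vol`. -/
def IsReeb {k : ℕ} (dΘ : V [⋀^Fin (k + 2)]→L[ℝ] ℝ) (vol : V [⋀^Fin (k + 1)]→L[ℝ] ℝ) (R : V) :
    Prop :=
  vol.curryLeft R = 0 ∧ ∀ Z : V, vol.curryLeft Z = 0 → (dΘ.curryLeft R).curryLeft Z = 0

/-- `σ` is the dissipation form of `(Θ, vol)` at a point: `σ ∧ i(R)Θ = i(R)dΘ` for all Reeb
vectors `R`. -/
def IsDissipation {k : ℕ} (Θ : V [⋀^Fin (k + 1)]→L[ℝ] ℝ) (dΘ : V [⋀^Fin (k + 2)]→L[ℝ] ℝ)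
    (vol : V [⋀^Fin (k + 1)]→L[ℝ] ℝ) (σ : V →L[ℝ] ℝ) : Prop :=
  ∀ R : V, IsReeb dΘ vol R → wedgeOne σ (Θ.curryLeft R) = dΘ.curryLeft R

/-- The (pre)multicontact field equations for a multivector `X` at a point:
`i(X) Θ = 0` and `i(X) (dΘ + σ ∧ Θ) = 0`, where `σ` is the dissipation form of `(Θ, vol)`. -/
def SolvesFieldEq {k : ℕ} (Θ : V [⋀^Fin (k + 1)]→L[ℝ] ℝ) (dΘ : V [⋀^Fin (k + 2)]→L[ℝ] ℝ)
    (vol : V [⋀^Fin (k + 1)]→L[ℝ] ℝ) (X : Multivector (k + 1) V) : Prop :=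
  X Θ = 0 ∧ ∃ σ : V →L[ℝ] ℝ, IsDissipation Θ dΘ vol σ ∧
    ∀ v : V, X.contract (dΘ + wedgeOne σ Θ) v = 0

end LinearAlgebra

/-! ### Forms and multivector fields on manifolds

As always in Mathlib, the tangent space at `q` of a manifold modelled on `V` is `V`, read in the
preferred chart at `q`. An `r`-form on `Q` is thus a function `Q → V [⋀^Fin r]→L[ℝ] ℝ`, and an
`r`-multivector field a function `Q → Multivector r V`. -/

section Manifold

variable {V V' : Type*} [NormedAddCommGroup V] [NormedSpace ℝ V]
  [NormedAddCommGroup V'] [NormedSpace ℝ V']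
  {H H' : Type*} [TopologicalSpace H] [TopologicalSpace H']
  (I : ModelWithCorners ℝ V H) (I' : ModelWithCorners ℝ V' H')
  {Q Q' : Type*} [TopologicalSpace Q] [ChartedSpace H Q] [TopologicalSpace Q'] [ChartedSpace H' Q']

/-- The tangent map of `f` at `q`. -/
def tmap (f : Q → Q') (q : Q) : V →L[ℝ] V' := mfderiv I I' f q

/-- For a form `α` along `f : Q → Q'` (`α q` is an `r`-form on the tangent space of `Q'` at `f q`),
the `r`-form `(X₁, …, X_r) ↦ α q (Tf X₁, …, Tf X_r)` on `Q`. -/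
def pullAlong {r : ℕ} (f : Q → Q') (α : Q → V' [⋀^Fin r]→L[ℝ] ℝ) (q : Q) :
    V [⋀^Fin r]→L[ℝ] ℝ :=
  (α q).compContinuousLinearMap (tmap I I' f q)

/-- The expression of the form `Θ` in the preferred chart at `q`. -/
def formInChart {r : ℕ} (Θ : Q → V [⋀^Fin r]→L[ℝ] ℝ) (q : Q) (z : V) : V [⋀^Fin r]→L[ℝ] ℝ :=
  (Θ ((extChartAt I q).symm z)).compContinuousLinearMap
    (tmap 𝓘(ℝ, V) I (extChartAt I q).symm z)

/-- Smoothness of a form (on a manifold without boundary). -/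
def SmoothForm {r : ℕ} (Θ : Q → V [⋀^Fin r]→L[ℝ] ℝ) : Prop :=
  ∀ q : Q, ContDiffOn ℝ ∞ (formInChart I Θ q) (extChartAt I q).target

/-- The exterior derivative of a form (on a manifold without boundary). -/
def extD {r : ℕ} (Θ : Q → V [⋀^Fin r]→L[ℝ] ℝ) (q : Q) : V [⋀^Fin (r + 1)]→L[ℝ] ℝ :=
  (extDeriv (formInChart I Θ q) (extChartAt I q q)).compContinuousLinearMap
    (tmap I 𝓘(ℝ, V) (extChartAt I q) q)

/-- Vectors at `q` that are tangent to the subset `S`: velocities of curves in `S`. -/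
def TangentToSet (S : Set Q) (q : Q) (u : V) : Prop :=
  ∃ γ : ℝ → Q, γ 0 = q ∧ (∀ᶠ t in nhds (0 : ℝ), γ t ∈ S) ∧ ContMDiffAt 𝓘(ℝ, ℝ) I ∞ γ 0 ∧
    tmap 𝓘(ℝ, ℝ) I γ 0 1 = u

/-- The multivector field `X`, given on the subset `S`, is smooth and locally decomposable: near
each point of `S` it is `Y₁ ∧ ⋯ ∧ Y_r` on `S` for smooth vector fields `Y₁, …, Y_r` of `Q`. -/
def LocallyDecomposableOn {r : ℕ} (X : Q → Multivector r V) (S : Set Q) : Prop :=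
  ∀ q ∈ S, ∃ O : Set Q, IsOpen O ∧ q ∈ O ∧ O ⊆ (extChartAt I q).source ∧
    ∃ Y : Fin r → Q → V,
      (∀ i, ContMDiffOn I 𝓘(ℝ, V) ∞ (fun q' => tmap I 𝓘(ℝ, V) (extChartAt I q) q' (Y i q')) O) ∧
      ∀ q' ∈ O ∩ S, X q' = wedgeVec (fun i => Y i q')

/-- Transversality, on the subset `S`, of `X` with respect to `τ : Q → Q'`, where `Q'` carries the
volume form `vol`: the function `i(X)(τ* vol)` has no zeros. -/
def TransverseOn {r : ℕ} (τ : Q → Q') (vol : Q' → V' [⋀^Fin r]→L[ℝ] ℝ) (X : Q → Multivector r V)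
    (S : Set Q) : Prop :=
  ∀ q ∈ S, X q (pullAlong I I' τ (fun p => vol (τ p)) q) ≠ 0

/-- `ψ` is an integral section, over the open set `O` and with values in `S`, of the multivector
field `X`: at the point `ψ x` the multivector `X` belongs to `Λʳ Tψ (Λʳ T_x Q')`. (If `X` is
transverse and normalised by `i(X)(τ* vol) = 1`, and `r = dim Q'`, then this says that `X ∘ ψ` is the
canonical prolongation of `ψ`.) -/
structure IsIntegralSection {r : ℕ} (τ : Q → Q') (X : Q → Multivector r V) (S : Set Q)
    (O : Set Q') (ψ : Q' → Q) : Prop where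
  isOpen : IsOpen O
  smooth : ContMDiffOn I' I ∞ ψ O
  mapsTo : ∀ x ∈ O, ψ x ∈ S
  isSection : ∀ x ∈ O, τ (ψ x) = x
  integral : ∀ x ∈ O, ∃ Z : Multivector r V', X (ψ x) = Z.map (tmap I' I ψ x)

/-- `X` is integrable on `S`: it is (smooth and) locally decomposable, and every point of `S` lies
on an integral section in `S`. -/
def IntegrableOn {r : ℕ} (τ : Q → Q') (X : Q → Multivector r V) (S : Set Q) : Prop :=
  LocallyDecomposableOn I X S ∧
    ∀ q ∈ S, ∃ (O : Set Q') (ψ : Q' → Q),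
      IsIntegralSection I I' τ X S O ψ ∧ τ q ∈ O ∧ ψ (τ q) = q

end Manifold

/-! ### Model fibres

The base `M` has dimension `m = k + 1` and the fibres of `E → M` have dimension `n`. -/

/-- Model of the base. -/
abbrev BaseV (k : ℕ) := EuclideanSpace ℝ (Fin (k + 1))

/-- Model of the fibres of the configuration bundle. -/
abbrev FibV (n : ℕ) := EuclideanSpace ℝ (Fin n)

/-- Model of the configuration bundle. -/
abbrev TotV (k n : ℕ) := BaseV k × FibV n

/-- Coordinates `y^A_μ` of a jet. -/
abbrev Jet (k n : ℕ) := BaseV k →L[ℝ] FibV n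

/-- `m`-forms on the model of the base. -/
abbrev Vol (k : ℕ) := BaseV k [⋀^Fin (k + 1)]→L[ℝ] ℝ

/-- `(m-1)`-forms on the model of the base, with the coordinates `s^μ`. -/
abbrev Act (k : ℕ) := BaseV k [⋀^Fin k]→L[ℝ] ℝ

/-- `m`-forms on the model of `E` that vanish by contraction with two vertical vectors: fibre of the
extended multimomentum bundle, with the coordinates `p^μ_A, p` given by `α = p^μ_A dy^A ∧ d^{m-1}x_μ + p d^m x`. -/
def extMomSubmodule (k n : ℕ) : Submodule ℝ (TotV k n [⋀^Fin (k + 1)]→L[ℝ] ℝ) where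
  carrier := {α | ∀ (u : Fin (k + 1) → TotV k n) (i j : Fin (k + 1)), i ≠ j →
    (u i).1 = 0 → (u j).1 = 0 → α u = 0}
  add_mem' := by
    intro α β hα hβ u i j hij hi hj
    simp [hα u i j hij hi hj, hβ u i j hij hi hj]
  zero_mem' := by
    intro u i j _ _ _
    simp
  smul_mem' := by
    intro c α hα u i j hij hi hj
    simp [hα u i j hij hi hj]

/-- The space of such `m`-forms. -/
def ExtMom (k n : ℕ) : Type := extMomSubmodule k n

instance (k n : ℕ) : NormedAddCommGroup (ExtMom k n) :=
  inferInstanceAs (NormedAddCommGroup (extMomSubmodule k n))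

instance (k n : ℕ) : NormedSpace ℝ (ExtMom k n) :=
  inferInstanceAs (NormedSpace ℝ (extMomSubmodule k n))

/-- The underlying `m`-form. -/
def ExtMom.form {k n : ℕ} (α : ExtMom k n) : TotV k n [⋀^Fin (k + 1)]→L[ℝ] ℝ := α.1

/-- Fibre of the restricted multimomentum bundle, with the coordinates `p^μ_A`. The quotient of
`ExtMom` by the basic forms is identified with `V* ⊗ Λ^{m-1} T*M` (`V` the vertical bundle) through
the map `resOfExt` below, whose kernel consists of the basic forms. -/
abbrev ResMom (k n : ℕ) := FibV n →L[ℝ] Act k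

/-- The quotient map from extended to restricted multimomenta: `α ↦ (e ↦ i(e) α)`, where `e` is
vertical, so that `i(e) α` is a basic form; `p^μ_A dy^A ∧ d^{m-1}x_μ + p d^m x` is sent to
`e ↦ p^μ_A e^A d^{m-1}x_μ`. -/
def resOfExt {k n : ℕ} (α : ExtMom k n) : ResMom k n :=
  (ContinuousAlternatingMap.compContinuousLinearMapCLM
      (ContinuousLinearMap.inl ℝ (BaseV k) (FibV n))).comp
    (α.form.curryLeft.comp
      (ContinuousLinearMap.inr ℝ (BaseV k) (FibV n)))

/-- The form `(T_xφ)* α` for a jet of a section `φ` with coordinates `v`, that is,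
`T_xφ = (id, v)`. -/
def jetPull {k n : ℕ} (v : Jet k n) (α : ExtMom k n) : Vol k :=
  α.form.compContinuousLinearMap
    ((ContinuousLinearMap.id ℝ (BaseV k)).prod v)

/-! ### Fibred manifolds and the bundles over them -/

section Bundles

variable {k n : ℕ}
  {M : Type*} [TopologicalSpace M] [ChartedSpace (BaseV k) M] [IsManifold 𝓘(ℝ, BaseV k) ∞ M]
  {E : Type*} [TopologicalSpace E] [ChartedSpace (TotV k n) E] [IsManifold 𝓘(ℝ, TotV k n) ∞ E]

/-- A bundle `π : E → M`, given with adapted charts: in the preferred charts at `y` and at `π y`,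
the projection is `(x, y) ↦ x`. -/
structure AdaptedBundle (k n : ℕ)
    (M : Type*) [TopologicalSpace M] [ChartedSpace (BaseV k) M] [IsManifold 𝓘(ℝ, BaseV k) ∞ M]
    (E : Type*) [TopologicalSpace E] [ChartedSpace (TotV k n) E]
    [IsManifold 𝓘(ℝ, TotV k n) ∞ E] where
  /-- the projection -/
  proj : E → M
  contMDiff_proj : ContMDiff 𝓘(ℝ, TotV k n) 𝓘(ℝ, BaseV k) ∞ proj
  proj_mem : ∀ y y' : E, y' ∈ (chartAt (TotV k n) y).source →
    proj y' ∈ (chartAt (BaseV k) (proj y)).source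
  chart_fst : ∀ y y' : E, y' ∈ (chartAt (TotV k n) y).source →
    (chartAt (TotV k n) y y').1 = chartAt (BaseV k) (proj y) (proj y')

namespace AdaptedBundle

variable (B : AdaptedBundle k n M E)

/-- Derivative of the change of base coordinates, from the chart at `B.proj i` to the chart at `B.proj j`. -/
def baseChange (i j y : E) : BaseV k →L[ℝ] BaseV k :=
  tangentCoordChange 𝓘(ℝ, BaseV k) (B.proj i) (B.proj j) (B.proj y)

/-- Derivative of the change of bundle coordinates, from the chart at `i` to the chart at `j`. (On
the common domain of the charts it is `tangentCoordChange`, see `totChange_eq`; writing the first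
component in this way makes it a fibred linear map everywhere.) -/
def totChange (i j y : E) : TotV k n →L[ℝ] TotV k n :=
  ((B.baseChange i j y).comp (ContinuousLinearMap.fst ℝ (BaseV k) (FibV n))).prod
    ((ContinuousLinearMap.snd ℝ (BaseV k) (FibV n)).comp
      (tangentCoordChange 𝓘(ℝ, TotV k n) i j y))

/-- Transformation of jets. -/
def jetChange (i j y : E) (v : Jet k n) : Jet k n :=
  (ContinuousLinearMap.snd ℝ (BaseV k) (FibV n)).comp
    ((B.totChange i j y).comp
      (((ContinuousLinearMap.id ℝ (BaseV k)).prod v).comp (B.baseChange j i y)))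

/-- Transformation of `m`-forms on `E`. -/
def extMomChange (i j y : E) (α : ExtMom k n) : ExtMom k n :=
  ⟨α.form.compContinuousLinearMap (B.totChange j i y), by
    intro u a b hab ha hb
    refine α.2 _ a b hab ?_ ?_
    · simp [totChange, ha]
    · simp [totChange, hb]⟩

/-- Transformation of restricted multimomenta. -/
def resMomChange (i j y : E) (p : ResMom k n) : ResMom k n :=
  (ContinuousAlternatingMap.compContinuousLinearMapCLM (B.baseChange j i y)).comp
    (p.comp ((ContinuousLinearMap.snd ℝ (BaseV k) (FibV n)).comp
      ((B.totChange j i y).comp (ContinuousLinearMap.inr ℝ (BaseV k) (FibV n)))))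

/-- Transformation of `(m-1)`-forms on `M`. -/
def actChange (i j y : E) (s : Act k) : Act k :=
  s.compContinuousLinearMap (B.baseChange j i y)


theorem fst_tangentCoordChange (i j y : E) (hi : y ∈ (chartAt (TotV k n) i).source)
    (hj : y ∈ (chartAt (TotV k n) j).source) (X : TotV k n) :
    (tangentCoordChange 𝓘(ℝ, TotV k n) i j y X).1 = B.baseChange i j y X.1 := by
  have h1 := hasFDerivWithinAt_tangentCoordChange (I := 𝓘(ℝ, TotV k n)) (x := i) (y := j) (z := y)
    (by simpa using ⟨hi, hj⟩)
  have h2 := hasFDerivWithinAt_tangentCoordChange (I := 𝓘(ℝ, BaseV k)) (x := B.proj i)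
    (y := B.proj j) (z := B.proj y) (by simpa using ⟨B.proj_mem i y hi, B.proj_mem j y hj⟩)
  simp only [modelWithCornersSelf_coe, range_id, hasFDerivWithinAt_univ] at h1 h2
  have hz : (extChartAt 𝓘(ℝ, TotV k n) i y).1 = extChartAt 𝓘(ℝ, BaseV k) (B.proj i) (B.proj y) := by
    simpa using B.chart_fst i y hi
  rw [← hz] at h2
  have h3 := h2.comp (extChartAt 𝓘(ℝ, TotV k n) i y)
    (ContinuousLinearMap.fst ℝ (BaseV k) (FibV n)).hasFDerivAt
  have h4 := (ContinuousLinearMap.fst ℝ (BaseV k) (FibV n)).hasFDerivAt.comp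
    (extChartAt 𝓘(ℝ, TotV k n) i y) h1
  have ho : ((chartAt (TotV k n) i).symm ⁻¹' (chartAt (TotV k n) j).source) ∈
      nhds (chartAt (TotV k n) i y) := by
    refine (chartAt (TotV k n) i).continuousAt_symm ((chartAt (TotV k n) i).map_source hi) ?_
    rw [(chartAt (TotV k n) i).left_inv hi]
    exact (chartAt (TotV k n) j).open_source.mem_nhds hj
  have ht : (chartAt (TotV k n) i).target ∈ nhds (chartAt (TotV k n) i y) :=
    (chartAt (TotV k n) i).open_target.mem_nhds ((chartAt (TotV k n) i).map_source hi)
  have hev : (ContinuousLinearMap.fst ℝ (BaseV k) (FibV n)) ∘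
        (extChartAt 𝓘(ℝ, TotV k n) j ∘ (extChartAt 𝓘(ℝ, TotV k n) i).symm) =ᶠ[
        nhds (extChartAt 𝓘(ℝ, TotV k n) i y)]
      (extChartAt 𝓘(ℝ, BaseV k) (B.proj j) ∘ (extChartAt 𝓘(ℝ, BaseV k) (B.proj i)).symm) ∘
        (ContinuousLinearMap.fst ℝ (BaseV k) (FibV n)) := by
    have hpt : extChartAt 𝓘(ℝ, TotV k n) i y = chartAt (TotV k n) i y := by simp
    rw [hpt]
    filter_upwards [ho, ht] with z hz1 hz2
    have hs := (chartAt (TotV k n) i).map_target hz2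
    have e1 := B.chart_fst j _ hz1
    have e2 := B.chart_fst i _ hs
    rw [(chartAt (TotV k n) i).right_inv hz2] at e2
    have e3 := (chartAt (BaseV k) (B.proj i)).left_inv (B.proj_mem i _ hs)
    rw [← e2] at e3
    simp [e1, e3]
  exact congrArg (fun T : TotV k n →L[ℝ] BaseV k => T X)
    (h4.unique (h3.congr_of_eventuallyEq hev))

theorem totChange_eq (i j y : E) (hi : y ∈ (chartAt (TotV k n) i).source)
    (hj : y ∈ (chartAt (TotV k n) j).source) :
    B.totChange i j y = tangentCoordChange 𝓘(ℝ, TotV k n) i j y := by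
  refine ContinuousLinearMap.ext fun X => ?_
  exact Prod.ext (B.fst_tangentCoordChange i j y hi hj X).symm rfl

theorem baseChange_self (i y : E) (hi : y ∈ (chartAt (TotV k n) i).source) (x : BaseV k) :
    B.baseChange i i y x = x :=
  tangentCoordChange_self (by simpa using B.proj_mem i y hi)

theorem baseChange_comp (i j l y : E) (hi : y ∈ (chartAt (TotV k n) i).source)
    (hj : y ∈ (chartAt (TotV k n) j).source) (hl : y ∈ (chartAt (TotV k n) l).source)
    (x : BaseV k) :
    B.baseChange j l y (B.baseChange i j y x) = B.baseChange i l y x :=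
  tangentCoordChange_comp (by
    simpa using ⟨⟨B.proj_mem i y hi, B.proj_mem j y hj⟩, B.proj_mem l y hl⟩)

theorem totChange_self (i y : E) (hi : y ∈ (chartAt (TotV k n) i).source) (x : TotV k n) :
    B.totChange i i y x = x := by
  rw [B.totChange_eq i i y hi hi]
  exact tangentCoordChange_self (by simpa using hi)

theorem totChange_comp (i j l y : E) (hi : y ∈ (chartAt (TotV k n) i).source)
    (hj : y ∈ (chartAt (TotV k n) j).source) (hl : y ∈ (chartAt (TotV k n) l).source)
    (x : TotV k n) :
    B.totChange j l y (B.totChange i j y x) = B.totChange i l y x := by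
  rw [B.totChange_eq i j y hi hj, B.totChange_eq j l y hj hl, B.totChange_eq i l y hi hl]
  exact tangentCoordChange_comp (by simpa using ⟨⟨hi, hj⟩, hl⟩)

theorem totChange_fst (i j y : E) (x : TotV k n) :
    (B.totChange i j y x).1 = B.baseChange i j y x.1 := rfl

theorem continuousOn_baseChange (i j : E) : ContinuousOn (B.baseChange i j)
    ((chartAt (TotV k n) i).source ∩ (chartAt (TotV k n) j).source) := by
  refine (continuousOn_tangentCoordChange (I := 𝓘(ℝ, BaseV k)) (B.proj i) (B.proj j)).comp
    B.contMDiff_proj.continuous.continuousOn ?_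
  intro y hy
  simpa using ⟨B.proj_mem i y hy.1, B.proj_mem j y hy.2⟩

theorem continuousOn_totChange (i j : E) : ContinuousOn (B.totChange i j)
    ((chartAt (TotV k n) i).source ∩ (chartAt (TotV k n) j).source) := by
  have h := continuousOn_tangentCoordChange (I := 𝓘(ℝ, TotV k n)) i j
  simp only [extChartAt_source] at h
  exact h.congr fun y hy => B.totChange_eq i j y hy.1 hy.2

theorem jetChange_self (i y : E) (hi : y ∈ (chartAt (TotV k n) i).source) (v : Jet k n) :
    B.jetChange i i y v = v := by
  ext x : 1
  simp [jetChange, B.totChange_self i y hi, B.baseChange_self i y hi]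

theorem jetChange_comp (i j l y : E) (hi : y ∈ (chartAt (TotV k n) i).source)
    (hj : y ∈ (chartAt (TotV k n) j).source) (hl : y ∈ (chartAt (TotV k n) l).source)
    (v : Jet k n) :
    B.jetChange j l y (B.jetChange i j y v) = B.jetChange i l y v := by
  ext x : 1
  have key : ∀ x' : BaseV k, ((x', B.jetChange i j y v x') : TotV k n) =
      B.totChange i j y (B.baseChange j i y x', v (B.baseChange j i y x')) := by
    intro x'
    refine Prod.ext ?_ rfl
    rw [totChange_fst, B.baseChange_comp j i j y hj hi hj, B.baseChange_self j y hj]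
  have e : B.jetChange j l y (B.jetChange i j y v) x =
      (B.totChange j l y (B.baseChange l j y x, B.jetChange i j y v (B.baseChange l j y x))).2 :=
    rfl
  rw [e, key, B.totChange_comp i j l y hi hj hl, B.baseChange_comp l j i y hl hj hi]
  rfl

theorem extMomChange_self (i y : E) (hi : y ∈ (chartAt (TotV k n) i).source) (α : ExtMom k n) :
    B.extMomChange i i y α = α := by
  apply Subtype.ext
  ext u
  show α.1 (fun a => B.totChange i i y (u a)) = α.1 u
  congr 1
  ext a : 1
  exact B.totChange_self i y hi (u a)

theorem extMomChange_comp (i j l y : E) (hi : y ∈ (chartAt (TotV k n) i).source)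
    (hj : y ∈ (chartAt (TotV k n) j).source) (hl : y ∈ (chartAt (TotV k n) l).source)
    (α : ExtMom k n) :
    B.extMomChange j l y (B.extMomChange i j y α) = B.extMomChange i l y α := by
  apply Subtype.ext
  ext u
  show α.1 (fun a => B.totChange j i y (B.totChange l j y (u a))) =
    α.1 (fun a => B.totChange l i y (u a))
  congr 1
  ext a : 1
  exact B.totChange_comp l j i y hl hj hi (u a)

theorem actChange_self (i y : E) (hi : y ∈ (chartAt (TotV k n) i).source) (s : Act k) :
    B.actChange i i y s = s := by
  ext u
  show s (fun a => B.baseChange i i y (u a)) = s u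
  congr 1
  ext a : 1
  exact B.baseChange_self i y hi (u a)

theorem actChange_comp (i j l y : E) (hi : y ∈ (chartAt (TotV k n) i).source)
    (hj : y ∈ (chartAt (TotV k n) j).source) (hl : y ∈ (chartAt (TotV k n) l).source)
    (s : Act k) :
    B.actChange j l y (B.actChange i j y s) = B.actChange i l y s := by
  ext u
  show s (fun a => B.baseChange j i y (B.baseChange l j y (u a))) =
    s (fun a => B.baseChange l i y (u a))
  congr 1
  ext a : 1
  exact B.baseChange_comp l j i y hl hj hi (u a)

theorem resMomChange_apply (i j y : E) (p : ResMom k n) (e : FibV n) :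
    B.resMomChange i j y p e = B.actChange i j y (p (B.totChange j i y (0, e)).2) := rfl

theorem totChange_vert (i j y : E) (e : FibV n) :
    ((0, (B.totChange i j y (0, e)).2) : TotV k n) = B.totChange i j y (0, e) :=
  Prod.ext (by rw [totChange_fst]; simp) rfl

theorem resMomChange_self (i y : E) (hi : y ∈ (chartAt (TotV k n) i).source) (p : ResMom k n) :
    B.resMomChange i i y p = p := by
  ext e : 1
  rw [resMomChange_apply, B.totChange_self i y hi, B.actChange_self i y hi]

theorem resMomChange_comp (i j l y : E) (hi : y ∈ (chartAt (TotV k n) i).source)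
    (hj : y ∈ (chartAt (TotV k n) j).source) (hl : y ∈ (chartAt (TotV k n) l).source)
    (p : ResMom k n) :
    B.resMomChange j l y (B.resMomChange i j y p) = B.resMomChange i l y p := by
  ext e : 1
  rw [resMomChange_apply, resMomChange_apply, resMomChange_apply, totChange_vert,
    B.totChange_comp l j i y hl hj hi, B.actChange_comp i j l y hi hj hl]

theorem continuousOn_jetChange (i j : E) :
    ContinuousOn (fun p : E × Jet k n => B.jetChange i j p.1 p.2)
      (((chartAt (TotV k n) i).source ∩ (chartAt (TotV k n) j).source) ×ˢ univ) := by
  have hT : ContinuousOn (fun p : E × Jet k n => B.totChange i j p.1)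
      (((chartAt (TotV k n) i).source ∩ (chartAt (TotV k n) j).source) ×ˢ univ) :=
    (B.continuousOn_totChange i j).comp continuousOn_fst fun p hp => hp.1
  have hA : ContinuousOn (fun p : E × Jet k n => B.baseChange j i p.1)
      (((chartAt (TotV k n) i).source ∩ (chartAt (TotV k n) j).source) ×ˢ univ) :=
    (B.continuousOn_baseChange j i).comp continuousOn_fst fun p hp => hp.1.symm
  have hv : ContinuousOn (fun p : E × Jet k n => (ContinuousLinearMap.id ℝ (BaseV k)).prod p.2)
      (((chartAt (TotV k n) i).source ∩ (chartAt (TotV k n) j).source) ×ˢ univ) := by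
    have e : (fun p : E × Jet k n => (ContinuousLinearMap.id ℝ (BaseV k)).prod p.2) =
        fun p => ContinuousLinearMap.inl ℝ (BaseV k) (FibV n) +
          (ContinuousLinearMap.inr ℝ (BaseV k) (FibV n)).comp p.2 := by
      funext p
      refine ContinuousLinearMap.ext fun x => Prod.ext ?_ ?_ <;> simp
    rw [e]
    exact (continuous_const.add (continuous_const.clm_comp continuous_snd)).continuousOn
  exact continuousOn_const.clm_comp (hT.clm_comp (hv.clm_comp hA))

theorem continuousOn_actChange (i j : E) :
    ContinuousOn (fun p : E × Act k => B.actChange i j p.1 p.2)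
      (((chartAt (TotV k n) i).source ∩ (chartAt (TotV k n) j).source) ×ˢ univ) := by
  have hA : ContinuousOn (fun p : E × Act k => B.baseChange j i p.1)
      (((chartAt (TotV k n) i).source ∩ (chartAt (TotV k n) j).source) ×ˢ univ) :=
    (B.continuousOn_baseChange j i).comp continuousOn_fst fun p hp => hp.1.symm
  have h := (ContinuousAlternatingMap.continuous_compContinuousLinearMapCLM (𝕜 := ℝ)
    (E := BaseV k) (F := BaseV k) (G := ℝ) (ι := Fin k)).comp_continuousOn hA
  exact h.clm_apply continuousOn_snd

theorem continuousOn_extMomChange (i j : E) :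
    ContinuousOn (fun p : E × ExtMom k n => B.extMomChange i j p.1 p.2)
      (((chartAt (TotV k n) i).source ∩ (chartAt (TotV k n) j).source) ×ˢ univ) := by
  have hA : ContinuousOn (fun p : E × ExtMom k n => B.totChange j i p.1)
      (((chartAt (TotV k n) i).source ∩ (chartAt (TotV k n) j).source) ×ˢ univ) :=
    (B.continuousOn_totChange j i).comp continuousOn_fst fun p hp => hp.1.symm
  have h := (ContinuousAlternatingMap.continuous_compContinuousLinearMapCLM (𝕜 := ℝ)
    (E := TotV k n) (F := TotV k n) (G := ℝ) (ι := Fin (k + 1))).comp_continuousOn hA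
  rw [continuousOn_iff_continuous_domRestrict]
  refine Continuous.subtype_mk ?_ _
  exact continuousOn_iff_continuous_domRestrict.1
    (h.clm_apply (continuous_subtype_val.comp continuous_snd).continuousOn)

theorem continuousOn_resMomChange (i j : E) :
    ContinuousOn (fun p : E × ResMom k n => B.resMomChange i j p.1 p.2)
      (((chartAt (TotV k n) i).source ∩ (chartAt (TotV k n) j).source) ×ˢ univ) := by
  have hT : ContinuousOn (fun p : E × ResMom k n => B.totChange j i p.1)
      (((chartAt (TotV k n) i).source ∩ (chartAt (TotV k n) j).source) ×ˢ univ) :=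
    (B.continuousOn_totChange j i).comp continuousOn_fst fun p hp => hp.1.symm
  have hA : ContinuousOn (fun p : E × ResMom k n => B.baseChange j i p.1)
      (((chartAt (TotV k n) i).source ∩ (chartAt (TotV k n) j).source) ×ˢ univ) :=
    (B.continuousOn_baseChange j i).comp continuousOn_fst fun p hp => hp.1.symm
  have h := (ContinuousAlternatingMap.continuous_compContinuousLinearMapCLM (𝕜 := ℝ)
    (E := BaseV k) (F := BaseV k) (G := ℝ) (ι := Fin k)).comp_continuousOn hA
  exact h.clm_comp (continuousOn_snd.clm_comp
    (continuousOn_const.clm_comp (hT.clm_comp continuousOn_const)))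


/-- The bundle `J¹π ×_M Λ^{m-1} T*M → E`: the fibre over `y` consists of a jet and an `(m-1)`-form
on `T_{π y} M`, read in the preferred charts at `y` and `π y`. -/
def velCore : FiberBundleCore E E (Jet k n × Act k) where
  baseSet i := (chartAt (TotV k n) i).source
  isOpen_baseSet i := (chartAt (TotV k n) i).open_source
  indexAt y := y
  mem_baseSet_at y := mem_chart_source (TotV k n) y
  coordChange i j y f := (B.jetChange i j y f.1, B.actChange i j y f.2)
  coordChange_self i y hi f := Prod.ext (B.jetChange_self i y hi _) (B.actChange_self i y hi _)
  continuousOn_coordChange i j :=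
    ((B.continuousOn_jetChange i j).comp (f := fun p : E × (Jet k n × Act k) => (p.1, p.2.1))
      (by fun_prop) fun p hp => ⟨hp.1, mem_univ _⟩).prodMk
    ((B.continuousOn_actChange i j).comp (f := fun p : E × (Jet k n × Act k) => (p.1, p.2.2))
      (by fun_prop) fun p hp => ⟨hp.1, mem_univ _⟩)
  coordChange_comp i j l y h f :=
    Prod.ext (B.jetChange_comp i j l y h.1.1 h.1.2 h.2 _)
      (B.actChange_comp i j l y h.1.1 h.1.2 h.2 _)

/-- The bundle `J¹*π ×_M Λ^{m-1} T*M → E`. -/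
def momCore : FiberBundleCore E E (ResMom k n × Act k) where
  baseSet i := (chartAt (TotV k n) i).source
  isOpen_baseSet i := (chartAt (TotV k n) i).open_source
  indexAt y := y
  mem_baseSet_at y := mem_chart_source (TotV k n) y
  coordChange i j y f := (B.resMomChange i j y f.1, B.actChange i j y f.2)
  coordChange_self i y hi f := Prod.ext (B.resMomChange_self i y hi _) (B.actChange_self i y hi _)
  continuousOn_coordChange i j :=
    ((B.continuousOn_resMomChange i j).comp
      (f := fun p : E × (ResMom k n × Act k) => (p.1, p.2.1))
      (by fun_prop) fun p hp => ⟨hp.1, mem_univ _⟩).prodMk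
    ((B.continuousOn_actChange i j).comp (f := fun p : E × (ResMom k n × Act k) => (p.1, p.2.2))
      (by fun_prop) fun p hp => ⟨hp.1, mem_univ _⟩)
  coordChange_comp i j l y h f :=
    Prod.ext (B.resMomChange_comp i j l y h.1.1 h.1.2 h.2 _)
      (B.actChange_comp i j l y h.1.1 h.1.2 h.2 _)

/-- The bundle `(J¹π ×_E Mπ) ×_M Λ^{m-1} T*M → E`. -/
def pontCore : FiberBundleCore E E (Jet k n × ExtMom k n × Act k) where
  baseSet i := (chartAt (TotV k n) i).source
  isOpen_baseSet i := (chartAt (TotV k n) i).open_source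
  indexAt y := y
  mem_baseSet_at y := mem_chart_source (TotV k n) y
  coordChange i j y f :=
    (B.jetChange i j y f.1, B.extMomChange i j y f.2.1, B.actChange i j y f.2.2)
  coordChange_self i y hi f := Prod.ext (B.jetChange_self i y hi _)
    (Prod.ext (B.extMomChange_self i y hi _) (B.actChange_self i y hi _))
  continuousOn_coordChange i j :=
    ((B.continuousOn_jetChange i j).comp
      (f := fun p : E × (Jet k n × ExtMom k n × Act k) => (p.1, p.2.1))
      (by fun_prop) fun p hp => ⟨hp.1, mem_univ _⟩).prodMk
    (((B.continuousOn_extMomChange i j).comp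
      (f := fun p : E × (Jet k n × ExtMom k n × Act k) => (p.1, p.2.2.1))
      (by fun_prop) fun p hp => ⟨hp.1, mem_univ _⟩).prodMk
    ((B.continuousOn_actChange i j).comp
      (f := fun p : E × (Jet k n × ExtMom k n × Act k) => (p.1, p.2.2.2))
      (by fun_prop) fun p hp => ⟨hp.1, mem_univ _⟩))
  coordChange_comp i j l y h f :=
    Prod.ext (B.jetChange_comp i j l y h.1.1 h.1.2 h.2 _)
      (Prod.ext (B.extMomChange_comp i j l y h.1.1 h.1.2 h.2 _)
        (B.actChange_comp i j l y h.1.1 h.1.2 h.2 _))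

end AdaptedBundle

variable (B : AdaptedBundle k n M E)

/-- The multivelocity phase bundle `𝒫 = J¹π ×_M Λ^{m-1} T*M`. -/
abbrev VelPhase := B.velCore.TotalSpace

/-- The multimomentum phase bundle `𝒫* = J¹*π ×_M Λ^{m-1} T*M`. -/
abbrev MomPhase := B.momCore.TotalSpace

/-- The extended Pontryagin bundle `𝒲 = (J¹π ×_E Mπ) ×_M Λ^{m-1} T*M`. -/
abbrev Pont := B.pontCore.TotalSpace

end Bundles

/-- Model of `𝒫`. -/
abbrev VelV (k n : ℕ) := TotV k n × (Jet k n × Act k)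

/-- Model of `𝒫*`. -/
abbrev MomV (k n : ℕ) := TotV k n × (ResMom k n × Act k)

/-- Model of `𝒲`. -/
abbrev PontV (k n : ℕ) := TotV k n × (Jet k n × ExtMom k n × Act k)

/-- Model with corners of `M`. -/
abbrev IB (k : ℕ) := 𝓘(ℝ, BaseV k)

/-- Model with corners of `E`. -/
abbrev IE (k n : ℕ) := 𝓘(ℝ, TotV k n)

/-- Model with corners of `𝒫`. -/
abbrev IVel (k n : ℕ) := 𝓘(ℝ, TotV k n).prod 𝓘(ℝ, Jet k n × Act k)

/-- Model with corners of `𝒫*`. -/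
abbrev IMom (k n : ℕ) := 𝓘(ℝ, TotV k n).prod 𝓘(ℝ, ResMom k n × Act k)

/-- Model with corners of `𝒲`. -/
abbrev IPont (k n : ℕ) := 𝓘(ℝ, TotV k n).prod 𝓘(ℝ, Jet k n × ExtMom k n × Act k)

section Projections

variable {k n : ℕ}
  {M : Type*} [TopologicalSpace M] [ChartedSpace (BaseV k) M] [IsManifold 𝓘(ℝ, BaseV k) ∞ M]
  {E : Type*} [TopologicalSpace E] [ChartedSpace (TotV k n) E] [IsManifold 𝓘(ℝ, TotV k n) ∞ E]
  {B : AdaptedBundle k n M E}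

/-- The point of `𝒫` over `y` with jet `v` and action form `s`. -/
def mkVel (y : E) (v : Jet k n) (s : Act k) : VelPhase B := ⟨y, ((v, s) : Jet k n × Act k)⟩

/-- The point of `𝒫*` over `y` with multimomentum `p` and action form `s`. -/
def mkMom (y : E) (p : ResMom k n) (s : Act k) : MomPhase B :=
  ⟨y, ((p, s) : ResMom k n × Act k)⟩

/-- The point of `𝒲` over `y` with jet `v`, extended multimomentum `α` and action form `s`. -/
def mkPont (y : E) (v : Jet k n) (α : ExtMom k n) (s : Act k) : Pont B :=
  ⟨y, ((v, α, s) : Jet k n × ExtMom k n × Act k)⟩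

/-! The components of a point of `𝒫`, `𝒫*` and `𝒲` in the preferred chart at its base point. -/

def velJet (p : VelPhase B) : Jet k n := (show Jet k n × Act k from p.2).1
def velAct (p : VelPhase B) : Act k := (show Jet k n × Act k from p.2).2
def momAct (p : MomPhase B) : Act k := (show ResMom k n × Act k from p.2).2
def pontJet (w : Pont B) : Jet k n := (show Jet k n × ExtMom k n × Act k from w.2).1
def pontMom (w : Pont B) : ExtMom k n := (show Jet k n × ExtMom k n × Act k from w.2).2.1
def pontAct (w : Pont B) : Act k := (show Jet k n × ExtMom k n × Act k from w.2).2.2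

/-- `𝒫 → E`. -/
def velE (p : VelPhase B) : E := p.1
/-- `𝒫* → E`. -/
def momE (p : MomPhase B) : E := p.1
/-- `𝒲 → E`. -/
def pontE (w : Pont B) : E := w.1
/-- `τ : 𝒫 → M`. -/
def velM (p : VelPhase B) : M := B.proj p.1
/-- `𝒫* → M`. -/
def momM (p : MomPhase B) : M := B.proj p.1
/-- `𝒲 → M`. -/
def pontM (w : Pont B) : M := B.proj w.1

/-- `pr : 𝒲 → 𝒫`. -/
def pr (w : Pont B) : VelPhase B := mkVel w.1 (pontJet w) (pontAct w)

/-- The projection `𝒲 → 𝒫*`. -/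
def prBar (w : Pont B) : MomPhase B := mkMom w.1 (resOfExt (pontMom w)) (pontAct w)

end Projections

section Theory

variable {k n : ℕ}

/-- The `ν`-th coordinate vector of the base. -/
def baseVec {k : ℕ} (ν : Fin (k + 1)) : BaseV k := EuclideanSpace.single ν 1

/-- For a covector `D` on jets, with the coordinates `p^ν_A`, the one-form
`p^ν_A (dy^A - v^A_μ dx^μ)` on the model of `E`. -/
def contactForm (D : Jet k n →L[ℝ] ℝ) (v : Jet k n) (ν : Fin (k + 1)) : TotV k n →L[ℝ] ℝ :=
  (D.comp (ContinuousLinearMap.smulRightL ℝ (BaseV k) (FibV n) (EuclideanSpace.proj ν))).comp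
    (ContinuousLinearMap.snd ℝ (BaseV k) (FibV n) -
      v.comp (ContinuousLinearMap.fst ℝ (BaseV k) (FibV n)))

/-- The `m`-form `p^ν_A (dy^A - v^A_μ dx^μ) ∧ i(∂/∂x^ν) vol + ℓ vol` on the model of `E`. -/
def affineForm (vol : Vol k) (ℓ : ℝ) (D : Jet k n →L[ℝ] ℝ) (v : Jet k n) :
    TotV k n [⋀^Fin (k + 1)]→L[ℝ] ℝ :=
  (∑ ν : Fin (k + 1), wedgeOne (contactForm D v ν)
    ((vol.curryLeft (baseVec ν)).compContinuousLinearMap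
      (ContinuousLinearMap.fst ℝ (BaseV k) (FibV n)))) +
  ℓ • vol.compContinuousLinearMap (ContinuousLinearMap.fst ℝ (BaseV k) (FibV n))

theorem affineForm_mem (vol : Vol k) (ℓ : ℝ) (D : Jet k n →L[ℝ] ℝ) (v : Jet k n) :
    affineForm vol ℓ D v ∈ extMomSubmodule k n := by
  intro u i j hij hi hj
  have hv : vol.compContinuousLinearMap (ContinuousLinearMap.fst ℝ (BaseV k) (FibV n)) u = 0 :=
    vol.map_coord_zero i (by simpa using hi)
  have hs : ∀ ν : Fin (k + 1), wedgeOne (contactForm D v ν)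
      ((vol.curryLeft (baseVec ν)).compContinuousLinearMap
        (ContinuousLinearMap.fst ℝ (BaseV k) (FibV n))) u = 0 := by
    intro ν
    rw [wedgeOne, ContinuousAlternatingMap.alternatizeUncurryFin_apply]
    refine Finset.sum_eq_zero fun a _ => ?_
    have : ∃ b : Fin k, (u (a.succAbove b)).1 = 0 := by
      by_cases h : i = a
      · obtain ⟨b, hb⟩ := Fin.exists_succAbove_eq (show j ≠ a from fun h' => hij (h.trans h'.symm))
        exact ⟨b, by rw [hb]; exact hj⟩
      · obtain ⟨b, hb⟩ := Fin.exists_succAbove_eq h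
        exact ⟨b, by rw [hb]; exact hi⟩
    obtain ⟨b, hb⟩ := this
    have h0 : ((vol.curryLeft (baseVec ν)).compContinuousLinearMap
        (ContinuousLinearMap.fst ℝ (BaseV k) (FibV n))) (a.removeNth u) = 0 :=
      (vol.curryLeft (baseVec ν)).map_coord_zero b (by simpa [Fin.removeNth] using hb)
    simp [h0]
  simp [affineForm, hs, hv]

variable
  {M : Type*} [TopologicalSpace M] [ChartedSpace (BaseV k) M] [IsManifold 𝓘(ℝ, BaseV k) ∞ M]
  {E : Type*} [TopologicalSpace E] [ChartedSpace (TotV k n) E] [IsManifold 𝓘(ℝ, TotV k n) ∞ E]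
  {B : AdaptedBundle k n M E} (vol : M → Vol k) (L : VelPhase B → ℝ)

/-! ### Lagrangian side -/

/-- The fibre derivative `∂L/∂y^A_μ` of `L` in the directions of the fibres of `J¹π → E`. -/
def fibreDeriv (p : VelPhase B) : Jet k n →L[ℝ] ℝ :=
  fderiv ℝ (fun v => L (mkVel p.1 v (velAct p))) (velJet p)

/-- `L` is regular: its Hessian `∂²L/∂y^A_μ∂y^B_ν` is nondegenerate at every point. -/
def RegularLagrangian : Prop :=
  ∀ p : VelPhase B, ∀ a : Jet k n,
    fderiv ℝ (fun v => fibreDeriv L (mkVel p.1 v (velAct p))) (velJet p) a = 0 → a = 0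

/-- The extended Legendre map, with the coordinates `p^μ_A = ∂L/∂y^A_μ`,
`p = L - y^A_μ ∂L/∂y^A_μ` (for `vol = d^m x`); the action variable is not changed. -/
def extLegendre (p : VelPhase B) : ExtMom k n :=
  ⟨affineForm (vol (velM p)) (L p) (fibreDeriv L p) (velJet p), affineForm_mem _ _ _ _⟩

/-- The restricted Legendre map `𝓕𝓛 : 𝒫 → 𝒫*`. -/
def legendre (p : VelPhase B) : MomPhase B :=
  mkMom p.1 (resOfExt (extLegendre vol L p)) (velAct p)

/-- The canonical action form `S` of `𝒫`. -/
def actionVel : VelPhase B → VelV k n [⋀^Fin k]→L[ℝ] ℝ :=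
  pullAlong (IVel k n) (IB k) velM velAct

/-- The Lagrangian form `Θ_𝓛 = -i(J)d𝓛 - 𝓛 + dS`, in coordinates
`-(∂L/∂y^A_μ) (dy^A - y^A_ν dx^ν) ∧ d^{m-1}x_μ - L d^m x + ds^μ ∧ d^{m-1}x_μ`. -/
def thetaVel (p : VelPhase B) : VelV k n [⋀^Fin (k + 1)]→L[ℝ] ℝ :=
  -pullAlong (IVel k n) (IE k n) velE
      (fun p => affineForm (vol (velM p)) (L p) (fibreDeriv L p) (velJet p)) p +
    extD (IVel k n) (actionVel (B := B)) p

/-- A multivector field on the open set `U ⊆ 𝒫` is holonomic: it is `τ`-transverse and integrable,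
and its integral sections are holonomic, i.e. they satisfy `T_xφ = (id, y^A_μ)` for the underlying
local section `φ` of `E → M`. -/
structure IsHolonomicField (U : Set (VelPhase B)) (X : VelPhase B → Multivector (k + 1) (VelV k n)) :
    Prop where
  transverse : TransverseOn (IVel k n) (IB k) velM vol X U
  integrable : IntegrableOn (IVel k n) (IB k) velM X U
  holonomic : ∀ (O : Set M) (ψ : M → VelPhase B),
    IsIntegralSection (IVel k n) (IB k) velM X U O ψ → ∀ x ∈ O,
      tmap (IB k) (IE k n) (fun x' => velE (ψ x')) x =
        (ContinuousLinearMap.id ℝ (BaseV k)).prod (velJet (ψ x))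

/-- `X` is a holonomic multivector field on the open set `U ⊆ 𝒫` that solves the Lagrangian
equations `i(X)Θ_𝓛 = 0`, `i(X)(dΘ_𝓛 + σ ∧ Θ_𝓛) = 0`. -/
structure IsLagrangianSolution (U : Set (VelPhase B))
    (X : VelPhase B → Multivector (k + 1) (VelV k n)) : Prop where
  holonomic : IsHolonomicField vol U X
  solves : ∀ p ∈ U, SolvesFieldEq (thetaVel vol L p) (extD (IVel k n) (thetaVel vol L) p)
    (pullAlong (IVel k n) (IB k) velM (fun p => vol (velM p)) p) (X p)

/-! ### Hamiltonian side -/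

open Classical in
/-- The inverse of `𝓕𝓛 : U → 𝓕𝓛(U)` (with an arbitrary value outside `𝓕𝓛(U)`). -/
def legendreInv (U : Set (VelPhase B)) (q : MomPhase B) : VelPhase B :=
  if h : ∃ p ∈ U, legendre vol L p = q then h.choose else mkVel q.1 0 (momAct q)

/-- The canonical action form of `𝒫*`. -/
def actionMom : MomPhase B → MomV k n [⋀^Fin k]→L[ℝ] ℝ :=
  pullAlong (IMom k n) (IB k) momM momAct

/-- The Hamiltonian form `Θ_𝓗 = h* Θ̃` on `𝓕𝓛(U)`, where `h` is the composition of the inverse of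
`𝓕𝓛 : U → 𝓕𝓛(U)` with the extended Legendre map, and `Θ̃` is minus the Liouville form plus the
differential of the action form. -/
def thetaMom (U : Set (VelPhase B)) (q : MomPhase B) : MomV k n [⋀^Fin (k + 1)]→L[ℝ] ℝ :=
  -pullAlong (IMom k n) (IE k n) momE
      (fun q => (extLegendre vol L (legendreInv vol L U q)).form) q +
    extD (IMom k n) (actionMom (B := B)) q

/-- `X` is a transverse and integrable multivector field on `𝓕𝓛(U) ⊆ 𝒫*` that solves the
Hamilton--de Donder--Weyl equations `i(X)Θ_𝓗 = 0`, `i(X)(dΘ_𝓗 + σ ∧ Θ_𝓗) = 0`. -/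
structure IsHamiltonianSolution (U : Set (VelPhase B))
    (X : MomPhase B → Multivector (k + 1) (MomV k n)) : Prop where
  transverse : TransverseOn (IMom k n) (IB k) momM vol X (legendre vol L '' U)
  integrable : IntegrableOn (IMom k n) (IB k) momM X (legendre vol L '' U)
  solves : ∀ q ∈ legendre vol L '' U,
    SolvesFieldEq (thetaMom vol L U q) (extD (IMom k n) (thetaMom vol L U) q)
      (pullAlong (IMom k n) (IB k) momM (fun q => vol (momM q)) q) (X q)

/-! ### Unified formalism -/

/-- The canonical action form of `𝒲`. -/
def actionPont : Pont B → PontV k n [⋀^Fin k]→L[ℝ] ℝ :=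
  pullAlong (IPont k n) (IB k) pontM pontAct

/-- The canonical `m`-form `Θ_𝒲` of `𝒲`: minus the Liouville form plus the differential of the
action form. -/
def thetaPont (w : Pont B) : PontV k n [⋀^Fin (k + 1)]→L[ℝ] ℝ :=
  -pullAlong (IPont k n) (IE k n) pontE
      (fun w => (pontMom w).form) w +
    extD (IPont k n) (actionPont (B := B)) w

/-- The coupling form `𝒞`. -/
def coupling (w : Pont B) : Vol k := jetPull (pontJet w) (pontMom w)

/-- The function `C` with `𝒞 = C vol`. -/
def couplingFun (w : Pont B) : ℝ := coupling w baseVec / vol (pontM w) baseVec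

/-- The Hamiltonian submanifold `𝒲_∘ = {𝒞 = 𝓛}` of `𝒲`, where `𝓛 = L vol`. -/
def W0 : Set (Pont B) := {w | coupling w = L (pr w) • vol (pontM w)}

/-- The tangent space of `𝒲_∘` at a point, the kernel of `d(C - L)`. -/
def tangentW0 (w : Pont B) : Submodule ℝ (PontV k n) :=
  LinearMap.ker (tmap (IPont k n) 𝓘(ℝ, ℝ) (fun w => couplingFun vol w - L (pr w)) w :
    PontV k n →ₗ[ℝ] ℝ)

/-- The tangent space of `𝒲_∘` at a point, as a normed space. -/
def TW0 (w : Pont B) : Type := tangentW0 vol L w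

instance (w : Pont B) : NormedAddCommGroup (TW0 vol L w) :=
  inferInstanceAs (NormedAddCommGroup (tangentW0 vol L w))

instance (w : Pont B) : NormedSpace ℝ (TW0 vol L w) :=
  inferInstanceAs (NormedSpace ℝ (tangentW0 vol L w))

/-- The inclusion of the tangent space of `𝒲_∘` in that of `𝒲`. -/
def inclW0 (w : Pont B) : TW0 vol L w →L[ℝ] PontV k n := (tangentW0 vol L w).subtypeL

/-- Restriction of a form of `𝒲` to `T𝒲_∘`. -/
def resW0 {r : ℕ} (α : Pont B → PontV k n [⋀^Fin r]→L[ℝ] ℝ) (w : Pont B) :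
    TW0 vol L w [⋀^Fin r]→L[ℝ] ℝ :=
  (α w).compContinuousLinearMap (inclW0 vol L w)

/-- The submanifold `𝒲₁` of `𝒲_∘`: all `w` such that `i(Y)dΘ_∘ = 0` at `w` for the vectors `Y`
tangent to `𝒲_∘` that are vertical for the projection `𝒲_∘ → 𝒫*`. -/
def W1 : Set (Pont B) :=
  {w | w ∈ W0 vol L ∧ ∀ Y : TW0 vol L w, tmap (IPont k n) (IMom k n) prBar w (inclW0 vol L w Y) = 0 →
    (resW0 vol L (extD (IPont k n) thetaPont) w).curryLeft Y = 0}

/-- The part of `𝒲₁` over `U ⊆ 𝒫`. -/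
def W1Over (U : Set (VelPhase B)) : Set (Pont B) := {w | w ∈ W1 vol L ∧ pr w ∈ U}

/-- Multivector fields of degree `m` on `𝒲_∘` (only their values on `𝒲_∘` are meaningful). -/
abbrev UnifiedField := ∀ w : Pont B, Multivector (k + 1) (TW0 vol L w)

variable {vol L} in
/-- A multivector field on `𝒲_∘`, as a multivector field along `𝒲_∘` in `𝒲`. -/
def UnifiedField.incl (X : UnifiedField vol L) (w : Pont B) : Multivector (k + 1) (PontV k n) :=
  (X w).map (inclW0 vol L w)

/-- `X` is an integrable transverse multivector field, tangent to `𝒲₁`, that solves the unified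
equations `i(X)Θ_∘ = 0`, `i(X)(dΘ_∘ + σ ∧ Θ_∘) = 0` at the points of `𝒲₁` (over `U`). -/
structure IsUnifiedSolution (U : Set (VelPhase B)) (X : UnifiedField vol L) : Prop where
  transverse : TransverseOn (IPont k n) (IB k) pontM vol X.incl (W1Over vol L U)
  integrable : IntegrableOn (IPont k n) (IB k) pontM X.incl (W1Over vol L U)
  tangent : ∀ w ∈ W1Over vol L U, ∃ u : Fin (k + 1) → PontV k n,
    (∀ i, TangentToSet (IPont k n) (W1 vol L) w (u i)) ∧ X.incl w = wedgeVec u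
  solves : ∀ w ∈ W1Over vol L U,
    SolvesFieldEq (resW0 vol L thetaPont w) (resW0 vol L (extD (IPont k n) thetaPont) w)
      (resW0 vol L (pullAlong (IPont k n) (IB k) pontM (fun w => vol (pontM w))) w) (X w)

/-- The graph of the Legendre map, `𝒫 → 𝒲₁`, the inverse of `pr₁ : 𝒲₁ → 𝒫`. -/
def legendreGraph (p : VelPhase B) : Pont B :=
  mkPont p.1 (velJet p) (extLegendre vol L p) (velAct p)

variable {vol L}

/-- The multivector field `(pr_∘)_* X` on `𝒫`. -/
def pushVel (X : UnifiedField vol L) (p : VelPhase B) : Multivector (k + 1) (VelV k n) :=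
  (X.incl (legendreGraph vol L p)).map
    (tmap (IPont k n) (IVel k n) pr (legendreGraph vol L p))

/-- The multivector field on `𝓕𝓛(U) ⊆ 𝒫*` that is the push-forward of `X` under `𝒲_∘ → 𝒫*`. -/
def pushMom (U : Set (VelPhase B)) (X : UnifiedField vol L) (q : MomPhase B) :
    Multivector (k + 1) (MomV k n) :=
  (X.incl (legendreGraph vol L (legendreInv vol L U q))).map
    (tmap (IPont k n) (IMom k n) prBar (legendreGraph vol L (legendreInv vol L U q)))

end Theory

end Multicontact

end

open Multicontact

/-! Everything happens along `W1`, which is the graph of the extended Legendre map. Relative to a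
jet v, an extended multimomentum is the same thing as an affine function v' ↦ ℓ + D (v' - v) on
jets, with values multiplied by the volume form (`jetPull_affineMom`, `exists_eq_affineMom`). The
equation of `W0` says ℓ = L. A jet direction a becomes tangent to `W0`, without leaving the fibres
of the projection to 𝒫*, after adding a basic multimomentum of size -(D a - ∂L·a). Contraction of dΘ
with a vector vertical over E sees only the multimomentum component, so the condition defining `W1`
forces D = ∂L (`eq_legendreGraph_of_mem_W1`), and the converse is the same computation
(`legendreGraph_mem_W1`).

The Lagrangian form is the pull-back of the canonical form by the graph, and the Hamiltonian form is
its pull-back by the graph composed with the inverse Legendre map (`thetaPont_pullback`). The field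
equations on `W0`, however, test all vectors tangent to `W0` and not only those tangent to `W1`. For
a parametrisation φ of `W1`, the tangent space of `W0` at a point of `W1` is the sum of the image of
Tφ and the vectors vertical over 𝒫*. The latter annihilate Θ, dΘ and the volume form, the condition
on dΘ being the definition of `W1` (`curryLeft_resW0_eq_zero`). Hence all three forms are pull-backs
along a left inverse b of Tφ, and it is linear algebra that Reeb vectors, dissipation forms and
field equations correspond along such a b (`solvesFieldEq_map_iff`, `UnifiedModel.solves_iff`).
Regularity gives the splitting: a kernel vector of the tangent Legendre map would lie in the kernel
of the Hessian (`tmap_legendre_injective`), and a dimension count does the rest.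

Tangency to `W1` means that a unified solution is Tφ applied to its own push-forward
(`UnifiedModel.incl_eq`), and lifts are defined by that formula. Transversality, decomposability and
integral sections are carried along by maps over M (`FibredCorr`). The structure `UnifiedModel`
collects what is needed, so that the Lagrangian and Hamiltonian statements are two instances of one
argument. Holonomy is the only extra point: contracting the second field equation with multimomentum
directions tangent to `W0` gives D (v' - v) = 0 for all covectors D, where v' is the actual
derivative of the section and v its jet coordinate (`holonomic_of_unified`). -/

noncomputable section

namespace Multicontact

/-! ### Finite-dimensional spaces of forms, and smoothness of pull-back. -/

section FiniteDimensional

variable {V V' : Type*} [NormedAddCommGroup V] [NormedSpace ℝ V]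
  [NormedAddCommGroup V'] [NormedSpace ℝ V']

instance finiteDimensional_multilinear [FiniteDimensional ℝ V] (r : ℕ) :
    FiniteDimensional ℝ (ContinuousMultilinearMap ℝ (fun _ : Fin r => V) ℝ) :=
  Module.Finite.of_injective
    (ContinuousMultilinearMap.toMultilinearMapLinear :
      ContinuousMultilinearMap ℝ (fun _ : Fin r => V) ℝ →ₗ[ℝ] _)
    ContinuousMultilinearMap.toMultilinearMap_injective

instance finiteDimensional_form [FiniteDimensional ℝ V] (r : ℕ) :
    FiniteDimensional ℝ (V [⋀^Fin r]→L[ℝ] ℝ) :=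
  Module.Finite.of_injective
    (ContinuousAlternatingMap.toContinuousMultilinearMapLinear :
      V [⋀^Fin r]→L[ℝ] ℝ →ₗ[ℝ] ContinuousMultilinearMap ℝ (fun _ : Fin r => V) ℝ)
    ContinuousAlternatingMap.toContinuousMultilinearMap_injective

instance finiteDimensional_extMom (k n : ℕ) : FiniteDimensional ℝ (ExtMom k n) :=
  inferInstanceAs (FiniteDimensional ℝ (extMomSubmodule k n))

/-- A continuous linear left inverse of an injective linear map. -/
theorem exists_clm_leftInverse [FiniteDimensional ℝ V'] (i : V →L[ℝ] V')
    (hi : Function.Injective i) : ∃ P : V' →L[ℝ] V, ∀ x, P (i x) = x := by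
  obtain ⟨g, hg⟩ := LinearMap.exists_leftInverse_of_injective (i : V →ₗ[ℝ] V')
    (LinearMap.ker_eq_bot.2 hi)
  exact ⟨(g : V' →ₗ[ℝ] V).toContinuousLinearMap, fun x => LinearMap.congr_fun hg x⟩

/-- A continuous left inverse undoes `i`, so smoothness may be tested after an embedding. This
serves for `ExtMom`, a subspace of forms, and for alternating maps inside the multilinear ones. -/
theorem contDiffOn_of_injective_comp [FiniteDimensional ℝ V'] {G : Type*} [NormedAddCommGroup G]
    [NormedSpace ℝ G] {r : ℕ∞ω} {s : Set G} {f : G → V} (i : V →L[ℝ] V')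
    (hi : Function.Injective i) (h : ContDiffOn ℝ r (fun x => i (f x)) s) :
    ContDiffOn ℝ r f s := by
  obtain ⟨P, hP⟩ := exists_clm_leftInverse i hi
  exact (P.contDiff.comp_contDiffOn h).congr fun x _ => (hP (f x)).symm

/-- Among multilinear maps, composition with a family of linear maps depends on that family in a
continuous multilinear way; here the family is constant. The smoothness is joint, as the coordinate
changes of the bundles require. -/
theorem contDiff_compContinuousLinearMapCLM [FiniteDimensional ℝ V] [FiniteDimensional ℝ V']
    (r : ℕ) : ContDiff ℝ ∞ (fun p : (V' [⋀^Fin r]→L[ℝ] ℝ) × (V →L[ℝ] V') =>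
      p.1.compContinuousLinearMap p.2) := by
  rw [← contDiffOn_univ]
  refine contDiffOn_of_injective_comp
    (ContinuousAlternatingMap.toContinuousMultilinearMapCLM ℝ
      : V [⋀^Fin r]→L[ℝ] ℝ →L[ℝ] ContinuousMultilinearMap ℝ (fun _ : Fin r => V) ℝ)
    ContinuousAlternatingMap.toContinuousMultilinearMap_injective ?_
  rw [contDiffOn_univ]
  have h1 : ContDiff ℝ ∞ (fun p : (V' [⋀^Fin r]→L[ℝ] ℝ) × (V →L[ℝ] V') =>
      ContinuousMultilinearMap.compContinuousLinearMapContinuousMultilinear ℝ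
        (fun _ : Fin r => V) (fun _ : Fin r => V') ℝ (fun _ => p.2)) :=
    (ContinuousMultilinearMap.contDiff _).comp (contDiff_pi.2 fun _ => contDiff_snd)
  have h2 : ContDiff ℝ ∞ (fun p : (V' [⋀^Fin r]→L[ℝ] ℝ) × (V →L[ℝ] V') =>
      p.1.toContinuousMultilinearMap) :=
    (ContinuousAlternatingMap.toContinuousMultilinearMapCLM ℝ
      : V' [⋀^Fin r]→L[ℝ] ℝ →L[ℝ] _).contDiff.comp contDiff_fst
  exact h1.clm_apply h2

end FiniteDimensional

/-! ### Multivectors, Reeb vectors and field equations under linear maps. -/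

section LinearAlgebra

variable {V V' V'' : Type*} [NormedAddCommGroup V] [NormedSpace ℝ V]
  [NormedAddCommGroup V'] [NormedSpace ℝ V'] [NormedAddCommGroup V''] [NormedSpace ℝ V'']

theorem Multivector.map_apply {r : ℕ} (A : V →L[ℝ] V') (X : Multivector r V)
    (α : V' [⋀^Fin r]→L[ℝ] ℝ) : X.map A α = X (α.compContinuousLinearMap A) := rfl

theorem Multivector.map_map {r : ℕ} (A : V →L[ℝ] V') (C : V' →L[ℝ] V'') (X : Multivector r V) :
    (X.map A).map C = X.map (C.comp A) := rfl

theorem Multivector.map_id {r : ℕ} (X : Multivector r V) :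
    X.map (ContinuousLinearMap.id ℝ V) = X := rfl

theorem map_wedgeVec {r : ℕ} (A : V →L[ℝ] V') (u : Fin r → V) :
    (wedgeVec u).map A = wedgeVec (fun i => A (u i)) := rfl

theorem Multivector.map_injective [FiniteDimensional ℝ V'] {r : ℕ} (A : V →L[ℝ] V')
    (hA : Function.Injective A) {X Y : Multivector r V} (h : X.map A = Y.map A) : X = Y := by
  obtain ⟨P, hP⟩ := exists_clm_leftInverse A hA
  have e : P.comp A = ContinuousLinearMap.id ℝ V := ContinuousLinearMap.ext hP
  rw [← X.map_id, ← Y.map_id, ← e, ← Multivector.map_map, h, Multivector.map_map]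

theorem wedgeOne_comp {r : ℕ} (A : V →L[ℝ] V') (σ : V' →L[ℝ] ℝ) (β : V' [⋀^Fin r]→L[ℝ] ℝ) :
    (wedgeOne σ β).compContinuousLinearMap A =
      wedgeOne (σ.comp A) (β.compContinuousLinearMap A) := by
  ext u
  simp [wedgeOne, ContinuousAlternatingMap.alternatizeUncurryFin_apply, Function.comp_def]
  rfl

theorem comp_injective_of_surjective {r : ℕ} {b : V' →L[ℝ] V} (hb : Function.Surjective b)
    {α β : V [⋀^Fin r]→L[ℝ] ℝ}
    (h : α.compContinuousLinearMap b = β.compContinuousLinearMap b) : α = β := by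
  ext u
  choose g hg using hb
  have := DFunLike.congr_fun h (fun i => g (u i))
  simpa [Function.comp_def, hg] using this

/-- Pull-back along a surjection is injective on forms, and each test vector `Z` below is the image
of one above, so both sides test the same conditions. -/
theorem isReeb_comp_iff {k : ℕ} {b : V' →L[ℝ] V} (hb : Function.Surjective b)
    (dΘ : V [⋀^Fin (k + 2)]→L[ℝ] ℝ) (vol : V [⋀^Fin (k + 1)]→L[ℝ] ℝ) (R : V') :
    IsReeb (dΘ.compContinuousLinearMap b) (vol.compContinuousLinearMap b) R ↔
      IsReeb dΘ vol (b R) := by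
  have key : ∀ (r : ℕ) (α : V [⋀^Fin r]→L[ℝ] ℝ), α.compContinuousLinearMap b = 0 ↔ α = 0 :=
    fun r α => ⟨fun h => comp_injective_of_surjective hb (h.trans rfl), fun h => by rw [h]; rfl⟩
  have h2 : ∀ Z, (vol.compContinuousLinearMap b).curryLeft Z = 0 ↔ vol.curryLeft (b Z) = 0 := by
    intro Z
    rw [ContinuousAlternatingMap.curryLeft_compContinuousLinearMap, key]
  have h3 : ∀ Z, ((dΘ.compContinuousLinearMap b).curryLeft R).curryLeft Z = 0 ↔
      (dΘ.curryLeft (b R)).curryLeft (b Z) = 0 := by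
    intro Z
    rw [ContinuousAlternatingMap.curryLeft_compContinuousLinearMap,
      ContinuousAlternatingMap.curryLeft_compContinuousLinearMap, key]
  simp only [IsReeb, h2, h3]
  refine and_congr_right fun _ => ⟨fun h Z hZ => ?_, fun h Z hZ => h _ hZ⟩
  obtain ⟨Z, rfl⟩ := hb Z
  exact h Z hZ

/-- The field equations correspond to each other under a linear map `a` with a left inverse `b`
along which the forms are pulled back. -/
theorem solvesFieldEq_map_iff {k : ℕ} {a : V →L[ℝ] V'} {b : V' →L[ℝ] V} (hab : ∀ u, b (a u) = u)
    (Θ : V [⋀^Fin (k + 1)]→L[ℝ] ℝ) (dΘ : V [⋀^Fin (k + 2)]→L[ℝ] ℝ)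
    (vol : V [⋀^Fin (k + 1)]→L[ℝ] ℝ) (X : Multivector (k + 1) V) :
    SolvesFieldEq (Θ.compContinuousLinearMap b) (dΘ.compContinuousLinearMap b)
      (vol.compContinuousLinearMap b) (X.map a) ↔ SolvesFieldEq Θ dΘ vol X := by
  have hb : Function.Surjective b := fun u => ⟨a u, hab u⟩
  have hba : b.comp a = ContinuousLinearMap.id ℝ V := ContinuousLinearMap.ext hab
  have hcc : ∀ {r : ℕ} (α : V [⋀^Fin r]→L[ℝ] ℝ),
      (α.compContinuousLinearMap b).compContinuousLinearMap a = α := by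
    intro r α
    ext u
    simp [Function.comp_def, hab]
  have hcon : ∀ (Ω : V [⋀^Fin (k + 2)]→L[ℝ] ℝ) (v : V'),
      (X.map a).contract (Ω.compContinuousLinearMap b) v = X.contract Ω (b v) := by
    intro Ω v
    rw [Multivector.contract, Multivector.contract, Multivector.map_apply,
      ContinuousAlternatingMap.curryLeft_compContinuousLinearMap, hcc]
  have hadd : ∀ (σ : V →L[ℝ] ℝ), dΘ.compContinuousLinearMap b +
      wedgeOne (σ.comp b) (Θ.compContinuousLinearMap b) =
      (dΘ + wedgeOne σ Θ).compContinuousLinearMap b := by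
    intro σ
    rw [← wedgeOne_comp]
    rfl
  rw [SolvesFieldEq, SolvesFieldEq, Multivector.map_apply, hcc]
  refine and_congr_right fun _ => ⟨?_, ?_⟩
  · rintro ⟨σ, hσ, h⟩
    -- The dissipation form upstairs is not known to be a pull-back along `b`. Composing with the
    -- section `a` suffices, because `a R` is a Reeb vector whenever `R` is.
    refine ⟨σ.comp a, fun R hR => ?_, fun v => ?_⟩
    · have h1 := hσ (a R) ((isReeb_comp_iff hb dΘ vol (a R)).2 (by rwa [hab]))
      rw [ContinuousAlternatingMap.curryLeft_compContinuousLinearMap,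
        ContinuousAlternatingMap.curryLeft_compContinuousLinearMap, hab] at h1
      have h2 := congrArg (fun η => η.compContinuousLinearMap a) h1
      simp only [wedgeOne_comp, hcc] at h2
      exact h2
    · have h1 := h (a v)
      rw [Multivector.contract, Multivector.map_apply] at h1
      rw [Multivector.contract, ← h1]
      congr 2
      rw [← ContinuousAlternatingMap.curryLeft_compContinuousLinearMap]
      congr 1
      have : (dΘ.compContinuousLinearMap b + wedgeOne σ (Θ.compContinuousLinearMap b)
          ).compContinuousLinearMap a =
          (dΘ.compContinuousLinearMap b).compContinuousLinearMap a +
          (wedgeOne σ (Θ.compContinuousLinearMap b)).compContinuousLinearMap a := rfl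
      rw [this, hcc, wedgeOne_comp, hcc]
  · rintro ⟨σ, hσ, h⟩
    refine ⟨σ.comp b, fun R hR => ?_, fun v => ?_⟩
    · rw [ContinuousAlternatingMap.curryLeft_compContinuousLinearMap,
        ContinuousAlternatingMap.curryLeft_compContinuousLinearMap, ← wedgeOne_comp,
        hσ (b R) ((isReeb_comp_iff hb dΘ vol R).1 hR)]
    · rw [hadd, hcon, h]

/-- A form annihilated by the kernel of `b`, where `b ∘ a = id`, is a pull-back along `b`. -/
theorem eq_comp_of_curryLeft_eq_zero {r : ℕ} {a : V →L[ℝ] V'} {b : V' →L[ℝ] V}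
    (hab : ∀ u, b (a u) = u) {η : V' [⋀^Fin (r + 1)]→L[ℝ] ℝ}
    (h : ∀ Y, b Y = 0 → η.curryLeft Y = 0) :
    η = (η.compContinuousLinearMap a).compContinuousLinearMap b := by
  -- The hypothesis concerns the first slot; any other slot is moved there at the cost of a sign.
  have h0 : ∀ (u : Fin (r + 1) → V') (i : Fin (r + 1)), b (u i) = 0 → η u = 0 := by
    intro u i hi
    have h1 := DFunLike.congr_fun (h (u i) hi) (i.removeNth u)
    rw [ContinuousAlternatingMap.curryLeft_apply_apply,
      ← ContinuousAlternatingMap.neg_one_pow_smul_map_insertNth η i, Fin.insertNth_self_removeNth] at h1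
    simpa using h1
  ext u
  -- The arguments `u i` are replaced by `a (b (u i))` one at a time: each difference lies in the
  -- kernel of `b` and does not contribute.
  have key : ∀ (s : Finset (Fin (r + 1))), η u = η (fun i => if i ∈ s then a (b (u i)) else u i) := by
    intro s
    induction s using Finset.induction_on with
    | empty => simp
    | insert j s hj ih =>
      rw [ih]
      set w : Fin (r + 1) → V' := fun i => if i ∈ s then a (b (u i)) else u i with hw
      have e1 : (fun i => if i ∈ insert j s then a (b (u i)) else u i) =
          Function.update w j (a (b (u j))) := by
        funext i
        by_cases hij : i = j
        · subst hij; simp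
        · simp [hij, hw]
      have e2 : w = Function.update w j (a (b (u j)) + (u j - a (b (u j)))) := by
        simp [hw, hj]
      rw [e1]
      conv_lhs => rw [e2]
      rw [ContinuousAlternatingMap.map_update_add]
      rw [h0 (Function.update w j (u j - a (b (u j)))) j (by simp [hab]), add_zero]
  have := key Finset.univ
  simpa [Function.comp_def] using this

end LinearAlgebra

/-! ### Multimomenta as affine functions of jets. -/

section Fibres

variable {k n : ℕ}

/-- The coordinate basis of the base. -/
def baseBasis (k : ℕ) : Module.Basis (Fin (k + 1)) ℝ (BaseV k) :=
  (EuclideanSpace.basisFun (Fin (k + 1)) ℝ).toBasis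

theorem baseBasis_apply (i : Fin (k + 1)) : baseBasis k i = baseVec i := by
  simp [baseBasis, baseVec]

theorem baseVec_apply (i j : Fin (k + 1)) : (baseVec i : BaseV k) j = if j = i then 1 else 0 := by
  simp [baseVec]

theorem sum_smul_baseVec (x : BaseV k) : ∑ i, x i • (baseVec i : BaseV k) = x := by
  have h := (baseBasis k).sum_repr x
  simpa [baseBasis, baseVec] using h

theorem vol_eq_zero {α : Vol k} (h : α baseVec = 0) : α = 0 := by
  have h1 := α.toAlternatingMap.eq_smul_basis_det (baseBasis k)
  have h2 : α.toAlternatingMap (baseBasis k) = 0 := by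
    rw [show (⇑(baseBasis k) : Fin (k + 1) → BaseV k) = baseVec from funext baseBasis_apply]
    exact h
  rw [h2, zero_smul] at h1
  exact ContinuousAlternatingMap.toAlternatingMap_injective h1

theorem vol_ext {α β : Vol k} (h : α baseVec = β baseVec) : α = β :=
  sub_eq_zero.1 (vol_eq_zero (by simp [h]))

theorem vol_apply_ne_zero {α : Vol k} (h : α ≠ 0) : α baseVec ≠ 0 := fun h' => h (vol_eq_zero h')

theorem eq_smul_vol {α : Vol k} (h : α ≠ 0) (β : Vol k) :
    β = (β baseVec / α baseVec) • α :=
  vol_ext (by simp [div_mul_cancel₀ _ (vol_apply_ne_zero h)])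

/-- An injective choice of m - 1 among m basis vectors omits exactly one index `j`, hence is a
permutation of the increasing choice `j.succAbove`. -/
theorem act_eq_zero {s : Act k}
    (h : ∀ j : Fin (k + 1), s (fun i => baseVec (j.succAbove i)) = 0) : s = 0 := by
  apply ContinuousAlternatingMap.toAlternatingMap_injective
  refine (baseBasis k).ext_alternating fun v hv => ?_
  have hns : ¬ Function.Surjective v := by
    intro hs
    have := Fintype.card_le_of_surjective v hs
    simp at this
  obtain ⟨j, hj⟩ : ∃ j, ∀ i, v i ≠ j := by
    simpa [Function.Surjective] using hns
  choose w hw using fun i => Fin.exists_succAbove_eq (hj i)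
  have hwi : Function.Injective w := fun a c hac => hv (by rw [← hw a, ← hw c, hac])
  let σ : Equiv.Perm (Fin k) := Equiv.ofBijective w (Finite.injective_iff_bijective.1 hwi)
  have e : (fun i => baseBasis k (v i)) = (fun i => baseVec (j.succAbove i)) ∘ σ := by
    funext i
    simp [baseBasis_apply, σ, hw]
  rw [e]
  show s.toAlternatingMap _ = _
  rw [AlternatingMap.map_perm]
  have h2 : s.toAlternatingMap (fun i => baseVec (j.succAbove i)) = 0 := h j
  rw [h2]
  simp

/-- The form of an extended multimomentum, as a continuous linear map. -/
def formL (k n : ℕ) : ExtMom k n →L[ℝ] TotV k n [⋀^Fin (k + 1)]→L[ℝ] ℝ :=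
  (extMomSubmodule k n).subtypeL

theorem formL_injective : Function.Injective (formL k n) := Subtype.val_injective

theorem ExtMom.ext_form {α β : ExtMom k n} (h : α.form = β.form) : α = β := Subtype.ext h

theorem jetPull_apply (v : Jet k n) (α : ExtMom k n) (x : Fin (k + 1) → BaseV k) :
    jetPull v α x = α.form (fun i => (x i, v (x i))) := rfl

/-- `jetPull v`, as a continuous linear map. -/
def jetPullL (v : Jet k n) : ExtMom k n →L[ℝ] Vol k :=
  (ContinuousAlternatingMap.compContinuousLinearMapCLM
    ((ContinuousLinearMap.id ℝ (BaseV k)).prod v)).comp (formL k n)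

theorem jetPullL_apply (v : Jet k n) (α : ExtMom k n) : jetPullL v α = jetPull v α := rfl

/-- The quotient map to restricted multimomenta, as a continuous linear map. -/
def resL (k n : ℕ) : ExtMom k n →L[ℝ] ResMom k n :=
  (ContinuousLinearMap.compL ℝ (FibV n) (TotV k n [⋀^Fin k]→L[ℝ] ℝ) (Act k)
      (ContinuousAlternatingMap.compContinuousLinearMapCLM
        (ContinuousLinearMap.inl ℝ (BaseV k) (FibV n)))).comp
    (((ContinuousLinearMap.compL ℝ (FibV n) (TotV k n) (TotV k n [⋀^Fin k]→L[ℝ] ℝ)).flip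
      (ContinuousLinearMap.inr ℝ (BaseV k) (FibV n))).comp
      (ContinuousAlternatingMap.curryLeftLI.toContinuousLinearMap.comp (formL k n)))

theorem resL_apply (α : ExtMom k n) : resL k n α = resOfExt α := rfl

theorem resOfExt_apply (α : ExtMom k n) (e : FibV n) (x : Fin k → BaseV k) :
    resOfExt α e x = α.form (Matrix.vecCons (0, e) (fun i => (x i, 0))) := rfl

/-- Once one argument is vertical, altering another by a vertical vector changes nothing, since the
form vanishes on two vertical vectors. In other words, contraction with a vertical vector gives a
basic form. -/
theorem form_eq_of_snd {α : ExtMom k n} {u u' : Fin (k + 1) → TotV k n} {i : Fin (k + 1)}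
    (hi : (u i).1 = 0) (hu : u i = u' i) (h : ∀ j, (u j).1 = (u' j).1) : α.form u = α.form u' := by
  have key : ∀ s : Finset (Fin (k + 1)), i ∉ s →
      α.form u = α.form (fun j => if j ∈ s then u' j else u j) := by
    intro s
    induction s using Finset.induction_on with
    | empty => simp
    | insert j s hj ih =>
      intro his
      have hij : i ≠ j := fun e => his (by simp [e])
      have his' : i ∉ s := fun e => his (by simp [e])
      rw [ih his']
      set w : Fin (k + 1) → TotV k n := fun j => if j ∈ s then u' j else u j with hw
      have e1 : (fun i => if i ∈ insert j s then u' i else u i) = Function.update w j (u' j) := by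
        funext l
        by_cases hlj : l = j
        · subst hlj; simp
        · simp [hlj, hw]
      have e2 : w = Function.update w j (u' j + (u j - u' j)) := by simp [hw, hj]
      rw [e1]
      conv_lhs => rw [e2]
      rw [ContinuousAlternatingMap.map_update_add]
      have : α.form (Function.update w j (u j - u' j)) = 0 := by
        refine α.2 _ i j hij ?_ ?_
        · rw [Function.update_of_ne hij]
          simpa [hw, his'] using hi
        · simp [h j]
      rw [this, add_zero]
  rw [key (Finset.univ.erase i) (by simp)]
  congr 1
  funext j
  by_cases hj : j = i
  · subst hj; simp [hu]
  · simp [hj]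

theorem form_cons_vertical {α : ExtMom k n} (hr : resOfExt α = 0) {u : Fin (k + 1) → TotV k n}
    {i : Fin (k + 1)} (hi : (u i).1 = 0) : α.form u = 0 := by
  have e : u = i.insertNth (u i) (i.removeNth u) := by simp
  rw [e, ContinuousAlternatingMap.map_insertNth]
  have h1 : α.form (Matrix.vecCons (u i) (i.removeNth u)) =
      α.form (Matrix.vecCons (0, (u i).2) (fun j => (((i.removeNth u) j).1, 0))) := by
    refine form_eq_of_snd (i := 0) hi (Prod.ext hi rfl) fun j => ?_
    refine Fin.cases ?_ (fun j => ?_) j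
    · exact hi
    · rfl
  rw [h1, ← resOfExt_apply, hr]
  simp

/-- This is the fact that the kernel of `resOfExt` consists of the basic forms, which justifies
`ResMom` as a model of the quotient. The basic form is recovered by pulling back along the zero jet.
-/
theorem form_eq_of_resOfExt_eq_zero {α : ExtMom k n} (hr : resOfExt α = 0) :
    α.form = (jetPull 0 α).compContinuousLinearMap
      (ContinuousLinearMap.fst ℝ (BaseV k) (FibV n)) := by
  have h := eq_comp_of_curryLeft_eq_zero (a := ContinuousLinearMap.inl ℝ (BaseV k) (FibV n))
    (b := ContinuousLinearMap.fst ℝ (BaseV k) (FibV n)) (fun u => rfl) (η := α.form) (by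
      intro Y hY
      ext u
      exact form_cons_vertical hr (i := 0) (by simpa using hY))
  rw [h]
  ext u
  rfl

/-- The function v ↦ `jetPull v α` on jets determines the multimomentum. Equalities between extended
multimomenta are checked through it, which avoids coordinates. -/
theorem extMom_eq_of_jetPull {α β : ExtMom k n} (h : ∀ v, jetPull v α = jetPull v β) :
    α = β := by
  rw [← sub_eq_zero]
  have h0 : ∀ v, jetPull v (α - β) = 0 := by
    intro v
    rw [← jetPullL_apply, map_sub, jetPullL_apply, jetPullL_apply, h, sub_self]
  have hr : resOfExt (α - β) = 0 := by
    ext e : 1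
    refine act_eq_zero fun j => ?_
    -- The rank-one jet x ↦ x^j e differs from the zero jet only on the j-th basis vector.
    -- Subtracting the two evaluations isolates the coefficient of `resOfExt` with ∂/∂x^j omitted.
    have h1 := DFunLike.congr_fun
      (h0 (ContinuousLinearMap.smulRight (EuclideanSpace.proj j : BaseV k →L[ℝ] ℝ) e))
      (Matrix.vecCons (baseVec j) (fun i => baseVec (j.succAbove i)))
    have h2 := DFunLike.congr_fun (h0 0)
      (Matrix.vecCons (baseVec j) (fun i => baseVec (j.succAbove i)))
    rw [jetPull_apply] at h1 h2
    have e1 : (fun i => ((Matrix.vecCons (baseVec j) (fun i => baseVec (j.succAbove i)) :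
        Fin (k + 1) → BaseV k) i,
        ContinuousLinearMap.smulRight (EuclideanSpace.proj j : BaseV k →L[ℝ] ℝ) e
          ((Matrix.vecCons (baseVec j) (fun i => baseVec (j.succAbove i)) :
        Fin (k + 1) → BaseV k) i))) =
        Matrix.vecCons ((baseVec j, 0) + (0, e)) (fun i => (baseVec (j.succAbove i), (0 : FibV n))) := by
      funext i
      refine Fin.cases ?_ (fun i => ?_) i
      · simp [baseVec_apply]
      · simp [baseVec_apply, Fin.ne_succAbove]
    have e2 : (fun i => ((Matrix.vecCons (baseVec j) (fun i => baseVec (j.succAbove i)) :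
        Fin (k + 1) → BaseV k) i, (0 : Jet k n)
          ((Matrix.vecCons (baseVec j) (fun i => baseVec (j.succAbove i)) :
        Fin (k + 1) → BaseV k) i))) =
        Matrix.vecCons (baseVec j, 0) (fun i => (baseVec (j.succAbove i), (0 : FibV n))) := by
      funext i
      refine Fin.cases ?_ (fun i => ?_) i <;> simp
    rw [e1, ← ContinuousAlternatingMap.curryLeft_apply_apply, map_add] at h1
    rw [e2] at h2
    rw [ContinuousAlternatingMap.add_apply, ContinuousAlternatingMap.curryLeft_apply_apply,
      ContinuousAlternatingMap.curryLeft_apply_apply, h2] at h1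
    rw [resOfExt_apply]
    simpa using h1
  apply ExtMom.ext_form
  rw [form_eq_of_resOfExt_eq_zero hr, h0]
  rfl

/-- The extended multimomentum with `jetPull v' = (ℓ + D (v' - v)) vol`. -/
def affineMom (vol : Vol k) (ℓ : ℝ) (D : Jet k n →L[ℝ] ℝ) (v : Jet k n) : ExtMom k n :=
  ⟨affineForm vol ℓ D v, affineForm_mem vol ℓ D v⟩

theorem vol_update_baseVec (vol : Vol k) (ν i : Fin (k + 1)) :
    (-1 : ℤ) ^ (i : ℕ) • vol (Matrix.vecCons (baseVec ν) (i.removeNth baseVec)) =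
      if ν = i then vol baseVec else 0 := by
  rw [← ContinuousAlternatingMap.map_insertNth]
  split_ifs with h
  · subst h; simp
  · refine vol.map_eq_zero_of_eq _ (i := i) (j := ν) ?_ (Ne.symm h)
    simp [Function.update_of_ne h]

/-- The formula through which `affineForm` is used: C = p + p^μ_A y^A_μ becomes the affine function
ℓ + D (v' - v). With ℓ = L and D = ∂L it is the first-order Taylor polynomial of L at v. -/
theorem jetPull_affineMom (vol : Vol k) (ℓ : ℝ) (D : Jet k n →L[ℝ] ℝ) (v v' : Jet k n) :
    jetPull v' (affineMom vol ℓ D v) = (ℓ + D (v' - v)) • vol := by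
  have hsum : ∑ ν : Fin (k + 1), ContinuousLinearMap.smulRight
      (EuclideanSpace.proj ν : BaseV k →L[ℝ] ℝ) ((v' - v) (baseVec ν)) = v' - v := by
    ext x : 1
    conv_rhs => rw [← sum_smul_baseVec x]
    simp [map_sum]
  apply vol_ext
  rw [jetPull_apply]
  show affineForm vol ℓ D v _ = _
  have hw : ∀ ν : Fin (k + 1), wedgeOne (contactForm D v ν)
      ((vol.curryLeft (baseVec ν)).compContinuousLinearMap
        (ContinuousLinearMap.fst ℝ (BaseV k) (FibV n))) (fun i => (baseVec i, v' (baseVec i))) =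
      D (ContinuousLinearMap.smulRight
      (EuclideanSpace.proj ν : BaseV k →L[ℝ] ℝ) ((v' - v) (baseVec ν))) * vol baseVec := by
    intro ν
    rw [wedgeOne, ContinuousAlternatingMap.alternatizeUncurryFin_apply]
    -- On the lifted vectors (x, v' x) the contact form of `v` sees only (v' - v) x. The other
    -- factor is `vol` with ∂/∂x^ν in the i-th slot, so only i = ν contributes.
    have h1 : ∀ i : Fin (k + 1), (-1 : ℤ) ^ (i : ℕ) • ((contactForm D v ν).smulRight
        ((vol.curryLeft (baseVec ν)).compContinuousLinearMap
        (ContinuousLinearMap.fst ℝ (BaseV k) (FibV n)))) (baseVec i, v' (baseVec i))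
        (i.removeNth fun i => (baseVec i, v' (baseVec i))) =
        D (ContinuousLinearMap.smulRight
          (EuclideanSpace.proj ν : BaseV k →L[ℝ] ℝ) ((v' - v) (baseVec i))) *
        (if ν = i then vol baseVec else 0) := by
      intro i
      rw [← vol_update_baseVec, mul_smul_comm]
      rfl
    simp only [h1]
    simp
  simp only [affineForm, ContinuousAlternatingMap.add_apply, ContinuousAlternatingMap.sum_apply,
    hw]
  rw [← Finset.sum_mul, ← map_sum, hsum, ContinuousAlternatingMap.smul_apply, add_smul, add_comm]
  rfl

theorem finrank_act_le (k : ℕ) : Module.finrank ℝ (Act k) ≤ k + 1 := by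
  let f : Act k →ₗ[ℝ] (Fin (k + 1) → ℝ) :=
    { toFun := fun s j => s (fun i => baseVec (j.succAbove i))
      map_add' := fun _ _ => rfl
      map_smul' := fun _ _ => rfl }
  have hf : Function.Injective f := by
    rw [← LinearMap.ker_eq_bot, LinearMap.ker_eq_bot']
    intro s hs
    exact act_eq_zero fun j => congrFun hs j
  simpa using LinearMap.finrank_le_finrank_of_injective hf

/-- Only this inequality is needed: wherever dimensions are compared, the opposite one comes from an
injective linear map. -/
theorem finrank_resMom_le (k n : ℕ) :
    Module.finrank ℝ (ResMom k n) ≤ Module.finrank ℝ (Jet k n) := by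
  rw [← (LinearMap.toContinuousLinearMap (𝕜 := ℝ) (E := FibV n) (F' := Act k)).finrank_eq,
    ← (LinearMap.toContinuousLinearMap (𝕜 := ℝ) (E := BaseV k) (F' := FibV n)).finrank_eq,
    Module.finrank_linearMap, Module.finrank_linearMap]
  simp only [finrank_euclideanSpace, Fintype.card_fin]
  rw [mul_comm]
  exact Nat.mul_le_mul_right n (finrank_act_le k)

theorem jet_eq_of_forall {v v' : Jet k n} (h : ∀ D : Jet k n →L[ℝ] ℝ, D (v' - v) = 0) :
    v' = v := by
  rw [← sub_eq_zero]
  by_contra h0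
  obtain ⟨g, hg⟩ := SeparatingDual.exists_ne_zero (R := ℝ) h0
  exact hg (h g)

end Fibres

/-! ### Tangent maps, exterior derivatives, and transport of fields along fibred maps. -/

section ManifoldCalculus

open Filter

variable {V V' V'' : Type*} [NormedAddCommGroup V] [NormedSpace ℝ V]
  [NormedAddCommGroup V'] [NormedSpace ℝ V'] [NormedAddCommGroup V''] [NormedSpace ℝ V'']
  {H H' H'' : Type*} [TopologicalSpace H] [TopologicalSpace H'] [TopologicalSpace H'']
  {I : ModelWithCorners ℝ V H} {I' : ModelWithCorners ℝ V' H'} {I'' : ModelWithCorners ℝ V'' H''}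
  {Q Q' Q'' : Type*} [TopologicalSpace Q] [ChartedSpace H Q] [TopologicalSpace Q']
  [ChartedSpace H' Q'] [TopologicalSpace Q''] [ChartedSpace H'' Q'']

theorem tmap_comp {g : Q' → Q''} {f : Q → Q'} {q : Q} (hg : MDifferentiableAt I' I'' g (f q))
    (hf : MDifferentiableAt I I' f q) :
    tmap I I'' (fun x => g (f x)) q = (tmap I' I'' g (f q)).comp (tmap I I' f q) :=
  mfderiv_comp q hg hf

theorem tmap_congr {f g : Q → Q'} {q : Q} (h : f =ᶠ[nhds q] g) : tmap I I' f q = tmap I I' g q :=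
  h.mfderiv_eq

theorem tmap_id (q : Q) : tmap I I (fun x => x) q = ContinuousLinearMap.id ℝ V :=
  mfderiv_id

theorem tmap_eq_fderiv (f : V → V') (z : V) : tmap 𝓘(ℝ, V) 𝓘(ℝ, V') f z = fderiv ℝ f z :=
  mfderiv_eq_fderiv

theorem mdifferentiableAt_of_contMDiffOn {f : Q → Q'} {O : Set Q} {q : Q}
    (hf : ContMDiffOn I I' ∞ f O) (hO : IsOpen O) (hq : q ∈ O) : MDifferentiableAt I I' f q :=
  (hf.contMDiffAt (hO.mem_nhds hq)).mdifferentiableAt (by simp)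

theorem tmap_extChartAt_self [IsManifold I ∞ Q] [I.Boundaryless] (q : Q) :
    tmap I 𝓘(ℝ, V) (extChartAt I q) q = ContinuousLinearMap.id ℝ V := by
  have : IsManifold I 1 Q := IsManifold.of_le (n := ∞) (by simp)
  exact mfderiv_extChartAt_self

theorem mdifferentiableAt_extChart [IsManifold I ∞ Q] {q q' : Q}
    (h : q' ∈ (extChartAt I q).source) :
    MDifferentiableAt I 𝓘(ℝ, V) (extChartAt I q) q' := by
  have : IsManifold I 1 Q := IsManifold.of_le (n := ∞) (by simp)
  exact mdifferentiableAt_extChartAt (by simpa using h)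

theorem mdifferentiableAt_extChart_symm [IsManifold I ∞ Q] [I.Boundaryless] {q : Q} {z : V}
    (h : z ∈ (extChartAt I q).target) :
    MDifferentiableAt 𝓘(ℝ, V) I (extChartAt I q).symm z :=
  mdifferentiableAt_of_contMDiffOn (contMDiffOn_extChartAt_symm q)
    (isOpen_extChartAt_target q) h

theorem tmap_extChart_comp_symm [IsManifold I ∞ Q] [I.Boundaryless] {q : Q} {z : V}
    (h : z ∈ (extChartAt I q).target) :
    (tmap I 𝓘(ℝ, V) (extChartAt I q) ((extChartAt I q).symm z)).comp
      (tmap 𝓘(ℝ, V) I (extChartAt I q).symm z) = ContinuousLinearMap.id ℝ V := by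
  rw [← tmap_comp (mdifferentiableAt_extChart ((extChartAt I q).map_target h))
    (mdifferentiableAt_extChart_symm h), ← tmap_id (I := 𝓘(ℝ, V)) z]
  apply tmap_congr
  filter_upwards [(isOpen_extChartAt_target q).mem_nhds h] with z' hz'
  exact (extChartAt I q).right_inv hz'

theorem tmap_symm_comp_extChart [IsManifold I ∞ Q] [I.Boundaryless] {q q' : Q}
    (h : q' ∈ (extChartAt I q).source) :
    (tmap 𝓘(ℝ, V) I (extChartAt I q).symm (extChartAt I q q')).comp
      (tmap I 𝓘(ℝ, V) (extChartAt I q) q') = ContinuousLinearMap.id ℝ V := by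
  rw [← tmap_comp (mdifferentiableAt_extChart_symm ((extChartAt I q).map_source h))
    (mdifferentiableAt_extChart h), ← tmap_id (I := I) q']
  apply tmap_congr
  filter_upwards [(isOpen_extChartAt_source q).mem_nhds h] with z' hz'
  exact (extChartAt I q).left_inv hz'

theorem formInChart_self (Θ : V → V [⋀^Fin r]→L[ℝ] ℝ) (q : V) :
    formInChart 𝓘(ℝ, V) Θ q = Θ := by
  funext z
  simp only [formInChart, extChartAt_model_space_eq_id]
  rw [show tmap 𝓘(ℝ, V) 𝓘(ℝ, V) (PartialEquiv.refl V).symm z = ContinuousLinearMap.id ℝ V from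
    tmap_id z]
  rfl

theorem extD_self (Θ : V → V [⋀^Fin r]→L[ℝ] ℝ) (q : V) :
    extD 𝓘(ℝ, V) Θ q = extDeriv Θ q := by
  rw [extD, formInChart_self, tmap_extChartAt_self]
  rfl

/-- The exterior derivative commutes with pull-backs. -/
theorem extD_pullback [IsManifold I ∞ Q] [I.Boundaryless] [IsManifold I' ∞ Q'] [I'.Boundaryless]
    {r : ℕ} {f : Q → Q'} {O : Set Q} (hO : IsOpen O) (hf : ContMDiffOn I I' ∞ f O)
    {Θ : Q → V [⋀^Fin r]→L[ℝ] ℝ} {Θ' : Q' → V' [⋀^Fin r]→L[ℝ] ℝ}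
    (hΘ : ∀ q ∈ O, Θ q = (Θ' (f q)).compContinuousLinearMap (tmap I I' f q)) {q : Q} (hq : q ∈ O)
    (hd : DifferentiableAt ℝ (formInChart I' Θ' (f q)) (extChartAt I' (f q) (f q))) :
    extD I Θ q = (extD I' Θ' (f q)).compContinuousLinearMap (tmap I I' f q) := by
  -- `F` expresses `f` in the preferred charts at `q` and `f q`. In these charts the claim is the
  -- pull-back formula for `extDeriv`.
  set F : V → V' := fun z => extChartAt I' (f q) (f ((extChartAt I q).symm z)) with hF
  set z₀ := extChartAt I q q with hz₀
  have hz₀t : z₀ ∈ (extChartAt I q).target := mem_extChartAt_target q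
  have hsz₀ : (extChartAt I q).symm z₀ = q := extChartAt_to_inv q
  have hFz₀ : F z₀ = extChartAt I' (f q) (f q) := by
    simp only [hF]
    rw [hsz₀]
  set D : Set V := (extChartAt I q).target ∩ (extChartAt I q).symm ⁻¹'
    (O ∩ f ⁻¹' (extChartAt I' (f q)).source) with hD
  have hDo : IsOpen D := (continuousOn_extChartAt_symm q).isOpen_inter_preimage
    (isOpen_extChartAt_target q)
    (hf.continuousOn.isOpen_inter_preimage hO (isOpen_extChartAt_source (f q)))
  have hz₀D : z₀ ∈ D := ⟨hz₀t, by
    simp only [mem_preimage, hsz₀]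
    exact ⟨hq, mem_extChartAt_source (f q)⟩⟩
  have hFs : ContDiffOn ℝ ∞ F D := by
    rw [← contMDiffOn_iff_contDiffOn]
    refine (contMDiffOn_extChartAt (I := I') (x := f q)).comp (hf.comp
      ((contMDiffOn_extChartAt_symm q).mono inter_subset_left) fun z hz => hz.2.1) fun z hz => ?_
    simpa using hz.2.2
  have hfz : ∀ z ∈ D, (extChartAt I' (f q)).symm (F z) = f ((extChartAt I q).symm z) :=
    fun z hz => (extChartAt I' (f q)).left_inv hz.2.2
  have hev : formInChart I Θ q =ᶠ[nhds z₀] fun z =>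
      (formInChart I' Θ' (f q) (F z)).compContinuousLinearMap (fderiv ℝ F z) := by
    filter_upwards [hDo.mem_nhds hz₀D] with z hz
    have hFd : DifferentiableAt ℝ F z := (hFs.contDiffAt (hDo.mem_nhds hz)).differentiableAt (by simp)
    have e1 : (tmap I I' f ((extChartAt I q).symm z)).comp (tmap 𝓘(ℝ, V) I (extChartAt I q).symm z) =
        (tmap 𝓘(ℝ, V') I' (extChartAt I' (f q)).symm (F z)).comp (fderiv ℝ F z) := by
      rw [← tmap_comp (mdifferentiableAt_of_contMDiffOn hf hO hz.2.1)
        (mdifferentiableAt_extChart_symm hz.1), ← tmap_eq_fderiv,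
        ← tmap_comp (g := (extChartAt I' (f q)).symm) (f := F)
        (mdifferentiableAt_extChart_symm ((extChartAt I' (f q)).map_source hz.2.2))
        hFd.mdifferentiableAt]
      apply tmap_congr
      filter_upwards [hDo.mem_nhds hz] with z' hz'
      exact (hfz z' hz').symm
    simp only [formInChart]
    rw [hΘ _ hz.2.1, hfz z hz]
    exact congrArg (fun A => (Θ' (f ((extChartAt I q).symm z))).compContinuousLinearMap A) e1
  have hFd : DifferentiableAt ℝ F z₀ :=
    (hFs.contDiffAt (hDo.mem_nhds hz₀D)).differentiableAt (by simp)
  rw [extD, hev.extDeriv_eq, extDeriv_pullback (r := ∞) (by rwa [hFz₀])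
    (hFs.contDiffAt (hDo.mem_nhds hz₀D)) (by
      rw [minSmoothness_of_isRCLikeNormedField]
      exact WithTop.coe_le_coe.2 le_top), hFz₀, extD, tmap_extChartAt_self,
    tmap_extChartAt_self]
  -- A preferred chart has identity derivative at its own base point, so the derivative of `F` there
  -- is the tangent map itself.
  have e2 : fderiv ℝ F z₀ = tmap I I' f q := by
    have h1 : tmap 𝓘(ℝ, V) I (extChartAt I q).symm z₀ = ContinuousLinearMap.id ℝ V := by
      have := tmap_symm_comp_extChart (I := I) (mem_extChartAt_source (I := I) q)
      rwa [tmap_extChartAt_self] at this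
    have hfd : MDifferentiableAt I I' f ((extChartAt I q).symm z₀) := by
      rw [hsz₀]; exact mdifferentiableAt_of_contMDiffOn hf hO hq
    have hcd : MDifferentiableAt I' 𝓘(ℝ, V') (extChartAt I' (f q)) (f ((extChartAt I q).symm z₀)) := by
      rw [hsz₀]; exact mdifferentiableAt_extChart (mem_extChartAt_source (f q))
    rw [← tmap_eq_fderiv, hF, tmap_comp (g := extChartAt I' (f q))
      (f := fun z => f ((extChartAt I q).symm z)) hcd
      (hfd.comp z₀ (mdifferentiableAt_extChart_symm hz₀t)), tmap_comp hfd
      (mdifferentiableAt_extChart_symm hz₀t), h1, hsz₀, tmap_extChartAt_self]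
    rfl
  rw [e2]
  rfl

/-- Two subsets `S`, `S'` of manifolds over `N` that are identified by smooth maps `f` and `g`,
which are defined on neighbourhoods of these subsets. -/
structure FibredCorr (I : ModelWithCorners ℝ V H) (I' : ModelWithCorners ℝ V' H')
    (J : ModelWithCorners ℝ V'' H'')
    (τ : Q → Q'') (τ' : Q' → Q'') (f : Q → Q') (g : Q' → Q) (S O : Set Q) (S' O' : Set Q') :
    Prop where
  isOpen : IsOpen O
  isOpen' : IsOpen O'
  subset : S ⊆ O
  subset' : S' ⊆ O'
  smooth : ContMDiffOn I I' ∞ f O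
  smooth' : ContMDiffOn I' I ∞ g O'
  mapsTo : MapsTo f S S'
  mapsTo' : MapsTo g S' S
  leftInv : ∀ q ∈ S, g (f q) = q
  rightInv : ∀ q' ∈ S', f (g q') = q'
  proj : ∀ q ∈ O, τ' (f q) = τ q
  proj' : ∀ q' ∈ O', τ (g q') = τ' q'
  smooth_proj : ContMDiff I J ∞ τ
  smooth_proj' : ContMDiff I' J ∞ τ'

variable {J : ModelWithCorners ℝ V'' H''} {τ : Q → Q''} {τ' : Q' → Q''} {f : Q → Q'} {g : Q' → Q}
  {S O : Set Q} {S' O' : Set Q'}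

theorem FibredCorr.symm (h : FibredCorr I I' J τ τ' f g S O S' O') :
    FibredCorr I' I J τ' τ g f S' O' S O :=
  ⟨h.isOpen', h.isOpen, h.subset', h.subset, h.smooth', h.smooth, h.mapsTo', h.mapsTo, h.rightInv,
    h.leftInv, h.proj', h.proj, h.smooth_proj', h.smooth_proj⟩

theorem FibredCorr.tmap_proj (h : FibredCorr I I' J τ τ' f g S O S' O') {q : Q} (hq : q ∈ O) :
    (tmap I' J τ' (f q)).comp (tmap I I' f q) = tmap I J τ q := by
  rw [← tmap_comp (h.smooth_proj'.mdifferentiable (by simp) _)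
    (mdifferentiableAt_of_contMDiffOn h.smooth h.isOpen hq)]
  apply tmap_congr
  filter_upwards [h.isOpen.mem_nhds hq] with x hx
  exact h.proj x hx

theorem FibredCorr.pullAlong (h : FibredCorr I I' J τ τ' f g S O S' O') {r : ℕ}
    (vol : Q'' → V'' [⋀^Fin r]→L[ℝ] ℝ) {q : Q} (hq : q ∈ O) :
    (pullAlong I' J τ' (fun p => vol (τ' p)) (f q)).compContinuousLinearMap (tmap I I' f q) =
      Multicontact.pullAlong I J τ (fun p => vol (τ p)) q := by
  rw [Multicontact.pullAlong, Multicontact.pullAlong, ← h.tmap_proj hq, h.proj q hq]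
  rfl

/-- Since `f` covers the identity of the common base, it pulls the volume form back to the volume
form. -/
theorem FibredCorr.transverseOn (h : FibredCorr I I' J τ τ' f g S O S' O') {r : ℕ}
    {vol : Q'' → V'' [⋀^Fin r]→L[ℝ] ℝ} {X : Q → Multivector r V} {X' : Q' → Multivector r V'}
    (hX : TransverseOn I J τ vol X S)
    (hXX' : ∀ q' ∈ S', X' q' = (X (g q')).map (tmap I I' f (g q'))) :
    TransverseOn I' J τ' vol X' S' := by
  intro q' hq'
  have h1 := hX (g q') (h.mapsTo' hq')
  rw [← h.pullAlong vol (h.subset (h.mapsTo' hq'))] at h1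
  rw [hXX' q' hq', Multivector.map_apply]
  rwa [h.rightInv q' hq'] at h1

/-- The local frame is transported by Tf. Away from `S'` the point `f (g q')` need not be `q'`, so
Tf applied to `Y i (g q')` is a vector at the wrong point. It is therefore read in the fixed chart
`c'` and planted at `q'`, which changes nothing on `S'` and gives smooth fields on an open set. -/
theorem FibredCorr.locallyDecomposableOn [IsManifold I ∞ Q] [I.Boundaryless] [IsManifold I' ∞ Q']
    [I'.Boundaryless] (h : FibredCorr I I' J τ τ' f g S O S' O') {r : ℕ}
    {X : Q → Multivector r V} {X' : Q' → Multivector r V'}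
    (hX : LocallyDecomposableOn I X S)
    (hXX' : ∀ q' ∈ S', X' q' = (X (g q')).map (tmap I I' f (g q'))) :
    LocallyDecomposableOn I' X' S' := by
  intro q₀ hq₀
  obtain ⟨P, hPo, hPq, hPs, Y, hY, hXY⟩ := hX (g q₀) (h.mapsTo' hq₀)
  set c := extChartAt I (g q₀) with hc
  set c' := extChartAt I' q₀ with hc'
  set F : V → V' := fun z => c' (f (c.symm z)) with hF
  set D : Set V := c.target ∩ c.symm ⁻¹' (O ∩ f ⁻¹' c'.source) with hD
  have hDo : IsOpen D := (continuousOn_extChartAt_symm _).isOpen_inter_preimage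
    (isOpen_extChartAt_target _)
    (h.smooth.continuousOn.isOpen_inter_preimage h.isOpen (isOpen_extChartAt_source _))
  have hFs : ContDiffOn ℝ ∞ F D := by
    rw [← contMDiffOn_iff_contDiffOn]
    refine (contMDiffOn_extChartAt (I := I') (x := q₀)).comp (h.smooth.comp
      ((contMDiffOn_extChartAt_symm _).mono inter_subset_left) fun z hz => hz.2.1) fun z hz => ?_
    simpa [hc'] using hz.2.2
  have hP2 : IsOpen (P ∩ (O ∩ f ⁻¹' c'.source)) := hPo.inter
    (h.smooth.continuousOn.isOpen_inter_preimage h.isOpen (isOpen_extChartAt_source _))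
  set R : Set Q' := (O' ∩ g ⁻¹' (P ∩ (O ∩ f ⁻¹' c'.source))) ∩ c'.source with hR
  have hRo : IsOpen R := (h.smooth'.continuousOn.isOpen_inter_preimage h.isOpen' hP2).inter
    (isOpen_extChartAt_source _)
  have hRD : ∀ q' ∈ R, c (g q') ∈ D := by
    intro q' hq'
    have hs : g q' ∈ c.source := hPs hq'.1.2.1
    refine ⟨c.map_source hs, ?_⟩
    simp only [mem_preimage, c.left_inv hs]
    exact hq'.1.2.2
  refine ⟨R, hRo, ⟨⟨h.subset' hq₀, hPq, h.subset (h.mapsTo' hq₀), ?_⟩, mem_extChartAt_source q₀⟩,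
    inter_subset_right, fun i q' => tmap 𝓘(ℝ, V') I' c'.symm (c' q')
      (fderiv ℝ F (c (g q')) (tmap I 𝓘(ℝ, V) c (g q') (Y i (g q')))), ?_, ?_⟩
  · simp only [mem_preimage, h.rightInv q₀ hq₀]
    exact mem_extChartAt_source q₀
  · intro i
    have hg : ContMDiffOn I' I ∞ g R := h.smooth'.mono fun q' hq' => hq'.1.1
    have h1 : ContMDiffOn I' 𝓘(ℝ, V) ∞ (fun q' => tmap I 𝓘(ℝ, V) c (g q') (Y i (g q'))) R :=
      (hY i).comp hg fun q' hq' => hq'.1.2.1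
    have h2 : ContMDiffOn I' 𝓘(ℝ, V) ∞ (fun q' => c (g q')) R :=
      (contMDiffOn_extChartAt (I := I)).comp hg fun q' hq' => by
        simpa [hc] using hPs hq'.1.2.1
    have h3 : ContMDiffOn 𝓘(ℝ, V) 𝓘(ℝ, V →L[ℝ] V') ∞ (fderiv ℝ F) D :=
      (hFs.fderiv_of_isOpen hDo (by simp)).contMDiffOn
    have h4 : ContMDiffOn I' 𝓘(ℝ, V →L[ℝ] V') ∞ (fun q' => fderiv ℝ F (c (g q'))) R :=
      h3.comp h2 hRD
    refine (h4.clm_apply h1).congr fun q' hq' => ?_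
    have h5 := DFunLike.congr_fun (tmap_extChart_comp_symm (I := I') (q := q₀)
      (c'.map_source hq'.2)) (fderiv ℝ F (c (g q')) (tmap I 𝓘(ℝ, V) c (g q') (Y i (g q'))))
    rw [← hc', c'.left_inv hq'.2] at h5
    exact h5
  · intro q' hq'
    rw [hXX' q' hq'.2, hXY (g q') ⟨hq'.1.1.2.1, h.mapsTo' hq'.2⟩, map_wedgeVec]
    congr 1
    funext i
    have hs : g q' ∈ c.source := hPs hq'.1.1.2.1
    have hzD := hRD q' hq'.1
    have hFd : DifferentiableAt ℝ F (c (g q')) :=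
      (hFs.contDiffAt (hDo.mem_nhds hzD)).differentiableAt (by simp)
    have e : (tmap 𝓘(ℝ, V') I' c'.symm (c' q')).comp ((fderiv ℝ F (c (g q'))).comp
        (tmap I 𝓘(ℝ, V) c (g q'))) = tmap I I' f (g q') := by
      have hFc : F (c (g q')) = c' q' := by
        simp only [hF]
        rw [c.left_inv hs, h.rightInv q' hq'.2]
      rw [← tmap_eq_fderiv, ← tmap_comp (g := F) (f := c) hFd.mdifferentiableAt
        (mdifferentiableAt_extChart hs), ← hFc, ← tmap_comp (g := c'.symm) (f := fun x => F (c x)) ?_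
        (hFd.mdifferentiableAt.comp (g q') (mdifferentiableAt_extChart hs))]
      · apply tmap_congr
        have hN : IsOpen (P ∩ (O ∩ f ⁻¹' c'.source)) := hP2
        filter_upwards [hN.mem_nhds hq'.1.1.2] with x hx
        simp only [hF]
        rw [c.left_inv (hPs hx.1), c'.left_inv hx.2.2]
      · rw [hFc]
        exact mdifferentiableAt_extChart_symm (c'.map_source hq'.1.2)
    rw [← e]
    rfl

/-- Integral sections are composed with `f`; the multivector `Z` on the base that witnesses
integrality stays the same. -/
theorem FibredCorr.integrableOn [IsManifold I ∞ Q] [I.Boundaryless] [IsManifold I' ∞ Q']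
    [I'.Boundaryless] (h : FibredCorr I I' J τ τ' f g S O S' O') {r : ℕ}
    {X : Q → Multivector r V} {X' : Q' → Multivector r V'}
    (hX : IntegrableOn I J τ X S)
    (hXX' : ∀ q' ∈ S', X' q' = (X (g q')).map (tmap I I' f (g q'))) :
    IntegrableOn I' J τ' X' S' := by
  refine ⟨h.locallyDecomposableOn hX.1 hXX', fun q' hq' => ?_⟩
  obtain ⟨P, ψ, hψ, hP, hψq⟩ := hX.2 (g q') (h.mapsTo' hq')
  rw [h.proj' q' (h.subset' hq')] at hP hψq
  refine ⟨P, fun x => f (ψ x), ⟨hψ.isOpen, ?_, ?_, ?_, ?_⟩, hP, ?_⟩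
  · exact h.smooth.comp hψ.smooth fun x hx => h.subset (hψ.mapsTo x hx)
  · exact fun x hx => h.mapsTo (hψ.mapsTo x hx)
  · intro x hx
    rw [h.proj _ (h.subset (hψ.mapsTo x hx)), hψ.isSection x hx]
  · intro x hx
    obtain ⟨Z, hZ⟩ := hψ.integral x hx
    refine ⟨Z, ?_⟩
    rw [hXX' _ (h.mapsTo (hψ.mapsTo x hx)), h.leftInv _ (hψ.mapsTo x hx), hZ, Multivector.map_map,
      tmap_comp (mdifferentiableAt_of_contMDiffOn h.smooth h.isOpen (h.subset (hψ.mapsTo x hx)))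
        (mdifferentiableAt_of_contMDiffOn hψ.smooth hψ.isOpen hx)]
  · show f (ψ (τ' q')) = q'
    rw [hψq, h.rightInv q' hq']

theorem tangentToSet_of_isOpen [IsManifold I ∞ Q] [I.Boundaryless] (hS : IsOpen S) {q : Q}
    (hq : q ∈ S) (u : V) : TangentToSet I S q u := by
  set c := extChartAt I q with hc
  have hl : ContDiff ℝ ∞ (fun t : ℝ => c q + t • u) := by fun_prop
  have h0 : c q + (0 : ℝ) • u = c q := by simp
  have hsm : ContMDiffAt 𝓘(ℝ, V) I ∞ c.symm (c q + (0 : ℝ) • u) := by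
    rw [h0]
    exact (contMDiffOn_extChartAt_symm q).contMDiffAt
      ((isOpen_extChartAt_target q).mem_nhds (mem_extChartAt_target q))
  have hcm : ContMDiffAt 𝓘(ℝ, ℝ) I ∞ (fun t : ℝ => c.symm (c q + t • u)) 0 :=
    hsm.comp (0 : ℝ) hl.contMDiff.contMDiffAt
  have hcs : c.symm (c q) = q := extChartAt_to_inv q
  refine ⟨fun t => c.symm (c q + t • u), by simp [hcs], ?_, hcm, ?_⟩
  · refine hcm.continuousAt.eventually_mem (hS.mem_nhds ?_)
    simpa [hcs] using hq
  · have h1 : tmap 𝓘(ℝ, V) I c.symm (c q) = ContinuousLinearMap.id ℝ V := by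
      have := tmap_symm_comp_extChart (I := I) (mem_extChartAt_source (I := I) q)
      rwa [tmap_extChartAt_self] at this
    have h2 : tmap 𝓘(ℝ, ℝ) 𝓘(ℝ, V) (fun t : ℝ => c q + t • u) 0 1 = u := by
      rw [tmap_eq_fderiv]
      have : HasDerivAt (fun t : ℝ => c q + t • u) u 0 := by
        simpa using ((hasDerivAt_id (0 : ℝ)).smul_const u).const_add (c q)
      rw [this.hasFDerivAt.fderiv]
      simp
    rw [tmap_comp (g := c.symm) (f := fun t : ℝ => c q + t • u)
      (hsm.mdifferentiableAt (by simp)) (hl.contMDiff.mdifferentiable (by simp) _), h0, h1]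
    simpa using h2

theorem TangentToSet.map {q : Q} {u : V} (hu : TangentToSet I S q u) (hS : MapsTo f S S')
    (hf : ContMDiffAt I I' ∞ f q) : TangentToSet I' S' (f q) (tmap I I' f q u) := by
  obtain ⟨γ, h0, hγ, hs, rfl⟩ := hu
  subst h0
  refine ⟨fun t => f (γ t), rfl, hγ.mono fun t ht => hS ht, hf.comp 0 hs, ?_⟩
  rw [tmap_comp (hf.mdifferentiableAt (by simp)) (hs.mdifferentiableAt (by simp))]
  rfl

/-- Vectors tangent to a set on which `f` is the identity are fixed by the tangent map of `f`. -/
theorem TangentToSet.tmap_eq {f : Q → Q} {q : Q} {u : V} (hu : TangentToSet I S q u)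
    (hS : ∀ x ∈ S, f x = x) (hf : ContMDiffAt I I ∞ f q) : tmap I I f q u = u := by
  obtain ⟨γ, h0, hγ, hs, rfl⟩ := hu
  subst h0
  have h1 : tmap 𝓘(ℝ, ℝ) I (fun t => f (γ t)) 0 = tmap 𝓘(ℝ, ℝ) I γ 0 := by
    apply tmap_congr
    filter_upwards [hγ] with t ht
    exact hS _ ht
  conv_rhs => rw [← h1]
  rw [tmap_comp (hf.mdifferentiableAt (by simp)) (hs.mdifferentiableAt (by simp))]
  rfl

end ManifoldCalculus

/-- As tangent spaces are read in preferred charts, the tangent map at `q` is the derivative of a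
coordinate expression in the charts at `q` and `f q`. This turns explicit formulas in bundle charts
into tangent maps. -/
theorem tmap_eq_of_chart {V V' : Type*} [NormedAddCommGroup V] [NormedSpace ℝ V]
    [NormedAddCommGroup V'] [NormedSpace ℝ V']
    {H H' : Type*} [TopologicalSpace H] [TopologicalSpace H']
    {I : ModelWithCorners ℝ V H} {I' : ModelWithCorners ℝ V' H'}
    {Q Q' : Type*} [TopologicalSpace Q] [ChartedSpace H Q] [TopologicalSpace Q']
    [ChartedSpace H' Q'] [IsManifold I ∞ Q] [I.Boundaryless] [IsManifold I' ∞ Q'] [I'.Boundaryless]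
    {f : Q → Q'} {q : Q} (hf : MDifferentiableAt I I' f q) {F : V → V'} {F' : V →L[ℝ] V'}
    (h : ∀ᶠ x in nhds q, extChartAt I' (f q) (f x) = F (extChartAt I q x))
    (hF : HasFDerivAt F F' (extChartAt I q q)) :
    tmap I I' f q = F' := by
  have h1 : tmap I 𝓘(ℝ, V') (fun x => extChartAt I' (f q) (f x)) q =
      tmap I 𝓘(ℝ, V') (fun x => F (extChartAt I q x)) q := tmap_congr h
  rw [tmap_comp (mdifferentiableAt_extChart (mem_extChartAt_source _)) hf,
    tmap_comp hF.differentiableAt.mdifferentiableAt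
      (mdifferentiableAt_extChart (mem_extChartAt_source _)), tmap_extChartAt_self,
    tmap_extChartAt_self, tmap_eq_fderiv, hF.fderiv] at h1
  exact h1

/-! ### Fibre bundles over a manifold in their preferred charts. -/

section Core

variable {N F : Type*} [NormedAddCommGroup N] [NormedSpace ℝ N] [NormedAddCommGroup F]
  [NormedSpace ℝ F] {E : Type*} [TopologicalSpace E] [ChartedSpace N E]

/-- A fibre bundle core whose local trivialisations belong to the preferred charts of the base. -/
structure ChartIndexed (Z : FiberBundleCore E E F) : Prop where
  indexAt : ∀ y, Z.indexAt y = y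
  baseSet : ∀ i, Z.baseSet i = (chartAt N i).source

/-- The coordinate changes of a fibre bundle core are smooth. -/
def SmoothCore (N : Type*) [NormedAddCommGroup N] [NormedSpace ℝ N] {E : Type*}
    [TopologicalSpace E] [ChartedSpace N E] (Z : FiberBundleCore E E F) : Prop :=
  ∀ i j, ContMDiffOn (𝓘(ℝ, N).prod 𝓘(ℝ, F)) 𝓘(ℝ, F) ∞
    (fun p : E × F => Z.coordChange i j p.1 p.2) ((Z.baseSet i ∩ Z.baseSet j) ×ˢ univ)

variable {Z : FiberBundleCore E E F}

theorem ChartIndexed.extChartAt_apply (hZ : ChartIndexed (N := N) Z) (w w' : Z.TotalSpace) :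
    extChartAt (𝓘(ℝ, N).prod 𝓘(ℝ, F)) w w' =
      (chartAt N w.1 w'.1, Z.coordChange w'.1 w.1 w'.1 w'.2) := by
  rw [FiberBundle.extChartAt]
  have : Z.coordChange w'.1 w.1 w'.1 w'.2 =
      Z.coordChange (Z.indexAt w'.1) (Z.indexAt w.1) w'.1 w'.2 := by
    rw [hZ.indexAt, hZ.indexAt]
  rw [this]
  simp only [mfld_simps]
  exact Prod.ext rfl rfl

theorem ChartIndexed.extChartAt_source (hZ : ChartIndexed (N := N) Z) (w : Z.TotalSpace) :
    (extChartAt (𝓘(ℝ, N).prod 𝓘(ℝ, F)) w).source = {w' | w'.1 ∈ (chartAt N w.1).source} := by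
  rw [FiberBundle.extChartAt]
  ext w'
  have : (trivializationAt F Z.Fiber w.1).source = {w' | w'.1 ∈ (chartAt N w.1).source} := by
    show Z.proj ⁻¹' Z.baseSet (Z.indexAt w.1) = _
    rw [hZ.baseSet, hZ.indexAt]
    rfl
  simp only [mfld_simps, this]
  exact ⟨fun h => h.1, fun h => ⟨h, h⟩⟩

theorem ChartIndexed.extChartAt_target (hZ : ChartIndexed (N := N) Z) (w : Z.TotalSpace) :
    (extChartAt (𝓘(ℝ, N).prod 𝓘(ℝ, F)) w).target = (chartAt N w.1).target ×ˢ univ := by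
  rw [FiberBundle.extChartAt_target]
  have : (trivializationAt F Z.Fiber w.1).baseSet = (chartAt N w.1).source := by
    show Z.baseSet (Z.indexAt w.1) = _
    rw [hZ.baseSet, hZ.indexAt]
  rw [this]
  congr 1
  ext z
  simp only [extChartAt, mfld_simps]
  exact ⟨fun h => h.1, fun h => ⟨h, (chartAt N w.1).map_target h⟩⟩

theorem ChartIndexed.extChartAt_symm_apply (hZ : ChartIndexed (N := N) Z) (w : Z.TotalSpace)
    (z : N × F) :
    (extChartAt (𝓘(ℝ, N).prod 𝓘(ℝ, F)) w).symm z =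
      (⟨(chartAt N w.1).symm z.1, Z.coordChange w.1 ((chartAt N w.1).symm z.1)
        ((chartAt N w.1).symm z.1) z.2⟩ : Z.TotalSpace) := by
  rw [FiberBundle.extChartAt]
  have : Z.coordChange w.1 ((chartAt N w.1).symm z.1) ((chartAt N w.1).symm z.1) z.2 =
      Z.coordChange (Z.indexAt w.1) (Z.indexAt ((chartAt N w.1).symm z.1))
        ((chartAt N w.1).symm z.1) z.2 := by
    rw [hZ.indexAt, hZ.indexAt]
  rw [this]
  simp
  rfl

theorem ChartIndexed.contMDiffAt_iff (hZ : ChartIndexed (N := N) Z) {V H Q : Type*}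
    [NormedAddCommGroup V] [NormedSpace ℝ V] [TopologicalSpace H] {I : ModelWithCorners ℝ V H}
    [TopologicalSpace Q] [ChartedSpace H Q] {f : Q → Z.TotalSpace} {q : Q} :
    ContMDiffAt I (𝓘(ℝ, N).prod 𝓘(ℝ, F)) ∞ f q ↔
      ContMDiffAt I 𝓘(ℝ, N) ∞ (fun x => (f x).1) q ∧
      ContMDiffAt I 𝓘(ℝ, F) ∞ (fun x => Z.coordChange (f x).1 (f q).1 (f x).1 (f x).2) q := by
  rw [Bundle.contMDiffAt_totalSpace]
  refine and_congr_right fun _ => ?_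
  have : (fun x => Z.coordChange (f x).1 (f q).1 (f x).1 (f x).2) =
      (fun x => (trivializationAt F Z.Fiber (f q).1 (f x)).2) := by
    funext x
    have : Z.coordChange (f x).1 (f q).1 (f x).1 (f x).2 =
      Z.coordChange (Z.indexAt (f x).1) (Z.indexAt (f q).1) (f x).1 (f x).2 := by
      rw [hZ.indexAt, hZ.indexAt]
    rw [this]
    rfl
  rw [this]

theorem SmoothCore.isManifold [IsManifold 𝓘(ℝ, N) ∞ E] (hZ : SmoothCore N Z) :
    IsManifold (𝓘(ℝ, N).prod 𝓘(ℝ, F)) ∞ Z.TotalSpace := by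
  refine isManifold_of_contDiffOn _ _ _ fun e e' he he' => ?_
  obtain ⟨t, ⟨_, ⟨i, rfl⟩, rfl⟩, c, hc, rfl⟩ := he
  obtain ⟨t', ⟨_, ⟨j, rfl⟩, rfl⟩, c', hc', rfl⟩ := he'
  obtain ⟨c, hc, d, hd, rfl⟩ := hc
  obtain ⟨c', hc', d', hd', rfl⟩ := hc'
  rw [chartedSpaceSelf_atlas] at hd hd'
  subst hd hd'
  have hc1 : ContMDiffOn 𝓘(ℝ, N) 𝓘(ℝ, N) ∞ c.symm c.target :=
    contMDiffOn_symm_of_mem_maximalAtlas (IsManifold.subset_maximalAtlas hc)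
  have hc1' : ContMDiffOn 𝓘(ℝ, N) 𝓘(ℝ, N) ∞ c' c'.source :=
    contMDiffOn_of_mem_maximalAtlas (IsManifold.subset_maximalAtlas hc')
  set D : Set (N × F) := (c.target ∩ c.symm ⁻¹' (Z.baseSet i ∩ Z.baseSet j ∩ c'.source)) ×ˢ univ
    with hD
  have h1 : ContDiffOn ℝ ∞ (fun z : N × F => (c' (c.symm z.1), Z.coordChange i j (c.symm z.1) z.2))
      D := by
    refine ContDiffOn.prodMk ?_ ?_
    · have h2 : ContDiffOn ℝ ∞ (fun z : N => c' (c.symm z)) (c.target ∩ c.symm ⁻¹' c'.source) := by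
        rw [← contMDiffOn_iff_contDiffOn]
        exact hc1'.comp (hc1.mono inter_subset_left) fun z hz => hz.2
      exact h2.comp contDiffOn_fst fun z hz => ⟨hz.1.1, hz.1.2.2⟩
    · rw [← contMDiffOn_iff_contDiffOn]
      refine (hZ i j).comp (f := fun z : N × F => (c.symm z.1, z.2))
        (ContMDiffOn.prodMk (hc1.comp contDiff_fst.contMDiff.contMDiffOn fun z hz => hz.1.1)
        contDiff_snd.contMDiff.contMDiffOn) fun z hz => ?_
      exact ⟨hz.1.2.1, mem_univ _⟩
  have hsub : ∀ z ∈ (↑(𝓘(ℝ, N).prod 𝓘(ℝ, F)).symm ⁻¹'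
        (((Z.localTriv i).toOpenPartialHomeomorph ≫ₕ c.prod (OpenPartialHomeomorph.refl F)).symm ≫ₕ
            (Z.localTriv j).toOpenPartialHomeomorph ≫ₕ
              c'.prod (OpenPartialHomeomorph.refl F)).source ∩
      range ↑(𝓘(ℝ, N).prod 𝓘(ℝ, F)) : Set (N × F)), z ∈ D := by
    rintro z ⟨hz, -⟩
    simp only [mfld_simps] at hz
    exact ⟨⟨hz.1.1.1, ⟨hz.1.2, hz.2.1⟩, hz.2.2⟩, mem_univ _⟩
  refine (h1.mono hsub).congr fun z hz => ?_
  have hz' := (hsub z hz).1.2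
  refine Prod.ext rfl ?_
  -- The transition map passes through the trivialisation preferred at the point; the cocycle
  -- identity collapses the two changes into one.
  exact Z.coordChange_comp i (Z.indexAt (c.symm z.1)) j (c.symm z.1)
    ⟨⟨hz'.1.1, Z.mem_baseSet_at _⟩, hz'.1.2⟩ z.2

end Core

/-! ### Smooth coordinate changes; the phase bundles are manifolds. -/

section SmoothCores

variable {k n : ℕ}
  {M : Type*} [TopologicalSpace M] [ChartedSpace (BaseV k) M] [IsManifold 𝓘(ℝ, BaseV k) ∞ M]
  {E : Type*} [TopologicalSpace E] [ChartedSpace (TotV k n) E] [IsManifold 𝓘(ℝ, TotV k n) ∞ E]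
  (B : AdaptedBundle k n M E)

theorem contMDiffOn_tangentCoordChange {V H Q : Type*} [NormedAddCommGroup V] [NormedSpace ℝ V]
    [TopologicalSpace H] (I : ModelWithCorners ℝ V H) [TopologicalSpace Q] [ChartedSpace H Q]
    [IsManifold I ∞ Q] (x y : Q) :
    ContMDiffOn I 𝓘(ℝ, V →L[ℝ] V) ∞ (tangentCoordChange I x y)
      ((chartAt H x).source ∩ (chartAt H y).source) := by
  -- Passing to the tangent bundle costs one derivative, which is free at order ∞.
  have : IsManifold I (∞ + 1) Q := ‹IsManifold I ∞ Q›
  have : (tangentBundleCore I Q).IsContMDiff I ∞ := tangentBundleCore.isContMDiff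
  have := (tangentBundleCore I Q).contMDiffOn_coordChange (IB := I) (n := ∞) (achart H x) (achart H y)
  exact this

namespace AdaptedBundle

theorem contMDiffOn_baseChange (i j : E) : ContMDiffOn 𝓘(ℝ, TotV k n)
    𝓘(ℝ, BaseV k →L[ℝ] BaseV k) ∞ (B.baseChange i j)
    ((chartAt (TotV k n) i).source ∩ (chartAt (TotV k n) j).source) :=
  (contMDiffOn_tangentCoordChange 𝓘(ℝ, BaseV k) (B.proj i) (B.proj j)).comp
    B.contMDiff_proj.contMDiffOn fun y hy => ⟨B.proj_mem i y hy.1, B.proj_mem j y hy.2⟩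

theorem contMDiffOn_totChange (i j : E) : ContMDiffOn 𝓘(ℝ, TotV k n)
    𝓘(ℝ, TotV k n →L[ℝ] TotV k n) ∞ (B.totChange i j)
    ((chartAt (TotV k n) i).source ∩ (chartAt (TotV k n) j).source) :=
  (contMDiffOn_tangentCoordChange 𝓘(ℝ, TotV k n) i j).congr fun y hy =>
    B.totChange_eq i j y hy.1 hy.2

end AdaptedBundle

theorem contMDiffOn_jetChange (i j : E) : ContMDiffOn (𝓘(ℝ, TotV k n).prod 𝓘(ℝ, Jet k n))
    𝓘(ℝ, Jet k n) ∞ (fun p : E × Jet k n => B.jetChange i j p.1 p.2)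
    (((chartAt (TotV k n) i).source ∩ (chartAt (TotV k n) j).source) ×ˢ univ) := by
  have hT := (B.contMDiffOn_totChange i j).comp (contMDiffOn_fst (M := E) (N := Jet k n)
    (I := 𝓘(ℝ, TotV k n)) (J := 𝓘(ℝ, Jet k n)) (n := ∞)
    (s := ((chartAt (TotV k n) i).source ∩ (chartAt (TotV k n) j).source) ×ˢ univ)) fun p hp => hp.1
  have hA := (B.contMDiffOn_baseChange j i).comp (contMDiffOn_fst (M := E) (N := Jet k n)
    (I := 𝓘(ℝ, TotV k n)) (J := 𝓘(ℝ, Jet k n)) (n := ∞)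
    (s := ((chartAt (TotV k n) i).source ∩ (chartAt (TotV k n) j).source) ×ˢ univ))
    fun p hp => hp.1.symm
  have hv := contMDiffOn_snd (M := E) (N := Jet k n)
    (I := 𝓘(ℝ, TotV k n)) (J := 𝓘(ℝ, Jet k n)) (n := ∞)
    (s := ((chartAt (TotV k n) i).source ∩ (chartAt (TotV k n) j).source) ×ˢ univ)
  -- The map (id, v) is written as `inl` plus `inr` composed with v, which displays its affine
  -- dependence on the jet.
  have h : ContDiff ℝ ∞ (fun p : (TotV k n →L[ℝ] TotV k n) × (BaseV k →L[ℝ] BaseV k) × Jet k n =>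
      (ContinuousLinearMap.snd ℝ (BaseV k) (FibV n)).comp
    (p.1.comp ((ContinuousLinearMap.inl ℝ (BaseV k) (FibV n) +
          (ContinuousLinearMap.inr ℝ (BaseV k) (FibV n)).comp p.2.2).comp p.2.1))) := by
    refine contDiff_const.clm_comp (contDiff_fst.clm_comp ((contDiff_const.add
      (contDiff_const.clm_comp ?_)).clm_comp ?_)) <;> fun_prop
  refine (h.contMDiff.comp_contMDiffOn (hT.prodMk_space (hA.prodMk_space hv))).congr fun p hp => ?_
  ext x : 1
  simp [AdaptedBundle.jetChange, ← Prod.snd_add, ← map_add]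

theorem contMDiffOn_actChange (i j : E) : ContMDiffOn (𝓘(ℝ, TotV k n).prod 𝓘(ℝ, Act k))
    𝓘(ℝ, Act k) ∞ (fun p : E × Act k => B.actChange i j p.1 p.2)
    (((chartAt (TotV k n) i).source ∩ (chartAt (TotV k n) j).source) ×ˢ univ) := by
  have hA := (B.contMDiffOn_baseChange j i).comp (contMDiffOn_fst (M := E) (N := Act k)
    (I := 𝓘(ℝ, TotV k n)) (J := 𝓘(ℝ, Act k)) (n := ∞)
    (s := ((chartAt (TotV k n) i).source ∩ (chartAt (TotV k n) j).source) ×ˢ univ))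
    fun p hp => hp.1.symm
  have hv := contMDiffOn_snd (M := E) (N := Act k)
    (I := 𝓘(ℝ, TotV k n)) (J := 𝓘(ℝ, Act k)) (n := ∞)
    (s := ((chartAt (TotV k n) i).source ∩ (chartAt (TotV k n) j).source) ×ˢ univ)
  exact (contDiff_compContinuousLinearMapCLM (V := BaseV k) (V' := BaseV k) k).contMDiff.comp_contMDiffOn (hv.prodMk_space hA)

theorem contMDiffOn_extMomChange (i j : E) : ContMDiffOn (𝓘(ℝ, TotV k n).prod 𝓘(ℝ, ExtMom k n))
    𝓘(ℝ, ExtMom k n) ∞ (fun p : E × ExtMom k n => B.extMomChange i j p.1 p.2)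
    (((chartAt (TotV k n) i).source ∩ (chartAt (TotV k n) j).source) ×ˢ univ) := by
  obtain ⟨P, hP⟩ := exists_clm_leftInverse (formL k n) formL_injective
  have hT := (B.contMDiffOn_totChange j i).comp (contMDiffOn_fst (M := E) (N := ExtMom k n)
    (I := 𝓘(ℝ, TotV k n)) (J := 𝓘(ℝ, ExtMom k n)) (n := ∞)
    (s := ((chartAt (TotV k n) i).source ∩ (chartAt (TotV k n) j).source) ×ˢ univ))
    fun p hp => hp.1.symm
  have hv := contMDiffOn_snd (M := E) (N := ExtMom k n)
    (I := 𝓘(ℝ, TotV k n)) (J := 𝓘(ℝ, ExtMom k n)) (n := ∞)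
    (s := ((chartAt (TotV k n) i).source ∩ (chartAt (TotV k n) j).source) ×ˢ univ)
  have h := P.contDiff.contMDiff.comp_contMDiffOn (
    (contDiff_compContinuousLinearMapCLM (V := TotV k n) (V' := TotV k n) (k + 1)).contMDiff.comp_contMDiffOn
    (((formL k n).contDiff.contMDiff.comp_contMDiffOn hv).prodMk_space hT))
  exact h.congr fun p hp => (hP _).symm

theorem contMDiffOn_resMomChange (i j : E) : ContMDiffOn (𝓘(ℝ, TotV k n).prod 𝓘(ℝ, ResMom k n))
    𝓘(ℝ, ResMom k n) ∞ (fun p : E × ResMom k n => B.resMomChange i j p.1 p.2)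
    (((chartAt (TotV k n) i).source ∩ (chartAt (TotV k n) j).source) ×ˢ univ) := by
  have hT := (B.contMDiffOn_totChange j i).comp (contMDiffOn_fst (M := E) (N := ResMom k n)
    (I := 𝓘(ℝ, TotV k n)) (J := 𝓘(ℝ, ResMom k n)) (n := ∞)
    (s := ((chartAt (TotV k n) i).source ∩ (chartAt (TotV k n) j).source) ×ˢ univ))
    fun p hp => hp.1.symm
  have hA := (B.contMDiffOn_baseChange j i).comp (contMDiffOn_fst (M := E) (N := ResMom k n)
    (I := 𝓘(ℝ, TotV k n)) (J := 𝓘(ℝ, ResMom k n)) (n := ∞)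
    (s := ((chartAt (TotV k n) i).source ∩ (chartAt (TotV k n) j).source) ×ˢ univ))
    fun p hp => hp.1.symm
  have hv := contMDiffOn_snd (M := E) (N := ResMom k n)
    (I := 𝓘(ℝ, TotV k n)) (J := 𝓘(ℝ, ResMom k n)) (n := ∞)
    (s := ((chartAt (TotV k n) i).source ∩ (chartAt (TotV k n) j).source) ×ˢ univ)
  have h1 : ContDiff ℝ ∞ (fun A : BaseV k →L[ℝ] BaseV k =>
      (ContinuousAlternatingMap.compContinuousLinearMapCLM A : Act k →L[ℝ] Act k)) := by
    rw [contDiff_clm_apply_iff]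
    intro s
    exact (contDiff_compContinuousLinearMapCLM (V := BaseV k) (V' := BaseV k) k).comp (contDiff_const.prodMk contDiff_id)
  have h : ContDiff ℝ ∞ (fun p : (TotV k n →L[ℝ] TotV k n) × (BaseV k →L[ℝ] BaseV k) × ResMom k n =>
      (ContinuousAlternatingMap.compContinuousLinearMapCLM p.2.1 : Act k →L[ℝ] Act k).comp
    (p.2.2.comp ((ContinuousLinearMap.snd ℝ (BaseV k) (FibV n)).comp
      (p.1.comp (ContinuousLinearMap.inr ℝ (BaseV k) (FibV n)))))) := by
    refine (h1.comp (contDiff_fst.comp contDiff_snd)).clm_comp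
      ((contDiff_snd.comp contDiff_snd).clm_comp (contDiff_const.clm_comp
        (contDiff_fst.clm_comp contDiff_const)))
  exact h.contMDiff.comp_contMDiffOn (hT.prodMk_space (hA.prodMk_space hv))

theorem chartIndexed_velCore : ChartIndexed (N := TotV k n) B.velCore := ⟨fun _ => rfl, fun _ => rfl⟩
theorem chartIndexed_momCore : ChartIndexed (N := TotV k n) (F := ResMom k n × Act k) B.momCore := ⟨fun _ => rfl, fun _ => rfl⟩
theorem chartIndexed_pontCore : ChartIndexed (N := TotV k n) B.pontCore := ⟨fun _ => rfl, fun _ => rfl⟩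

theorem smoothCore_velCore : SmoothCore (TotV k n) B.velCore := fun i j =>
  ((contMDiffOn_jetChange B i j).comp (f := fun p : E × (Jet k n × Act k) => (p.1, p.2.1))
    (contMDiff_fst.prodMk (contDiff_fst.contMDiff.comp contMDiff_snd)).contMDiffOn
    fun _ hp => ⟨hp.1, mem_univ _⟩).prodMk_space
  ((contMDiffOn_actChange B i j).comp (f := fun p : E × (Jet k n × Act k) => (p.1, p.2.2))
    (contMDiff_fst.prodMk (contDiff_snd.contMDiff.comp contMDiff_snd)).contMDiffOn
    fun _ hp => ⟨hp.1, mem_univ _⟩)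

theorem smoothCore_momCore : SmoothCore (F := ResMom k n × Act k) (TotV k n) B.momCore := fun i j =>
  ((contMDiffOn_resMomChange B i j).comp (f := fun p : E × (ResMom k n × Act k) => (p.1, p.2.1))
    (contMDiff_fst.prodMk (contDiff_fst.contMDiff.comp contMDiff_snd)).contMDiffOn
    fun _ hp => ⟨hp.1, mem_univ _⟩).prodMk_space
  ((contMDiffOn_actChange B i j).comp (f := fun p : E × (ResMom k n × Act k) => (p.1, p.2.2))
    (contMDiff_fst.prodMk (contDiff_snd.contMDiff.comp contMDiff_snd)).contMDiffOn
    fun _ hp => ⟨hp.1, mem_univ _⟩)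

theorem smoothCore_pontCore : SmoothCore (TotV k n) B.pontCore := fun i j =>
  ((contMDiffOn_jetChange B i j).comp (f := fun p : E × (Jet k n × ExtMom k n × Act k) => (p.1, p.2.1))
    (contMDiff_fst.prodMk (contDiff_fst.contMDiff.comp contMDiff_snd)).contMDiffOn
    fun _ hp => ⟨hp.1, mem_univ _⟩).prodMk_space
  (((contMDiffOn_extMomChange B i j).comp
    (f := fun p : E × (Jet k n × ExtMom k n × Act k) => (p.1, p.2.2.1))
    (contMDiff_fst.prodMk ((contDiff_fst.comp contDiff_snd).contMDiff.comp contMDiff_snd)).contMDiffOn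
    fun _ hp => ⟨hp.1, mem_univ _⟩).prodMk_space
  ((contMDiffOn_actChange B i j).comp
    (f := fun p : E × (Jet k n × ExtMom k n × Act k) => (p.1, p.2.2.2))
    (contMDiff_fst.prodMk ((contDiff_snd.comp contDiff_snd).contMDiff.comp contMDiff_snd)).contMDiffOn
    fun _ hp => ⟨hp.1, mem_univ _⟩))

instance isManifold_velPhase : IsManifold (IVel k n) ∞ (VelPhase B) :=
  (smoothCore_velCore B).isManifold

instance isManifold_momPhase : IsManifold (IMom k n) ∞ (MomPhase B) :=
  (smoothCore_momCore B).isManifold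

instance isManifold_pont : IsManifold (IPont k n) ∞ (Pont B) :=
  (smoothCore_pontCore B).isManifold

end SmoothCores

theorem tmap_eq_of_chart_linear {V V' : Type*} [NormedAddCommGroup V] [NormedSpace ℝ V]
    [NormedAddCommGroup V'] [NormedSpace ℝ V']
    {H H' : Type*} [TopologicalSpace H] [TopologicalSpace H']
    {I : ModelWithCorners ℝ V H} {I' : ModelWithCorners ℝ V' H'}
    {Q Q' : Type*} [TopologicalSpace Q] [ChartedSpace H Q] [TopologicalSpace Q']
    [ChartedSpace H' Q'] [IsManifold I ∞ Q] [I.Boundaryless] [IsManifold I' ∞ Q'] [I'.Boundaryless]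
    {f : Q → Q'} {q : Q} (hf : ContMDiff I I' ∞ f) {F' : V →L[ℝ] V'}
    (h : ∀ᶠ x in nhds q, extChartAt I' (f q) (f x) = F' (extChartAt I q x)) :
    tmap I I' f q = F' :=
  tmap_eq_of_chart (hf.mdifferentiable (by simp) q) h F'.hasFDerivAt


/-! ### The projections between the bundles in coordinates. -/

section Coordinates

variable {k n : ℕ}
  {M : Type*} [TopologicalSpace M] [ChartedSpace (BaseV k) M] [IsManifold 𝓘(ℝ, BaseV k) ∞ M]
  {E : Type*} [TopologicalSpace E] [ChartedSpace (TotV k n) E] [IsManifold 𝓘(ℝ, TotV k n) ∞ E]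

namespace AdaptedBundle

variable (B : AdaptedBundle k n M E)

/-- Compatibility with coordinate changes makes `resOfExt` a bundle map. The two evaluations differ
by vertical parts of arguments next to a vertical first argument, which are invisible. -/
theorem resOfExt_extMomChange (i j y : E) (α : ExtMom k n) :
    resOfExt (B.extMomChange i j y α) = B.resMomChange i j y (resOfExt α) := by
  ext e : 1
  ext x
  rw [resMomChange_apply]
  show α.form (fun a => B.totChange j i y (Matrix.vecCons (0, e) (fun l => (x l, 0)) a)) =
    α.form (Matrix.vecCons (0, (B.totChange j i y (0, e)).2)
      (fun l => (B.baseChange j i y (x l), 0)))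
  refine form_eq_of_snd (i := 0) ?_ ?_ fun l => ?_
  · simp [totChange_fst]
  · simp [totChange_vert]
  · refine Fin.cases ?_ (fun l => ?_) l <;> simp [totChange_fst]

/-- The pull-back of a form by a jet is intrinsic; in coordinates it can only change as a form on
the base. This makes the coupling form independent of charts. -/
theorem jetPull_extMomChange (i j y : E) (hi : y ∈ (chartAt (TotV k n) i).source)
    (hj : y ∈ (chartAt (TotV k n) j).source) (v : Jet k n) (α : ExtMom k n) :
    jetPull (B.jetChange i j y v) (B.extMomChange i j y α) =
      (jetPull v α).compContinuousLinearMap (B.baseChange j i y) := by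
  ext x
  show α.form (fun a => B.totChange j i y (x a, B.jetChange i j y v (x a))) =
    α.form (fun a => (B.baseChange j i y (x a), v (B.baseChange j i y (x a))))
  congr 1
  funext a
  have key : ((x a, B.jetChange i j y v (x a)) : TotV k n) =
      B.totChange i j y (B.baseChange j i y (x a), v (B.baseChange j i y (x a))) := by
    refine Prod.ext ?_ rfl
    rw [totChange_fst, B.baseChange_comp j i j y hj hi hj, B.baseChange_self j y hj]
  rw [key, B.totChange_comp i j i y hi hj hi, B.totChange_self i y hi]

end AdaptedBundle

variable {B : AdaptedBundle k n M E}

/-- The multimomentum of a point of `𝒫*`. -/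
def momMom (q : MomPhase B) : ResMom k n := (show ResMom k n × Act k from q.2).1

theorem extChartAt_vel (p₀ p : VelPhase B) : extChartAt (IVel k n) p₀ p =
    (chartAt (TotV k n) p₀.1 p.1, (B.jetChange p.1 p₀.1 p.1 (velJet p),
      B.actChange p.1 p₀.1 p.1 (velAct p))) :=
  (chartIndexed_velCore B).extChartAt_apply p₀ p

theorem extChartAt_mom (q₀ q : MomPhase B) : extChartAt (IMom k n) q₀ q =
    (chartAt (TotV k n) q₀.1 q.1, (B.resMomChange q.1 q₀.1 q.1 (momMom q),
      B.actChange q.1 q₀.1 q.1 (momAct q))) :=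
  (chartIndexed_momCore B).extChartAt_apply q₀ q

theorem extChartAt_pont (w₀ w : Pont B) : extChartAt (IPont k n) w₀ w =
    (chartAt (TotV k n) w₀.1 w.1, (B.jetChange w.1 w₀.1 w.1 (pontJet w),
      B.extMomChange w.1 w₀.1 w.1 (pontMom w), B.actChange w.1 w₀.1 w.1 (pontAct w))) :=
  (chartIndexed_pontCore B).extChartAt_apply w₀ w

theorem extChartAt_vel_symm (p₀ : VelPhase B) (z : VelV k n) :
    (extChartAt (IVel k n) p₀).symm z =
      (mkVel ((chartAt (TotV k n) p₀.1).symm z.1)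
        (B.jetChange p₀.1 ((chartAt (TotV k n) p₀.1).symm z.1)
          ((chartAt (TotV k n) p₀.1).symm z.1) z.2.1)
        (B.actChange p₀.1 ((chartAt (TotV k n) p₀.1).symm z.1)
          ((chartAt (TotV k n) p₀.1).symm z.1) z.2.2) : VelPhase B) :=
  (chartIndexed_velCore B).extChartAt_symm_apply p₀ z

theorem extChartAt_pont_symm (w₀ : Pont B) (z : PontV k n) :
    (extChartAt (IPont k n) w₀).symm z =
      (mkPont ((chartAt (TotV k n) w₀.1).symm z.1)
        (B.jetChange w₀.1 ((chartAt (TotV k n) w₀.1).symm z.1)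
          ((chartAt (TotV k n) w₀.1).symm z.1) z.2.1)
        (B.extMomChange w₀.1 ((chartAt (TotV k n) w₀.1).symm z.1)
          ((chartAt (TotV k n) w₀.1).symm z.1) z.2.2.1)
        (B.actChange w₀.1 ((chartAt (TotV k n) w₀.1).symm z.1)
          ((chartAt (TotV k n) w₀.1).symm z.1) z.2.2.2) : Pont B) :=
  (chartIndexed_pontCore B).extChartAt_symm_apply w₀ z

theorem extChartAt_pont_target (w₀ : Pont B) :
    (extChartAt (IPont k n) w₀).target = (chartAt (TotV k n) w₀.1).target ×ˢ univ :=
  (chartIndexed_pontCore B).extChartAt_target w₀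

theorem extChartAt_vel_source (p₀ : VelPhase B) :
    (extChartAt (IVel k n) p₀).source = {p | p.1 ∈ (chartAt (TotV k n) p₀.1).source} :=
  (chartIndexed_velCore B).extChartAt_source p₀

theorem extChartAt_pont_source (w₀ : Pont B) :
    (extChartAt (IPont k n) w₀).source = {w | w.1 ∈ (chartAt (TotV k n) w₀.1).source} :=
  (chartIndexed_pontCore B).extChartAt_source w₀

theorem contMDiff_velE : ContMDiff (IVel k n) (IE k n) ∞ (velE : VelPhase B → E) :=
  Bundle.contMDiff_proj _

theorem contMDiff_momE : ContMDiff (IMom k n) (IE k n) ∞ (momE : MomPhase B → E) :=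
  Bundle.contMDiff_proj _

theorem contMDiff_pontE : ContMDiff (IPont k n) (IE k n) ∞ (pontE : Pont B → E) :=
  Bundle.contMDiff_proj _

theorem contMDiff_velM : ContMDiff (IVel k n) (IB k) ∞ (velM : VelPhase B → M) :=
  B.contMDiff_proj.comp contMDiff_velE

theorem contMDiff_momM : ContMDiff (IMom k n) (IB k) ∞ (momM : MomPhase B → M) :=
  B.contMDiff_proj.comp contMDiff_momE

theorem contMDiff_pontM : ContMDiff (IPont k n) (IB k) ∞ (pontM : Pont B → M) :=
  B.contMDiff_proj.comp contMDiff_pontE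

theorem contMDiff_pr : ContMDiff (IPont k n) (IVel k n) ∞ (pr : Pont B → VelPhase B) := by
  intro w₀
  refine (chartIndexed_velCore B).contMDiffAt_iff.2 ⟨contMDiff_pontE w₀, ?_⟩
  have h : ContMDiffAt (IPont k n) 𝓘(ℝ, Jet k n × Act k) ∞
      (fun w : Pont B => ((extChartAt (IPont k n) w₀ w).2.1, (extChartAt (IPont k n) w₀ w).2.2.2))
      w₀ := by
    have h1 : ContDiff ℝ ∞ (fun z : PontV k n => (z.2.1, z.2.2.2)) := by fun_prop
    exact h1.contMDiff.contMDiffAt.comp w₀ contMDiffAt_extChartAt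
  refine h.congr_of_eventuallyEq (Filter.Eventually.of_forall fun w => ?_)
  simp only [extChartAt_pont]
  rfl

theorem contMDiff_prBar : ContMDiff (IPont k n) (IMom k n) ∞ (prBar : Pont B → MomPhase B) := by
  intro w₀
  refine (chartIndexed_momCore B).contMDiffAt_iff.2 ⟨contMDiff_pontE w₀, ?_⟩
  have h : ContMDiffAt (IPont k n) 𝓘(ℝ, ResMom k n × Act k) ∞
      (fun w : Pont B => (resL k n (extChartAt (IPont k n) w₀ w).2.2.1,
        (extChartAt (IPont k n) w₀ w).2.2.2)) w₀ := by
    have h1 : ContDiff ℝ ∞ (fun z : PontV k n => (resL k n z.2.2.1, z.2.2.2)) := by fun_prop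
    exact h1.contMDiff.contMDiffAt.comp w₀ contMDiffAt_extChartAt
  refine h.congr_of_eventuallyEq (Filter.Eventually.of_forall fun w => ?_)
  simp only [extChartAt_pont, resL_apply, B.resOfExt_extMomChange]
  rfl

theorem tmap_proj (y : E) : tmap (IE k n) (IB k) B.proj y =
    ContinuousLinearMap.fst ℝ (BaseV k) (FibV n) := by
  refine tmap_eq_of_chart (B.contMDiff_proj.mdifferentiable (by simp) y) (F := Prod.fst) ?_
    (ContinuousLinearMap.fst ℝ (BaseV k) (FibV n)).hasFDerivAt
  filter_upwards [(chartAt (TotV k n) y).open_source.mem_nhds (mem_chart_source _ y)] with x hx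
  simpa using (B.chart_fst y x hx).symm

theorem tmap_velE (p : VelPhase B) : tmap (IVel k n) (IE k n) velE p =
    ContinuousLinearMap.fst ℝ (TotV k n) (Jet k n × Act k) := by
  refine tmap_eq_of_chart (contMDiff_velE.mdifferentiable (by simp) p) (F := Prod.fst) ?_
    (ContinuousLinearMap.fst ℝ (TotV k n) (Jet k n × Act k)).hasFDerivAt
  refine Filter.Eventually.of_forall fun x => ?_
  rw [extChartAt_vel]
  simp [velE]

theorem tmap_pontE (w : Pont B) : tmap (IPont k n) (IE k n) pontE w =
    ContinuousLinearMap.fst ℝ (TotV k n) (Jet k n × ExtMom k n × Act k) := by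
  refine tmap_eq_of_chart (contMDiff_pontE.mdifferentiable (by simp) w) (F := Prod.fst) ?_
    (ContinuousLinearMap.fst ℝ (TotV k n) (Jet k n × ExtMom k n × Act k)).hasFDerivAt
  refine Filter.Eventually.of_forall fun x => ?_
  rw [extChartAt_pont]
  simp [pontE]

theorem tmap_pontM (w : Pont B) : tmap (IPont k n) (IB k) pontM w =
    (ContinuousLinearMap.fst ℝ (BaseV k) (FibV n)).comp
    (ContinuousLinearMap.fst ℝ (TotV k n) (Jet k n × ExtMom k n × Act k)) := by
  rw [← tmap_proj (B := B) (pontE w), ← tmap_pontE w]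
  exact tmap_comp (B.contMDiff_proj.mdifferentiable (by simp) _)
    (contMDiff_pontE.mdifferentiable (by simp) w)

theorem tmap_velM (p : VelPhase B) : tmap (IVel k n) (IB k) velM p =
    (ContinuousLinearMap.fst ℝ (BaseV k) (FibV n)).comp
    (ContinuousLinearMap.fst ℝ (TotV k n) (Jet k n × Act k)) := by
  rw [← tmap_proj (B := B) (velE p), ← tmap_velE p]
  exact tmap_comp (B.contMDiff_proj.mdifferentiable (by simp) _)
    (contMDiff_velE.mdifferentiable (by simp) p)

/-- The tangent map of `pr` in coordinates. -/
def prL (k n : ℕ) : PontV k n →L[ℝ] VelV k n :=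
  (ContinuousLinearMap.fst ℝ _ _).prod
    (((ContinuousLinearMap.fst ℝ _ _).comp (ContinuousLinearMap.snd ℝ _ _)).prod
      ((ContinuousLinearMap.snd ℝ _ _).comp
        ((ContinuousLinearMap.snd ℝ _ _).comp (ContinuousLinearMap.snd ℝ _ _))))

/-- The tangent map of `prBar` in coordinates. -/
def prBarL (k n : ℕ) : PontV k n →L[ℝ] MomV k n :=
  (ContinuousLinearMap.fst ℝ _ _).prod
    (((resL k n).comp ((ContinuousLinearMap.fst ℝ _ _).comp
      ((ContinuousLinearMap.snd ℝ _ _).comp (ContinuousLinearMap.snd ℝ _ _)))).prod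
      ((ContinuousLinearMap.snd ℝ _ _).comp
        ((ContinuousLinearMap.snd ℝ _ _).comp (ContinuousLinearMap.snd ℝ _ _))))

theorem prBarL_apply (u : PontV k n) :
    prBarL k n u = (u.1, (resOfExt u.2.2.1, u.2.2.2)) := rfl

/-- In corresponding bundle charts `pr`, and likewise `prBar`, is the same linear map everywhere,
because it commutes with the coordinate changes. Hence its tangent map is that constant linear map.
-/
theorem tmap_pr (w : Pont B) : tmap (IPont k n) (IVel k n) pr w = prL k n := by
  refine tmap_eq_of_chart (contMDiff_pr.mdifferentiable (by simp) w) (F := prL k n) ?_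
    (prL k n).hasFDerivAt
  refine Filter.Eventually.of_forall fun x => ?_
  rw [extChartAt_vel, extChartAt_pont]
  rfl

theorem tmap_prBar (w : Pont B) : tmap (IPont k n) (IMom k n) prBar w = prBarL k n := by
  refine tmap_eq_of_chart_linear contMDiff_prBar ?_
  refine Filter.Eventually.of_forall fun x => ?_
  rw [extChartAt_mom, extChartAt_pont]
  erw [prBarL_apply]
  rw [B.resOfExt_extMomChange]
  rfl

end Coordinates

theorem tmap_extChart_symm {V H Q : Type*} [NormedAddCommGroup V] [NormedSpace ℝ V]
    [TopologicalSpace H] {I : ModelWithCorners ℝ V H} [TopologicalSpace Q] [ChartedSpace H Q]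
    [IsManifold I ∞ Q] [I.Boundaryless] {q : Q} {z : V} (hz : z ∈ (extChartAt I q).target) :
    tmap 𝓘(ℝ, V) I (extChartAt I q).symm z =
      tangentCoordChange I q ((extChartAt I q).symm z) ((extChartAt I q).symm z) := by
  have h := (mdifferentiableAt_extChart_symm hz).mfderiv
  refine h.trans ?_
  rw [tangentCoordChange_def, (extChartAt I q).right_inv hz, I.range_eq_univ,
    𝓘(ℝ, V).range_eq_univ]
  rfl

section

variable {V : Type*} [NormedAddCommGroup V] [NormedSpace ℝ V] {r : ℕ}
  {f : V → V [⋀^Fin r]→L[ℝ] ℝ} {A : V →L[ℝ] (V [⋀^Fin r]→L[ℝ] ℝ)} {z : V}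

theorem differentiableAt_of_eventuallyEq_clm (h : f =ᶠ[nhds z] A) : DifferentiableAt ℝ f z :=
  A.differentiableAt.congr_of_eventuallyEq h

theorem extDeriv_of_eventuallyEq_clm (h : f =ᶠ[nhds z] A) :
    extDeriv f z = ContinuousAlternatingMap.alternatizeUncurryFin A := by
  rw [extDeriv, h.fderiv_eq, ContinuousLinearMap.fderiv]

theorem hasFDerivAt_of_eventuallyEq_neg_add {c : V [⋀^Fin r]→L[ℝ] ℝ}
    (h : f =ᶠ[nhds z] fun z => -A z + c) : HasFDerivAt f (-A) z :=
  (A.hasFDerivAt.neg.add_const c).congr_of_eventuallyEq h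

theorem extDeriv_of_eventuallyEq_neg_add {c : V [⋀^Fin r]→L[ℝ] ℝ}
    (h : f =ᶠ[nhds z] fun z => -A z + c) :
    extDeriv f z = -ContinuousAlternatingMap.alternatizeUncurryFin A := by
  rw [extDeriv, (hasFDerivAt_of_eventuallyEq_neg_add h).fderiv]
  exact map_neg (ContinuousAlternatingMap.alternatizeUncurryFinCLM ℝ V ℝ) A

end

/-- The exterior derivative in an arbitrary chart. -/
theorem formInChart_extD {V H Q : Type*} [NormedAddCommGroup V] [NormedSpace ℝ V]
    [TopologicalSpace H] {I : ModelWithCorners ℝ V H} [TopologicalSpace Q] [ChartedSpace H Q]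
    [IsManifold I ∞ Q] [I.Boundaryless] {r : ℕ} {Θ : Q → V [⋀^Fin r]→L[ℝ] ℝ}
    (hd : ∀ q, DifferentiableAt ℝ (formInChart I Θ q) (extChartAt I q q)) {q : Q} {z : V}
    (hz : z ∈ (extChartAt I q).target) :
    formInChart I (extD I Θ) q z = extDeriv (formInChart I Θ q) z := by
  rw [← extD_self]
  exact (extD_pullback (Θ := formInChart I Θ q) (isOpen_extChartAt_target q)
    (contMDiffOn_extChartAt_symm q) (fun _ _ => rfl) hz (hd _)).symm

/-! ### The canonical forms of 𝒲 in coordinates. -/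

section Forms

variable {k n : ℕ}
  {M : Type*} [TopologicalSpace M] [ChartedSpace (BaseV k) M] [IsManifold 𝓘(ℝ, BaseV k) ∞ M]
  {E : Type*} [TopologicalSpace E] [ChartedSpace (TotV k n) E] [IsManifold 𝓘(ℝ, TotV k n) ∞ E]
  {B : AdaptedBundle k n M E}

theorem tmap_pontE_comp_symm (w : Pont B) {z : PontV k n}
    (hz : z ∈ (extChartAt (IPont k n) w).target) :
    (tmap (IPont k n) (IE k n) pontE ((extChartAt (IPont k n) w).symm z)).comp
      (tmap 𝓘(ℝ, PontV k n) (IPont k n) (extChartAt (IPont k n) w).symm z) =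
    (B.totChange w.1 ((chartAt (TotV k n) w.1).symm z.1)
      ((chartAt (TotV k n) w.1).symm z.1)).comp
      (ContinuousLinearMap.fst ℝ (TotV k n) (Jet k n × ExtMom k n × Act k)) := by
  have hz1 : z.1 ∈ (chartAt (TotV k n) w.1).target := by
    rw [extChartAt_pont_target] at hz; exact hz.1
  have hz1' : z.1 ∈ (extChartAt (IE k n) w.1).target := by simpa using hz1
  rw [← tmap_comp (contMDiff_pontE.mdifferentiable (by simp) _)
    (mdifferentiableAt_extChart_symm hz),
    B.totChange_eq _ _ _ ((chartAt (TotV k n) w.1).map_target hz1) (mem_chart_source _ _)]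
  have h1 := tmap_extChart_symm hz1'
  have h2 : (extChartAt (IE k n) w.1).symm z.1 = (chartAt (TotV k n) w.1).symm z.1 := by simp
  rw [h2] at h1
  rw [← h1]
  have h3 : (fun x => pontE ((extChartAt (IPont k n) w).symm x)) =
      fun x : PontV k n => (extChartAt (IE k n) w.1).symm x.1 := by
    funext x
    rw [extChartAt_pont_symm]
    simp [pontE, mkPont]
  rw [h3]
  have h4 := tmap_comp (I := 𝓘(ℝ, PontV k n)) (g := (extChartAt (IE k n) w.1).symm) (f := Prod.fst)
    (q := z) (mdifferentiableAt_extChart_symm hz1')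
    (differentiableAt_fst.mdifferentiableAt)
  rw [h4, tmap_eq_fderiv, fderiv_fst]

theorem tmap_pontM_comp_symm (w : Pont B) {z : PontV k n}
    (hz : z ∈ (extChartAt (IPont k n) w).target) :
    (tmap (IPont k n) (IB k) pontM ((extChartAt (IPont k n) w).symm z)).comp
      (tmap 𝓘(ℝ, PontV k n) (IPont k n) (extChartAt (IPont k n) w).symm z) =
    (B.baseChange w.1 ((chartAt (TotV k n) w.1).symm z.1)
      ((chartAt (TotV k n) w.1).symm z.1)).comp
      ((ContinuousLinearMap.fst ℝ (BaseV k) (FibV n)).comp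
        (ContinuousLinearMap.fst ℝ (TotV k n) (Jet k n × ExtMom k n × Act k))) := by
  have h : tmap (IPont k n) (IB k) pontM ((extChartAt (IPont k n) w).symm z) =
      (ContinuousLinearMap.fst ℝ (BaseV k) (FibV n)).comp
        (tmap (IPont k n) (IE k n) pontE ((extChartAt (IPont k n) w).symm z)) := by
    rw [tmap_pontM, tmap_pontE]
  rw [h, ContinuousLinearMap.comp_assoc, tmap_pontE_comp_symm w hz]
  rfl

/-- The canonical action form in coordinates. -/
def actionL (k n : ℕ) : PontV k n →L[ℝ] (PontV k n [⋀^Fin k]→L[ℝ] ℝ) :=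
  (ContinuousAlternatingMap.compContinuousLinearMapCLM
    ((ContinuousLinearMap.fst ℝ (BaseV k) (FibV n)).comp
      (ContinuousLinearMap.fst ℝ (TotV k n) (Jet k n × ExtMom k n × Act k)))).comp
  ((ContinuousLinearMap.snd ℝ _ _).comp
    ((ContinuousLinearMap.snd ℝ _ _).comp (ContinuousLinearMap.snd ℝ _ _)))

/-- The Liouville form in coordinates. -/
def liouvilleL (k n : ℕ) : PontV k n →L[ℝ] (PontV k n [⋀^Fin (k + 1)]→L[ℝ] ℝ) :=
  (ContinuousAlternatingMap.compContinuousLinearMapCLM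
      (ContinuousLinearMap.fst ℝ (TotV k n) (Jet k n × ExtMom k n × Act k))).comp
  ((formL k n).comp ((ContinuousLinearMap.fst ℝ _ _).comp
    ((ContinuousLinearMap.snd ℝ _ _).comp (ContinuousLinearMap.snd ℝ _ _))))

/-- The form is tautological: its fibre coordinate at a point is transformed by the inverse of the
change that the tangent map of the projection introduces. The two cancel, and in each chart the form
is linear in the coordinates. The Liouville form behaves in the same way. -/
theorem formInChart_actionPont (w : Pont B) {z : PontV k n}
    (hz : z ∈ (extChartAt (IPont k n) w).target) :
    formInChart (IPont k n) actionPont w z = actionL k n z := by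
  have hz1 : z.1 ∈ (chartAt (TotV k n) w.1).target := by
    rw [extChartAt_pont_target] at hz; exact hz.1
  have h1 := tmap_pontM_comp_symm w hz
  set y := (chartAt (TotV k n) w.1).symm z.1 with hy
  have hyi : y ∈ (chartAt (TotV k n) w.1).source := (chartAt (TotV k n) w.1).map_target hz1
  have hA : pontAct ((extChartAt (IPont k n) w).symm z) = B.actChange w.1 y y z.2.2.2 := by
    rw [extChartAt_pont_symm]; rfl
  ext u
  have h2 : ∀ a, tmap (IPont k n) (IB k) pontM ((extChartAt (IPont k n) w).symm z)
      (tmap 𝓘(ℝ, PontV k n) (IPont k n) (extChartAt (IPont k n) w).symm z a) =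
      B.baseChange w.1 y y a.1.1 := fun a => congrArg (fun T => T a) h1
  show pontAct ((extChartAt (IPont k n) w).symm z) (fun a => tmap (IPont k n) (IB k) pontM
      ((extChartAt (IPont k n) w).symm z)
      (tmap 𝓘(ℝ, PontV k n) (IPont k n) (extChartAt (IPont k n) w).symm z (u a))) =
    z.2.2.2 (fun a => (u a).1.1)
  simp only [h2, hA]
  show z.2.2.2 (fun a => B.baseChange y w.1 y (B.baseChange w.1 y y (u a).1.1)) = _
  congr 1
  funext a
  rw [B.baseChange_comp w.1 y w.1 y hyi (mem_chart_source _ _) hyi, B.baseChange_self w.1 y hyi]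

theorem formInChart_liouville (w : Pont B) {z : PontV k n}
    (hz : z ∈ (extChartAt (IPont k n) w).target) :
    formInChart (IPont k n) (pullAlong (IPont k n) (IE k n) pontE
      (fun w : Pont B => (pontMom w).form)) w z = liouvilleL k n z := by
  have hz1 : z.1 ∈ (chartAt (TotV k n) w.1).target := by
    rw [extChartAt_pont_target] at hz; exact hz.1
  have h1 := tmap_pontE_comp_symm w hz
  set y := (chartAt (TotV k n) w.1).symm z.1 with hy
  have hyi : y ∈ (chartAt (TotV k n) w.1).source := (chartAt (TotV k n) w.1).map_target hz1
  have hA : pontMom ((extChartAt (IPont k n) w).symm z) = B.extMomChange w.1 y y z.2.2.1 := by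
    rw [extChartAt_pont_symm]; rfl
  ext u
  have h2 : ∀ a, tmap (IPont k n) (IE k n) pontE ((extChartAt (IPont k n) w).symm z)
      (tmap 𝓘(ℝ, PontV k n) (IPont k n) (extChartAt (IPont k n) w).symm z a) =
      B.totChange w.1 y y a.1 := fun a => congrArg (fun T => T a) h1
  show (pontMom ((extChartAt (IPont k n) w).symm z)).form (fun a => tmap (IPont k n) (IE k n) pontE
      ((extChartAt (IPont k n) w).symm z)
      (tmap 𝓘(ℝ, PontV k n) (IPont k n) (extChartAt (IPont k n) w).symm z (u a))) =
    z.2.2.1.form (fun a => (u a).1)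
  simp only [h2, hA]
  show z.2.2.1.form (fun a => B.totChange y w.1 y (B.totChange w.1 y y (u a).1)) = _
  congr 1
  funext a
  rw [B.totChange_comp w.1 y w.1 y hyi (mem_chart_source _ _) hyi, B.totChange_self w.1 y hyi]

theorem eventuallyEq_formInChart_actionPont (w : Pont B) {z : PontV k n}
    (hz : z ∈ (extChartAt (IPont k n) w).target) :
    formInChart (IPont k n) actionPont w =ᶠ[nhds z] actionL k n := by
  filter_upwards [(isOpen_extChartAt_target w).mem_nhds hz] with z hz
  exact formInChart_actionPont w hz

theorem differentiableAt_formInChart_actionPont (w : Pont B) :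
    DifferentiableAt ℝ (formInChart (IPont k n) actionPont w) (extChartAt (IPont k n) w w) :=
  differentiableAt_of_eventuallyEq_clm
    (eventuallyEq_formInChart_actionPont w (mem_extChartAt_target w))

theorem formInChart_extD_actionPont (w : Pont B) {z : PontV k n}
    (hz : z ∈ (extChartAt (IPont k n) w).target) :
    formInChart (IPont k n) (extD (IPont k n) actionPont) w z =
      ContinuousAlternatingMap.alternatizeUncurryFin (actionL k n) := by
  rw [formInChart_extD differentiableAt_formInChart_actionPont hz,
    extDeriv_of_eventuallyEq_clm (eventuallyEq_formInChart_actionPont w hz)]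

theorem formInChart_thetaPont (w : Pont B) {z : PontV k n}
    (hz : z ∈ (extChartAt (IPont k n) w).target) :
    formInChart (IPont k n) thetaPont w z = -liouvilleL k n z +
      ContinuousAlternatingMap.alternatizeUncurryFin (actionL k n) := by
  rw [← formInChart_extD_actionPont w hz, ← formInChart_liouville w hz]
  rfl

theorem eventuallyEq_formInChart_thetaPont (w : Pont B) :
    formInChart (IPont k n) thetaPont w =ᶠ[nhds (extChartAt (IPont k n) w w)] fun z =>
      -liouvilleL k n z + ContinuousAlternatingMap.alternatizeUncurryFin (actionL k n) := by
  filter_upwards [(isOpen_extChartAt_target w).mem_nhds (mem_extChartAt_target w)] with z hz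
  exact formInChart_thetaPont w hz

theorem differentiableAt_formInChart_thetaPont (w : Pont B) :
    DifferentiableAt ℝ (formInChart (IPont k n) thetaPont w) (extChartAt (IPont k n) w w) :=
  (hasFDerivAt_of_eventuallyEq_neg_add (eventuallyEq_formInChart_thetaPont w)).differentiableAt

/-- In a chart Θ is affine: minus the linear Liouville form plus the differential of the linear
action form, which is constant. Hence dΘ has constant coefficients and involves only the Liouville
part. -/
theorem extD_thetaPont (w : Pont B) : extD (IPont k n) thetaPont w =
    -ContinuousAlternatingMap.alternatizeUncurryFin (liouvilleL k n) := by
  rw [extD, tmap_extChartAt_self,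
    extDeriv_of_eventuallyEq_neg_add (eventuallyEq_formInChart_thetaPont w)]
  rfl

theorem thetaPont_eq (w : Pont B) : thetaPont w =
    -(pontMom w).form.compContinuousLinearMap
      (ContinuousLinearMap.fst ℝ (TotV k n) (Jet k n × ExtMom k n × Act k)) +
      ContinuousAlternatingMap.alternatizeUncurryFin (actionL k n) := by
  have h := formInChart_extD_actionPont w (mem_extChartAt_target w)
  rw [formInChart, extChartAt_to_inv] at h
  have h2 : tmap 𝓘(ℝ, PontV k n) (IPont k n) (extChartAt (IPont k n) w).symm
      (extChartAt (IPont k n) w w) = ContinuousLinearMap.id ℝ _ := by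
    have := tmap_symm_comp_extChart (I := IPont k n) (mem_extChartAt_source w)
    rwa [tmap_extChartAt_self] at this
  rw [h2] at h
  rw [thetaPont, pullAlong, tmap_pontE, ← h]
  rfl

end Forms

/-! ### Smooth operations on forms, and a dimension count. -/

section

variable {V V' W : Type*} [NormedAddCommGroup V] [NormedSpace ℝ V] [NormedAddCommGroup V']
  [NormedSpace ℝ V'] [NormedAddCommGroup W] [NormedSpace ℝ W]

theorem contDiff_comp_clm {r : ℕ} (A : V →L[ℝ] V') : ContDiff ℝ ∞
    (fun p : (V' [⋀^Fin r]→L[ℝ] ℝ) × W => p.1.compContinuousLinearMap A) :=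
  (ContinuousAlternatingMap.compContinuousLinearMapCLM A :
    (V' [⋀^Fin r]→L[ℝ] ℝ) →L[ℝ] V [⋀^Fin r]→L[ℝ] ℝ).contDiff.comp contDiff_fst

theorem contDiff_curryLeft_comp [FiniteDimensional ℝ V'] {r : ℕ} (A : V →L[ℝ] V') (b : V') :
    ContDiff ℝ ∞ (fun p : (V' [⋀^Fin (r + 1)]→L[ℝ] ℝ) × W =>
      (p.1.curryLeft b).compContinuousLinearMap A) := by
  let f : (V' [⋀^Fin (r + 1)]→L[ℝ] ℝ) →ₗ[ℝ] V [⋀^Fin r]→L[ℝ] ℝ :=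
    { toFun := fun α => (α.curryLeft b).compContinuousLinearMap A
      map_add' := fun _ _ => rfl
      map_smul' := fun _ _ => rfl }
  exact (LinearMap.toContinuousLinearMap f).contDiff.comp contDiff_fst

theorem contDiff_comp_graph [FiniteDimensional ℝ V] [FiniteDimensional ℝ V'] {r : ℕ} :
    ContDiff ℝ ∞ (fun p : (V →L[ℝ] V') × ((V × V') [⋀^Fin r]→L[ℝ] ℝ) =>
      p.2.compContinuousLinearMap ((ContinuousLinearMap.id ℝ V).prod p.1)) := by
  have h := (ContinuousLinearMap.prodL (𝕜 := ℝ) ℝ (E := V) (F := V) (G := V')).contDiff (n := ∞)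
  have h1 : ContDiff ℝ ∞ (fun p : (V →L[ℝ] V') × ((V × V') [⋀^Fin r]→L[ℝ] ℝ) =>
      (ContinuousLinearMap.id ℝ V).prod p.1) :=
    h.comp (contDiff_const.prodMk contDiff_fst)
  exact (contDiff_compContinuousLinearMapCLM r).comp (contDiff_snd.prodMk h1)

/-- A dimension count: an injective linear map from affine functions on `W` is surjective. -/
theorem exists_eq_of_finrank_le [FiniteDimensional ℝ V'] [FiniteDimensional ℝ W]
    (hr : Module.finrank ℝ V' ≤ Module.finrank ℝ W) (f : V →L[ℝ] V') (g : V →L[ℝ] ℝ)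
    (hfg : ∀ x, f x = 0 → g x = 0 → x = 0) (F : ℝ → (W →L[ℝ] ℝ) → V)
    (hF : ∀ c ℓ ℓ' D D', F (ℓ + c * ℓ') (D + c • D') = F ℓ D + c • F ℓ' D')
    (hF0 : ∀ ℓ D, F ℓ D = 0 → ℓ = 0 ∧ D = 0) (x : V) : ∃ ℓ D, x = F ℓ D := by
  -- Affinity with factor -1 at the origin reads F 0 0 = F 0 0 - F 0 0.
  have h0 : F 0 0 = 0 := by simpa using hF (-1) 0 0 0 0
  let Φ : ℝ × (W →L[ℝ] ℝ) →ₗ[ℝ] V :=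
    { toFun := fun p => F p.1 p.2
      map_add' := fun p q => by simpa using hF 1 p.1 q.1 p.2 q.2
      map_smul' := fun c p => by simpa [h0] using hF c 0 p.1 0 p.2 }
  have hΦ : Function.Injective Φ := by
    rw [← LinearMap.ker_eq_bot, LinearMap.ker_eq_bot']
    exact fun p hp => Prod.ext (hF0 _ _ hp).1 (hF0 _ _ hp).2
  -- `Ψ` bounds the dimension of `V` by dim V' + 1 ≤ dim W + 1, the dimension of the source of `Φ`;
  -- in particular `V` is finite-dimensional.
  let Ψ : V →ₗ[ℝ] V' × ℝ := (f : V →ₗ[ℝ] V').prod (g : V →ₗ[ℝ] ℝ)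
  have hΨ : Function.Injective Ψ := by
    rw [← LinearMap.ker_eq_bot, LinearMap.ker_eq_bot']
    exact fun x hx => hfg x (congrArg Prod.fst hx) (congrArg Prod.snd hx)
  have : FiniteDimensional ℝ V := FiniteDimensional.of_injective Ψ hΨ
  have h1 : Module.finrank ℝ V ≤ Module.finrank ℝ (ℝ × (W →L[ℝ] ℝ)) := by
    refine (LinearMap.finrank_le_finrank_of_injective hΨ).trans ?_
    rw [Module.finrank_prod, Module.finrank_prod,
      ← (LinearMap.toContinuousLinearMap (𝕜 := ℝ) (E := W) (F' := ℝ)).finrank_eq,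
      Module.finrank_linearMap, add_comm]
    simpa using hr
  obtain ⟨p, hp⟩ := (LinearMap.injective_iff_surjective_of_finrank_eq_finrank
    (le_antisymm (LinearMap.finrank_le_finrank_of_injective hΦ) h1)).1 hΦ x
  exact ⟨p.1, p.2, hp.symm⟩

end

/-! ### Smooth dependence and exhaustiveness of affine multimomenta. -/

section Smoothness

variable {k n : ℕ}

theorem contDiff_jetPull : ContDiff ℝ ∞ (fun p : Jet k n × ExtMom k n => jetPull p.1 p.2) := by
  have h : ContDiff ℝ ∞ (fun p : Jet k n × ExtMom k n => (p.1, formL k n p.2)) :=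
    contDiff_fst.prodMk ((formL k n).contDiff.comp contDiff_snd)
  exact contDiff_comp_graph.comp h

theorem contDiff_affineMom : ContDiff ℝ ∞
    (fun p : Vol k × ℝ × (Jet k n →L[ℝ] ℝ) × Jet k n => affineMom p.1 p.2.1 p.2.2.1 p.2.2.2) := by
  rw [← contDiffOn_univ]
  refine contDiffOn_of_injective_comp (formL k n) formL_injective ?_
  rw [contDiffOn_univ]
  show ContDiff ℝ ∞
    (fun p : Vol k × ℝ × (Jet k n →L[ℝ] ℝ) × Jet k n => affineForm p.1 p.2.1 p.2.2.1 p.2.2.2)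
  unfold affineForm
  refine ContDiff.add (ContDiff.sum fun ν _ => ?_) ?_
  · have h1 : ContDiff ℝ ∞ (fun p : Vol k × ℝ × (Jet k n →L[ℝ] ℝ) × Jet k n =>
        contactForm p.2.2.1 p.2.2.2 ν) := by
      unfold contactForm
      fun_prop
    have h2 : ContDiff ℝ ∞ (fun p : Vol k × ℝ × (Jet k n →L[ℝ] ℝ) × Jet k n =>
        (p.1.curryLeft (baseVec ν)).compContinuousLinearMap
          (ContinuousLinearMap.fst ℝ (BaseV k) (FibV n))) := by
      exact contDiff_curryLeft_comp _ _
    exact (ContinuousAlternatingMap.alternatizeUncurryFinCLM ℝ (TotV k n) ℝ).contDiff.comp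
      (h1.smulRight h2)
  · exact (contDiff_fst.comp contDiff_snd).smul (contDiff_comp_clm _)

theorem affineMom_add_smul {vol : Vol k} (c ℓ ℓ' : ℝ) (D D' : Jet k n →L[ℝ] ℝ) (v : Jet k n) :
    affineMom vol (ℓ + c * ℓ') (D + c • D') v =
      affineMom vol ℓ D v + c • affineMom vol ℓ' D' v := by
  refine extMom_eq_of_jetPull fun v' => ?_
  rw [← jetPullL_apply v' (_ + _), map_add, map_smul]
  simp only [jetPullL_apply, jetPull_affineMom, ← add_smul, smul_smul]
  congr 1
  simp
  ring

/-- The affine functions of jets embed in `ExtMom`, which has at most their dimension: a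
multimomentum is determined by its class in `ResMom` and by its basic part. -/
theorem exists_eq_affineMom {vol : Vol k} (hvol : vol ≠ 0) (v : Jet k n) (α : ExtMom k n) :
    ∃ ℓ D, α = affineMom vol ℓ D v := by
  refine exists_eq_of_finrank_le (V' := ResMom k n) (W := Jet k n) (finrank_resMom_le k n) (resL k n)
    ((ContinuousAlternatingMap.apply ℝ (BaseV k) ℝ baseVec).comp (jetPullL 0)) ?_
    (fun ℓ D => affineMom vol ℓ D v) ?_ ?_ α
  · intro α h1 h2
    have h2 : jetPull 0 α = 0 := vol_eq_zero h2
    refine ExtMom.ext_form ?_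
    rw [form_eq_of_resOfExt_eq_zero h1, h2]
    rfl
  · exact fun c ℓ ℓ' D D' => affineMom_add_smul c ℓ ℓ' D D' v
  · intro ℓ D h
    have h1 : ∀ v', ℓ + D (v' - v) = 0 := by
      intro v'
      have h2 : jetPull v' (affineMom vol ℓ D v) = 0 := by
        rw [show affineMom vol ℓ D v = 0 from h]; rfl
      rw [jetPull_affineMom] at h2
      exact (smul_eq_zero.1 h2).resolve_right hvol
    have h2 : ℓ = 0 := by simpa using h1 v
    refine ⟨h2, ContinuousLinearMap.ext fun a => ?_⟩
    simpa [h2] using h1 (v + a)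

end Smoothness

/-! ### The volume form and the coupling function in a fixed chart. -/

section Local

variable {k n : ℕ}
  {M : Type*} [TopologicalSpace M] [ChartedSpace (BaseV k) M] [IsManifold 𝓘(ℝ, BaseV k) ∞ M]
  {E : Type*} [TopologicalSpace E] [ChartedSpace (TotV k n) E] [IsManifold 𝓘(ℝ, TotV k n) ∞ E]
  {B : AdaptedBundle k n M E}

variable (B) in
/-- A volume form on the base at `B.proj y`, in the chart at `B.proj i`. -/
def volLoc (vol : M → Vol k) (i y : E) : Vol k :=
  (vol (B.proj y)).compContinuousLinearMap (B.baseChange i y y)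

theorem volLoc_ne_zero {vol : M → Vol k} (hvol0 : ∀ x, vol x ≠ 0) {i y : E}
    (hi : y ∈ (chartAt (TotV k n) i).source) : volLoc B vol i y ≠ 0 := by
  intro h
  apply hvol0 (B.proj y)
  have h1 : (volLoc B vol i y).compContinuousLinearMap (B.baseChange y i y) = vol (B.proj y) := by
    ext x
    show vol (B.proj y) (fun a => B.baseChange i y y (B.baseChange y i y (x a))) = _
    congr 1
    funext a
    rw [B.baseChange_comp y i y y (mem_chart_source _ _) hi (mem_chart_source _ _),
      B.baseChange_self y y (mem_chart_source _ _)]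
  rw [← h1, h]
  rfl

theorem contMDiffOn_volLoc {vol : M → Vol k} (hvol : SmoothForm (IB k) vol) (i : E) :
    ContMDiffOn (IE k n) 𝓘(ℝ, Vol k) ∞ (volLoc B vol i) (chartAt (TotV k n) i).source := by
  have h1 : ContMDiffOn (IE k n) 𝓘(ℝ, BaseV k) ∞
      (fun y => extChartAt (IB k) (B.proj i) (B.proj y)) (chartAt (TotV k n) i).source :=
    (contMDiffOn_extChartAt (I := IB k) (x := B.proj i)).comp B.contMDiff_proj.contMDiffOn
      fun y hy => B.proj_mem i y hy
  have h2 : ∀ y ∈ (chartAt (TotV k n) i).source, extChartAt (IB k) (B.proj i) (B.proj y) ∈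
      (extChartAt (IB k) (B.proj i)).target := fun y hy =>
    (extChartAt (IB k) (B.proj i)).map_source (by simpa using B.proj_mem i y hy)
  refine (((hvol (B.proj i)).contMDiffOn).comp h1 h2).congr fun y hy => ?_
  have h3 : (extChartAt (IB k) (B.proj i)).symm (extChartAt (IB k) (B.proj i) (B.proj y)) =
      B.proj y := (extChartAt (IB k) (B.proj i)).left_inv (by simpa using B.proj_mem i y hy)
  show volLoc B vol i y = formInChart (IB k) vol (B.proj i) _
  rw [formInChart, tmap_extChart_symm (h2 y hy), h3]
  rfl

theorem contMDiff_mkVel (y : E) : ContMDiff 𝓘(ℝ, Jet k n × Act k) (IVel k n) ∞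
    (fun f : Jet k n × Act k => (mkVel y f.1 f.2 : VelPhase B)) := by
  intro f
  refine (chartIndexed_velCore B).contMDiffAt_iff.2 ⟨contMDiffAt_const, ?_⟩
  refine contMDiffAt_id.congr_of_eventuallyEq (Filter.Eventually.of_forall fun f' => ?_)
  exact B.velCore.coordChange_self y y (mem_chart_source _ _) f'

theorem contMDiff_mkPont (y : E) : ContMDiff 𝓘(ℝ, Jet k n × ExtMom k n × Act k) (IPont k n) ∞
    (fun f : Jet k n × ExtMom k n × Act k => (mkPont y f.1 f.2.1 f.2.2 : Pont B)) := by
  intro f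
  refine (chartIndexed_pontCore B).contMDiffAt_iff.2 ⟨contMDiffAt_const, ?_⟩
  refine contMDiffAt_id.congr_of_eventuallyEq (Filter.Eventually.of_forall fun f' => ?_)
  exact B.pontCore.coordChange_self y y (mem_chart_source _ _) f'

theorem tmap_mkVel (y : E) (f : Jet k n × Act k) :
    tmap 𝓘(ℝ, Jet k n × Act k) (IVel k n)
      (fun f : Jet k n × Act k => (mkVel y f.1 f.2 : VelPhase B)) f =
      ContinuousLinearMap.inr ℝ (TotV k n) (Jet k n × Act k) := by
  refine tmap_eq_of_chart ((contMDiff_mkVel y).mdifferentiable (by simp) f)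
    (F := fun f => (chartAt (TotV k n) y y, f)) ?_
    (hasFDerivAt_prodMk_right _ _)
  refine Filter.Eventually.of_forall fun f' => ?_
  rw [extChartAt_vel]
  refine Prod.ext rfl ?_
  exact B.velCore.coordChange_self y y (mem_chart_source _ _) f'

theorem tmap_mkPont (y : E) (f : Jet k n × ExtMom k n × Act k) :
    tmap 𝓘(ℝ, Jet k n × ExtMom k n × Act k) (IPont k n)
      (fun f : Jet k n × ExtMom k n × Act k => (mkPont y f.1 f.2.1 f.2.2 : Pont B)) f =
      ContinuousLinearMap.inr ℝ (TotV k n) (Jet k n × ExtMom k n × Act k) := by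
  refine tmap_eq_of_chart ((contMDiff_mkPont y).mdifferentiable (by simp) f)
    (F := fun f => (chartAt (TotV k n) y y, f)) ?_
    (hasFDerivAt_prodMk_right _ _)
  refine Filter.Eventually.of_forall fun f' => ?_
  rw [extChartAt_pont]
  refine Prod.ext rfl ?_
  exact B.pontCore.coordChange_self y y (mem_chart_source _ _) f'

/-- The function `C` in coordinates. -/
theorem couplingFun_eq {vol : M → Vol k} (hvol0 : ∀ x, vol x ≠ 0) (w₀ w : Pont B)
    (hw : w ∈ (extChartAt (IPont k n) w₀).source) :
    couplingFun vol w = jetPull (extChartAt (IPont k n) w₀ w).2.1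
      (extChartAt (IPont k n) w₀ w).2.2.1 baseVec / volLoc B vol w₀.1 w.1 baseVec := by
  rw [extChartAt_pont_source] at hw
  rw [extChartAt_pont]
  simp only [B.jetPull_extMomChange w.1 w₀.1 w.1 (mem_chart_source _ _) hw]
  have h := eq_smul_vol (hvol0 (B.proj w.1)) (jetPull (pontJet w) (pontMom w))
  have h1 : (jetPull (pontJet w) (pontMom w)).compContinuousLinearMap (B.baseChange w₀.1 w.1 w.1) =
      couplingFun vol w • volLoc B vol w₀.1 w.1 := by
    conv_lhs => rw [h]
    rfl
  rw [h1]
  have h2 := vol_apply_ne_zero (volLoc_ne_zero (B := B) hvol0 hw)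
  simp [h2]

/-- Both `coupling` and the volume form are read in charts that move with the point. In a fixed
chart the common change of base coordinates cancels in the quotient, leaving smooth functions with
nonvanishing denominator. -/
theorem contMDiff_couplingFun {vol : M → Vol k} (hvol : SmoothForm (IB k) vol)
    (hvol0 : ∀ x, vol x ≠ 0) :
    ContMDiff (IPont k n) 𝓘(ℝ, ℝ) ∞ (couplingFun (B := B) vol) := by
  intro w₀
  have hs : (extChartAt (IPont k n) w₀).source ∈ nhds w₀ := extChartAt_source_mem_nhds w₀
  have h1 : ContMDiffAt (IPont k n) 𝓘(ℝ, ℝ) ∞ (fun w : Pont B =>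
      jetPull (extChartAt (IPont k n) w₀ w).2.1 (extChartAt (IPont k n) w₀ w).2.2.1 baseVec) w₀ := by
    have h : ContDiff ℝ ∞ (fun z : PontV k n => jetPull z.2.1 z.2.2.1 baseVec) := by
      have h2 : ContDiff ℝ ∞ (fun z : PontV k n => jetPull z.2.1 z.2.2.1) :=
        contDiff_jetPull.comp (by fun_prop : ContDiff ℝ ∞ (fun z : PontV k n => (z.2.1, z.2.2.1)))
      exact (ContinuousAlternatingMap.apply ℝ (BaseV k) ℝ baseVec).contDiff.comp h2
    exact h.contMDiff.contMDiffAt.comp w₀ contMDiffAt_extChartAt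
  have h2 : ContMDiffAt (IPont k n) 𝓘(ℝ, ℝ) ∞ (fun w : Pont B => volLoc B vol w₀.1 w.1 baseVec)
      w₀ := by
    have h : ContMDiffAt (IPont k n) 𝓘(ℝ, Vol k) ∞ (fun w : Pont B => volLoc B vol w₀.1 w.1) w₀ :=
      ((contMDiffOn_volLoc hvol w₀.1).contMDiffAt
        ((chartAt (TotV k n) w₀.1).open_source.mem_nhds (mem_chart_source _ _))).comp w₀
        (contMDiff_pontE w₀)
    exact (ContinuousAlternatingMap.apply ℝ (BaseV k) ℝ baseVec).contDiff.contMDiff.contMDiffAt.comp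
      w₀ h
  refine (h1.div₀ h2 (vol_apply_ne_zero
    (volLoc_ne_zero (B := B) hvol0 (mem_chart_source _ _)))).congr_of_eventuallyEq ?_
  filter_upwards [hs] with w hw
  exact couplingFun_eq hvol0 w₀ w hw

end Local

/-! ### Smoothness of the Legendre map and of its graph. -/

section Graph

variable {k n : ℕ}
  {M : Type*} [TopologicalSpace M] [ChartedSpace (BaseV k) M] [IsManifold 𝓘(ℝ, BaseV k) ∞ M]
  {E : Type*} [TopologicalSpace E] [ChartedSpace (TotV k n) E] [IsManifold 𝓘(ℝ, TotV k n) ∞ E]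

namespace AdaptedBundle

variable (B : AdaptedBundle k n M E)

/-- The linear part of the affine map `jetChange`. -/
def jetLin (i j y : E) : Jet k n →L[ℝ] Jet k n :=
  (ContinuousLinearMap.compL ℝ (BaseV k) (FibV n) (FibV n)
    ((ContinuousLinearMap.snd ℝ (BaseV k) (FibV n)).comp
      ((B.totChange i j y).comp (ContinuousLinearMap.inr ℝ (BaseV k) (FibV n))))).comp
    ((ContinuousLinearMap.compL ℝ (BaseV k) (BaseV k) (FibV n)).flip (B.baseChange j i y))

theorem jetLin_apply (i j y : E) (a : Jet k n) (x : BaseV k) :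
    B.jetLin i j y a x = (B.totChange i j y (0, a (B.baseChange j i y x))).2 := rfl

theorem jetChange_eq (i j y : E) (v : Jet k n) :
    B.jetChange i j y v = B.jetLin i j y v + B.jetChange i j y 0 := by
  ext x : 1
  rw [ContinuousLinearMap.add_apply, jetLin_apply]
  show (B.totChange i j y (B.baseChange j i y x, v (B.baseChange j i y x))).2 =
    _ + (B.totChange i j y (B.baseChange j i y x, 0)).2
  rw [← Prod.snd_add, ← map_add]
  simp

theorem jetChange_sub (i j y : E) (v v' : Jet k n) :
    B.jetChange i j y v' - B.jetChange i j y v = B.jetLin i j y (v' - v) := by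
  rw [B.jetChange_eq i j y v', B.jetChange_eq i j y v, map_sub]
  abel

end AdaptedBundle

variable {B : AdaptedBundle k n M E} {L : VelPhase B → ℝ}

theorem contDiff_lagrangian_fibre (hL : ContMDiff (IVel k n) 𝓘(ℝ, ℝ) ∞ L) (y : E) :
    ContDiff ℝ ∞ (fun f : Jet k n × Act k => L (mkVel y f.1 f.2)) :=
  (hL.comp (contMDiff_mkVel y)).contDiff

theorem contDiff_lagrangian_jet (hL : ContMDiff (IVel k n) 𝓘(ℝ, ℝ) ∞ L) (y : E) (s : Act k) :
    ContDiff ℝ ∞ (fun v : Jet k n => L (mkVel y v s)) :=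
  (contDiff_lagrangian_fibre hL y).comp (contDiff_id.prodMk contDiff_const)

theorem contDiffOn_lagrangian_chart (hL : ContMDiff (IVel k n) 𝓘(ℝ, ℝ) ∞ L) (p₀ : VelPhase B) :
    ContDiffOn ℝ ∞ (fun z => L ((extChartAt (IVel k n) p₀).symm z))
      (extChartAt (IVel k n) p₀).target :=
  (hL.comp_contMDiffOn (contMDiffOn_extChartAt_symm p₀)).contDiffOn

/-- `fibreDeriv` is taken in the chart preferred at the moving base point, so its smoothness is not
visible. Jets transform affinely along a fibre, and the chain rule relates it to an ordinary partial
derivative in a fixed chart through the linear part `jetLin`. -/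
theorem fderiv_lagrangian_chart (hL : ContMDiff (IVel k n) 𝓘(ℝ, ℝ) ∞ L) (p₀ p : VelPhase B)
    (hp : p ∈ (extChartAt (IVel k n) p₀).source) (a : Jet k n) :
    fderiv ℝ (fun z => L ((extChartAt (IVel k n) p₀).symm z)) (extChartAt (IVel k n) p₀ p)
      (0, (a, 0)) = fibreDeriv L p (B.jetLin p₀.1 p.1 p.1 a) := by
  have hp1 : p.1 ∈ (chartAt (TotV k n) p₀.1).source := by
    rw [extChartAt_vel_source] at hp; exact hp
  have hz := (extChartAt (IVel k n) p₀).map_source hp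
  have hd : DifferentiableAt ℝ (fun z => L ((extChartAt (IVel k n) p₀).symm z))
      (extChartAt (IVel k n) p₀ p) :=
    ((contDiffOn_lagrangian_chart hL p₀).contDiffAt
      ((isOpen_extChartAt_target p₀).mem_nhds hz)).differentiableAt (by simp)
  set z := extChartAt (IVel k n) p₀ p with hzdef
  have hg : HasFDerivAt (fun a : Jet k n => ((z.1, (a, z.2.2)) : VelV k n))
      ((ContinuousLinearMap.inr ℝ (TotV k n) (Jet k n × Act k)).comp
        (ContinuousLinearMap.inl ℝ (Jet k n) (Act k))) z.2.1 :=
    (hasFDerivAt_prodMk_right z.1 _).comp z.2.1 (hasFDerivAt_prodMk_left z.2.1 z.2.2)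
  have h1 := HasFDerivAt.comp (g := fun z => L ((extChartAt (IVel k n) p₀).symm z)) z.2.1
    (hd.hasFDerivAt) hg
  have hJ : B.jetChange p₀.1 p.1 p.1 z.2.1 = velJet p := by
    rw [hzdef, extChartAt_vel]
    simp only
    rw [B.jetChange_comp p.1 p₀.1 p.1 p.1 (mem_chart_source _ _) hp1 (mem_chart_source _ _),
      B.jetChange_self p.1 p.1 (mem_chart_source _ _)]
  have hA : B.actChange p₀.1 p.1 p.1 z.2.2 = velAct p := by
    rw [hzdef, extChartAt_vel]
    simp only
    rw [B.actChange_comp p.1 p₀.1 p.1 p.1 (mem_chart_source _ _) hp1 (mem_chart_source _ _),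
      B.actChange_self p.1 p.1 (mem_chart_source _ _)]
  have hy : (chartAt (TotV k n) p₀.1).symm z.1 = p.1 := by
    rw [hzdef, extChartAt_vel]
    exact (chartAt (TotV k n) p₀.1).left_inv hp1
  have h2 : HasFDerivAt (fun a => B.jetChange p₀.1 p.1 p.1 a) (B.jetLin p₀.1 p.1 p.1) z.2.1 := by
    have : (fun a => B.jetChange p₀.1 p.1 p.1 a) = fun a => B.jetLin p₀.1 p.1 p.1 a +
      B.jetChange p₀.1 p.1 p.1 0 := funext fun a => B.jetChange_eq _ _ _ a
    rw [this]
    exact (B.jetLin p₀.1 p.1 p.1).hasFDerivAt.add_const _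
  have h3 : HasFDerivAt (fun v => L (mkVel p.1 v (velAct p))) (fibreDeriv L p)
      (B.jetChange p₀.1 p.1 p.1 z.2.1) := by
    rw [hJ]
    exact ((contDiff_lagrangian_jet hL p.1 (velAct p)).differentiable (by simp) _).hasFDerivAt
  have h4 := h3.comp z.2.1 h2
  have h5 : (fun z => L ((extChartAt (IVel k n) p₀).symm z)) ∘
      (fun a : Jet k n => ((z.1, (a, z.2.2)) : VelV k n)) =
      (fun v => L (mkVel p.1 v (velAct p))) ∘ (fun a => B.jetChange p₀.1 p.1 p.1 a) := by
    funext a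
    simp only [Function.comp_apply]
    rw [extChartAt_vel_symm]
    simp only [hy, hA]
  rw [h5] at h1
  exact congrArg (fun T : Jet k n →L[ℝ] ℝ => T a) (h1.unique h4)

variable {vol : M → Vol k}

theorem extLegendre_eq (p : VelPhase B) : extLegendre vol L p =
    affineMom (vol (velM p)) (L p) (fibreDeriv L p) (velJet p) := rfl

/-- The extended Legendre map in coordinates. -/
theorem extMomChange_extLegendre (hL : ContMDiff (IVel k n) 𝓘(ℝ, ℝ) ∞ L) (p₀ p : VelPhase B)
    (hp : p ∈ (extChartAt (IVel k n) p₀).source) :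
    B.extMomChange p.1 p₀.1 p.1 (extLegendre vol L p) =
      affineMom (volLoc B vol p₀.1 p.1) (L p)
        ((fderiv ℝ (fun z => L ((extChartAt (IVel k n) p₀).symm z))
          (extChartAt (IVel k n) p₀ p)).comp
          ((ContinuousLinearMap.inr ℝ (TotV k n) (Jet k n × Act k)).comp
            (ContinuousLinearMap.inl ℝ (Jet k n) (Act k))))
        (extChartAt (IVel k n) p₀ p).2.1 := by
  have hp1 : p.1 ∈ (chartAt (TotV k n) p₀.1).source := by
    rw [extChartAt_vel_source] at hp; exact hp
  -- Both sides are compared as affine functions of the jet; the difference of two jets transforms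
  -- linearly.
  refine extMom_eq_of_jetPull fun v' => ?_
  have hv' : v' = B.jetChange p.1 p₀.1 p.1 (B.jetChange p₀.1 p.1 p.1 v') := by
    rw [B.jetChange_comp p₀.1 p.1 p₀.1 p.1 hp1 (mem_chart_source _ _) hp1,
      B.jetChange_self p₀.1 p.1 hp1]
  have hJ : B.jetChange p₀.1 p.1 p.1 (extChartAt (IVel k n) p₀ p).2.1 = velJet p := by
    rw [extChartAt_vel]
    simp only
    rw [B.jetChange_comp p.1 p₀.1 p.1 p.1 (mem_chart_source _ _) hp1 (mem_chart_source _ _),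
      B.jetChange_self p.1 p.1 (mem_chart_source _ _)]
  conv_lhs => rw [hv', B.jetPull_extMomChange p.1 p₀.1 p.1 (mem_chart_source _ _) hp1,
    extLegendre_eq, jetPull_affineMom, ← hJ, B.jetChange_sub]
  rw [jetPull_affineMom]
  have h := fderiv_lagrangian_chart hL p₀ p hp (v' - (extChartAt (IVel k n) p₀ p).2.1)
  rw [← h]
  rfl

/-- In a fixed chart the multimomentum component is `affineMom` of smooth data: the volume form, L,
its partial derivative and the jet coordinates. -/
theorem contMDiff_legendreGraph (hvol : SmoothForm (IB k) vol)
    (hL : ContMDiff (IVel k n) 𝓘(ℝ, ℝ) ∞ L) :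
    ContMDiff (IVel k n) (IPont k n) ∞ (legendreGraph vol L) := by
  intro p₀
  have hs : (extChartAt (IVel k n) p₀).source ∈ nhds p₀ := extChartAt_source_mem_nhds p₀
  have hc : ContMDiffAt (IVel k n) 𝓘(ℝ, VelV k n) ∞ (extChartAt (IVel k n) p₀) p₀ :=
    contMDiffAt_extChartAt
  refine (chartIndexed_pontCore B).contMDiffAt_iff.2 ⟨contMDiff_velE p₀, ?_⟩
  have h1 : ContMDiffAt (IVel k n) 𝓘(ℝ, Jet k n) ∞
      (fun p => (extChartAt (IVel k n) p₀ p).2.1) p₀ :=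
    (by fun_prop : ContDiff ℝ ∞ (fun z : VelV k n => z.2.1)).contMDiff.contMDiffAt.comp p₀ hc
  have h2 : ContMDiffAt (IVel k n) 𝓘(ℝ, Act k) ∞
      (fun p => (extChartAt (IVel k n) p₀ p).2.2) p₀ :=
    (by fun_prop : ContDiff ℝ ∞ (fun z : VelV k n => z.2.2)).contMDiff.contMDiffAt.comp p₀ hc
  have hv : ContMDiffAt (IVel k n) 𝓘(ℝ, Vol k) ∞ (fun p : VelPhase B => volLoc B vol p₀.1 p.1) p₀ :=
    ((contMDiffOn_volLoc hvol p₀.1).contMDiffAt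
      ((chartAt (TotV k n) p₀.1).open_source.mem_nhds (mem_chart_source _ _))).comp p₀
      (contMDiff_velE p₀)
  have hD : ContDiffAt ℝ ∞ (fun z => (fderiv ℝ (fun z => L ((extChartAt (IVel k n) p₀).symm z))
          z).comp
          ((ContinuousLinearMap.inr ℝ (TotV k n) (Jet k n × Act k)).comp
            (ContinuousLinearMap.inl ℝ (Jet k n) (Act k)))) (extChartAt (IVel k n) p₀ p₀) := by
    have h := ((contDiffOn_lagrangian_chart hL p₀).contDiffAt
      ((isOpen_extChartAt_target p₀).mem_nhds (mem_extChartAt_target p₀))).fderiv_right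
      (m := ∞) (by simp)
    exact h.clm_comp contDiffAt_const
  have hD' := hD.contMDiffAt.comp p₀ hc
  have h3 : ContMDiffAt (IVel k n) 𝓘(ℝ, ExtMom k n) ∞
      (fun p : VelPhase B => B.extMomChange p.1 p₀.1 p.1 (extLegendre vol L p)) p₀ := by
    refine (contDiff_affineMom.contMDiff.contMDiffAt.comp p₀ (hv.prodMk_space
      ((hL p₀).prodMk_space (hD'.prodMk_space h1)))).congr_of_eventuallyEq ?_
    filter_upwards [hs] with p hp
    exact extMomChange_extLegendre hL p₀ p hp
  refine (h1.prodMk_space (h3.prodMk_space h2)).congr_of_eventuallyEq ?_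
  refine Filter.Eventually.of_forall fun p => ?_
  simp only [extChartAt_vel]
  rfl

theorem contMDiff_legendre (hvol : SmoothForm (IB k) vol)
    (hL : ContMDiff (IVel k n) 𝓘(ℝ, ℝ) ∞ L) :
    ContMDiff (IVel k n) (IMom k n) ∞ (legendre vol L) :=
  contMDiff_prBar.comp (contMDiff_legendreGraph hvol hL)

end Graph

/-! ### `W1` is the graph of the extended Legendre map. -/

section Constraint

variable {k n : ℕ}
  {M : Type*} [TopologicalSpace M] [ChartedSpace (BaseV k) M] [IsManifold 𝓘(ℝ, BaseV k) ∞ M]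
  {E : Type*} [TopologicalSpace E] [ChartedSpace (TotV k n) E] [IsManifold 𝓘(ℝ, TotV k n) ∞ E]
  {B : AdaptedBundle k n M E} {vol : M → Vol k} {L : VelPhase B → ℝ}

variable (vol L) in
/-- The function `C - L`, whose zero set is `𝒲_∘`. -/
def constraintFun (w : Pont B) : ℝ := couplingFun vol w - L (pr w)

theorem contMDiff_constraintFun (hvol : SmoothForm (IB k) vol) (hvol0 : ∀ x, vol x ≠ 0)
    (hL : ContMDiff (IVel k n) 𝓘(ℝ, ℝ) ∞ L) :
    ContMDiff (IPont k n) 𝓘(ℝ, ℝ) ∞ (constraintFun vol L) :=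
  (contMDiff_couplingFun hvol hvol0).sub (hL.comp contMDiff_pr)

theorem mem_tangentW0 {w : Pont B} {u : PontV k n} : u ∈ tangentW0 vol L w ↔
    tmap (IPont k n) 𝓘(ℝ, ℝ) (constraintFun vol L) w u = 0 := Iff.rfl

/-- Along the fibre with fixed jet, C is linear in the multimomentum and L is constant. -/
theorem tmap_constraintFun_mom (hvol : SmoothForm (IB k) vol) (hvol0 : ∀ x, vol x ≠ 0)
    (hL : ContMDiff (IVel k n) 𝓘(ℝ, ℝ) ∞ L) (w : Pont B) (β : ExtMom k n) :
    tmap (IPont k n) 𝓘(ℝ, ℝ) (constraintFun vol L) w (0, (0, β, 0)) =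
      jetPull (pontJet w) β baseVec / vol (pontM w) baseVec := by
  have hF := contMDiff_constraintFun hvol hvol0 hL
  have hι := contMDiff_mkPont (B := B) w.1
  have hj : ContDiff ℝ ∞ (fun α : ExtMom k n =>
      ((pontJet w, α, pontAct w) : Jet k n × ExtMom k n × Act k)) :=
    contDiff_const.prodMk (contDiff_id.prodMk contDiff_const)
  have h1 := tmap_comp (I := 𝓘(ℝ, ExtMom k n)) (g := constraintFun vol L)
    (f := fun α : ExtMom k n => (mkPont w.1 (pontJet w) α (pontAct w) : Pont B)) (q := pontMom w)
    (hF.mdifferentiable (by simp) _) ((hι.comp hj.contMDiff).mdifferentiable (by simp) _)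
  have h2 := tmap_comp (I := 𝓘(ℝ, ExtMom k n))
    (g := fun f : Jet k n × ExtMom k n × Act k => (mkPont w.1 f.1 f.2.1 f.2.2 : Pont B))
    (f := fun α : ExtMom k n => (pontJet w, α, pontAct w)) (q := pontMom w)
    (hι.mdifferentiable (by simp) _) (hj.contMDiff.mdifferentiable (by simp) _)
  have h3 : HasFDerivAt (fun α : ExtMom k n =>
      ((pontJet w, α, pontAct w) : Jet k n × ExtMom k n × Act k))
      ((ContinuousLinearMap.inr ℝ (Jet k n) (ExtMom k n × Act k)).comp
        (ContinuousLinearMap.inl ℝ (ExtMom k n) (Act k))) (pontMom w) :=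
    (hasFDerivAt_prodMk_right _ _).comp _ (hasFDerivAt_prodMk_left _ _)
  rw [tmap_mkPont, tmap_eq_fderiv, h3.fderiv] at h2
  have h4 : HasFDerivAt (fun α : ExtMom k n =>
      constraintFun vol L (mkPont w.1 (pontJet w) α (pontAct w) : Pont B))
      ((vol (pontM w) baseVec)⁻¹ • (ContinuousAlternatingMap.apply ℝ (BaseV k) ℝ baseVec).comp
        (jetPullL (pontJet w))) (pontMom w) := by
    have h := ((vol (pontM w) baseVec)⁻¹ • (ContinuousAlternatingMap.apply ℝ (BaseV k) ℝ
      baseVec).comp (jetPullL (pontJet w))).hasFDerivAt.sub_const (x := pontMom w) (L (pr w))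
    refine h.congr_of_eventuallyEq (Filter.Eventually.of_forall fun α => ?_)
    show jetPull (pontJet w) α baseVec / vol (pontM w) baseVec - L (pr w) =
      (vol (pontM w) baseVec)⁻¹ * jetPull (pontJet w) α baseVec - L (pr w)
    ring
  rw [tmap_eq_fderiv, h4.fderiv, h2] at h1
  have h5 := congrArg (fun T : ExtMom k n →L[ℝ] ℝ => T β) h1
  refine (Eq.trans ?_ h5.symm).trans ?_
  · rfl
  · show (vol (pontM w) baseVec)⁻¹ * jetPull (pontJet w) β baseVec = _
    ring

/-- Along the fibre with fixed multimomentum, C is the affine function of the jet with slope `D`.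
Its derivative is compared with that of L; the difference vanishes for all `a` exactly on the
Legendre relation. -/
theorem tmap_constraintFun_jet (hvol : SmoothForm (IB k) vol) (hvol0 : ∀ x, vol x ≠ 0)
    (hL : ContMDiff (IVel k n) 𝓘(ℝ, ℝ) ∞ L) (w : Pont B) {ℓ : ℝ} {D : Jet k n →L[ℝ] ℝ}
    (hw : pontMom w = affineMom (vol (pontM w)) ℓ D (pontJet w)) (a : Jet k n) :
    tmap (IPont k n) 𝓘(ℝ, ℝ) (constraintFun vol L) w (0, (a, 0, 0)) =
      D a - fibreDeriv L (pr w) a := by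
  have hF := contMDiff_constraintFun hvol hvol0 hL
  have hι := contMDiff_mkPont (B := B) w.1
  have hj : ContDiff ℝ ∞ (fun v : Jet k n =>
      ((v, pontMom w, pontAct w) : Jet k n × ExtMom k n × Act k)) :=
    contDiff_id.prodMk contDiff_const
  have h1 := tmap_comp (I := 𝓘(ℝ, Jet k n)) (g := constraintFun vol L)
    (f := fun v : Jet k n => (mkPont w.1 v (pontMom w) (pontAct w) : Pont B)) (q := pontJet w)
    (hF.mdifferentiable (by simp) _) ((hι.comp hj.contMDiff).mdifferentiable (by simp) _)
  have h2 := tmap_comp (I := 𝓘(ℝ, Jet k n))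
    (g := fun f : Jet k n × ExtMom k n × Act k => (mkPont w.1 f.1 f.2.1 f.2.2 : Pont B))
    (f := fun v : Jet k n => (v, pontMom w, pontAct w)) (q := pontJet w)
    (hι.mdifferentiable (by simp) _) (hj.contMDiff.mdifferentiable (by simp) _)
  have h3 : HasFDerivAt (fun v : Jet k n =>
      ((v, pontMom w, pontAct w) : Jet k n × ExtMom k n × Act k))
      (ContinuousLinearMap.inl ℝ (Jet k n) (ExtMom k n × Act k)) (pontJet w) :=
    hasFDerivAt_prodMk_left _ _
  rw [tmap_mkPont, tmap_eq_fderiv, h3.fderiv] at h2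
  have hLd : HasFDerivAt (fun v => L (mkVel w.1 v (pontAct w))) (fibreDeriv L (pr w)) (pontJet w) :=
    ((contDiff_lagrangian_jet hL w.1 (pontAct w)).differentiable (by simp) _).hasFDerivAt
  have h4 : HasFDerivAt (fun v : Jet k n =>
      constraintFun vol L (mkPont w.1 v (pontMom w) (pontAct w) : Pont B))
      (D - fibreDeriv L (pr w)) (pontJet w) := by
    have h := (D.hasFDerivAt.const_add (x := pontJet w) (ℓ - D (pontJet w))).sub hLd
    refine h.congr_of_eventuallyEq (Filter.Eventually.of_forall fun v => ?_)
    show jetPull v (pontMom w) baseVec / vol (pontM w) baseVec - L (mkVel w.1 v (pontAct w)) =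
      ℓ - D (pontJet w) + D v - L (mkVel w.1 v (pontAct w))
    have h0 := vol_apply_ne_zero (hvol0 (pontM w))
    rw [hw, jetPull_affineMom, map_sub]
    congr 1
    rw [ContinuousAlternatingMap.smul_apply, smul_eq_mul, mul_div_cancel_right₀ _ h0]
    ring
  rw [tmap_eq_fderiv, h4.fderiv, h2] at h1
  have h5 := congrArg (fun T : Jet k n →L[ℝ] ℝ => T a) h1
  exact h5.symm

theorem tmap_constraintFun_vertical (hvol : SmoothForm (IB k) vol) (hvol0 : ∀ x, vol x ≠ 0)
    (hL : ContMDiff (IVel k n) 𝓘(ℝ, ℝ) ∞ L) (w : Pont B) {ℓ : ℝ} {D : Jet k n →L[ℝ] ℝ}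
    (hw : pontMom w = affineMom (vol (pontM w)) ℓ D (pontJet w)) (a : Jet k n) (β : ExtMom k n) :
    tmap (IPont k n) 𝓘(ℝ, ℝ) (constraintFun vol L) w (0, (a, β, 0)) =
      D a - fibreDeriv L (pr w) a + jetPull (pontJet w) β baseVec / vol (pontM w) baseVec := by
  have h : ((0, (a, β, 0)) : PontV k n) = (0, (a, 0, 0)) + (0, (0, β, 0)) := by simp
  rw [h, map_add, tmap_constraintFun_jet hvol hvol0 hL w hw, tmap_constraintFun_mom hvol hvol0 hL]

/-- Vectors tangent to `𝒲_∘` have arbitrary components in the directions of the configuration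
bundle. -/
theorem exists_mem_tangentW0 (hvol : SmoothForm (IB k) vol) (hvol0 : ∀ x, vol x ≠ 0)
    (hL : ContMDiff (IVel k n) 𝓘(ℝ, ℝ) ∞ L) (w : Pont B) (e : TotV k n) :
    ∃ Y : TW0 vol L w, (inclW0 vol L w Y).1 = e := by
  set c := tmap (IPont k n) 𝓘(ℝ, ℝ) (constraintFun vol L) w (e, (0, 0, 0)) with hc
  have h0 := vol_apply_ne_zero (hvol0 (pontM w))
  -- A basic multimomentum changes C by its coefficient, so `-c` compensates the derivative `c` of
  -- the constraint along `e`.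
  refine ⟨⟨(e, (0, affineMom (vol (pontM w)) (-c) 0 0, 0)), mem_tangentW0.2 ?_⟩, rfl⟩
  have h : ((e, (0, affineMom (vol (pontM w)) (-c) 0 0, 0)) : PontV k n) =
      (e, (0, 0, 0)) + (0, (0, affineMom (vol (pontM w)) (-c) 0 0, 0)) := by simp
  rw [h, map_add, tmap_constraintFun_mom hvol hvol0 hL, ← hc, jetPull_affineMom]
  rw [ContinuousAlternatingMap.smul_apply, smul_eq_mul, mul_div_cancel_right₀ _ h0]
  simp

theorem surjective_fst_inclW0 (hvol : SmoothForm (IB k) vol) (hvol0 : ∀ x, vol x ≠ 0)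
    (hL : ContMDiff (IVel k n) 𝓘(ℝ, ℝ) ∞ L) (w : Pont B) (x : BaseV k) :
    ∃ Y : TW0 vol L w, (inclW0 vol L w Y).1.1 = x := by
  obtain ⟨Y, hY⟩ := exists_mem_tangentW0 hvol hvol0 hL w (x, 0)
  exact ⟨Y, by rw [hY]⟩

/-- The contraction of `dΘ` with a vector that is vertical over the configuration bundle. -/
theorem curryLeft_extD_thetaPont (w : Pont B) {Y : PontV k n} (hY : Y.1 = 0) :
    (extD (IPont k n) thetaPont w).curryLeft Y =
      -Y.2.2.1.form.compContinuousLinearMap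
        (ContinuousLinearMap.fst ℝ (TotV k n) (Jet k n × ExtMom k n × Act k)) := by
  rw [extD_thetaPont]
  ext u
  show -(ContinuousAlternatingMap.alternatizeUncurryFin (liouvilleL k n) (Matrix.vecCons Y u)) =
    -(Y.2.2.1.form (fun i => (u i).1))
  -- Only the term that differentiates along `Y` survives; in the others `Y` is an argument of a
  -- form pulled back from E.
  rw [ContinuousAlternatingMap.alternatizeUncurryFin_apply, Fin.sum_univ_succ,
    Finset.sum_eq_zero fun i _ => ?_]
  · simp
    rfl
  · have h : (Matrix.vecCons (Y.1) fun j => (u (i.succAbove j)).1) 0 = 0 := by simp [hY]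
    have h1 : liouvilleL k n (Matrix.vecCons Y u i.succ) (i.succ.removeNth (Matrix.vecCons Y u)) =
        0 := by
      refine (u i).2.2.1.form.map_coord_zero 0 ?_
      simpa [Fin.removeNth] using hY
    rw [h1, smul_zero]

/-- The contraction of `Θ` with a vector in the direction of the multimomenta vanishes. -/
theorem curryLeft_thetaPont (w : Pont B) {Y : PontV k n} (hY : Y.1 = 0) (hYs : Y.2.2.2 = 0) :
    (thetaPont w).curryLeft Y = 0 := by
  rw [thetaPont_eq]
  ext u
  show -((pontMom w).form (fun i => (Matrix.vecCons Y u i).1)) +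
    ContinuousAlternatingMap.alternatizeUncurryFin (actionL k n) (Matrix.vecCons Y u) = 0
  -- The Liouville part dies because `Y` is vertical. In dS, differentiation along `Y` sees only its
  -- action component, and the remaining terms see only its projection to the base.
  rw [(pontMom w).form.map_coord_zero 0 (by simpa using hY),
    ContinuousAlternatingMap.alternatizeUncurryFin_apply, Fin.sum_univ_succ,
    Finset.sum_eq_zero fun i _ => ?_]
  · have h1 : actionL k n Y = 0 := by
      show (Y.2.2.2).compContinuousLinearMap _ = 0
      rw [hYs]; rfl
    simp [h1]
  · have hk : ∃ j : Fin k, i.succ.succAbove j = 0 := by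
      obtain ⟨j, hj⟩ := Fin.exists_succAbove_eq (Fin.succ_ne_zero i).symm
      exact ⟨j, hj⟩
    obtain ⟨j, hj⟩ := hk
    have h1 : actionL k n (Matrix.vecCons Y u i.succ) (i.succ.removeNth (Matrix.vecCons Y u)) =
        0 := by
      refine (u i).2.2.2.map_coord_zero j ?_
      simp [Fin.removeNth, hj, hY]
    rw [h1, smul_zero]

/-- A vector tangent to `𝒲_∘` that is vertical over the multimomentum phase bundle. -/
theorem eq_of_prBarL_eq_zero {vol : Vol k} (hvol : vol ≠ 0) {Y : PontV k n} (v : Jet k n)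
    (hY : prBarL k n Y = 0) : ∃ c : ℝ, Y = (0, (Y.2.1, affineMom vol c 0 v, 0)) := by
  have h1 : Y.1 = 0 := congrArg Prod.fst hY
  have h2 : resOfExt Y.2.2.1 = 0 := congrArg (fun q => q.2.1) hY
  have h3 : Y.2.2.2 = 0 := congrArg (fun q => q.2.2) hY
  refine ⟨jetPull 0 Y.2.2.1 baseVec / vol baseVec, ?_⟩
  refine Prod.ext h1 (Prod.ext rfl (Prod.ext ?_ h3))
  refine extMom_eq_of_jetPull fun v' => ?_
  show _ = jetPull v' (affineMom vol _ 0 v)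
  rw [jetPull_affineMom, zero_apply, add_zero, ← eq_smul_vol hvol]
  ext u
  rw [jetPull_apply, form_eq_of_resOfExt_eq_zero h2]
  rfl

theorem pr_legendreGraph (p : VelPhase B) : pr (legendreGraph vol L p) = p := rfl

theorem legendreGraph_mem_W0 (p : VelPhase B) : legendreGraph vol L p ∈ W0 vol L := by
  show jetPull (velJet p) (extLegendre vol L p) = L p • vol (velM p)
  rw [extLegendre_eq, jetPull_affineMom, sub_self, map_zero, add_zero]

/-- Along the graph of the Legendre map, the vectors that are tangent to `𝒲_∘` and vertical over
the multimomentum phase bundle are in the direction of the jets. -/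
theorem eq_of_prBarL_eq_zero_of_tangent (hvol : SmoothForm (IB k) vol) (hvol0 : ∀ x, vol x ≠ 0)
    (hL : ContMDiff (IVel k n) 𝓘(ℝ, ℝ) ∞ L) (p : VelPhase B) {Y : PontV k n}
    (hY : prBarL k n Y = 0) (hT : Y ∈ tangentW0 vol L (legendreGraph vol L p)) :
    Y = (0, (Y.2.1, 0, 0)) := by
  obtain ⟨c, hc⟩ := eq_of_prBarL_eq_zero (hvol0 (velM p)) (velJet p) hY
  have h0 := vol_apply_ne_zero (hvol0 (velM p))
  rw [mem_tangentW0] at hT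
  -- On the graph the slope of C equals the fibre derivative of L, so the jet contribution cancels
  -- and tangency reduces to c = 0.
  rw [hc, tmap_constraintFun_vertical hvol hvol0 hL (legendreGraph vol L p) (extLegendre_eq p)] at hT
  have hT' : fibreDeriv L p Y.2.1 - fibreDeriv L p Y.2.1 +
    jetPull (velJet p) (affineMom (vol (velM p)) c 0 (velJet p)) baseVec / vol (velM p) baseVec
      = 0 := hT
  rw [jetPull_affineMom, ContinuousAlternatingMap.smul_apply, smul_eq_mul,
    mul_div_cancel_right₀ _ h0] at hT'
  have hc0 : c = 0 := by simpa using hT'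
  have h1 : affineMom (vol (velM p)) c 0 (velJet p) = 0 := by
    refine extMom_eq_of_jetPull fun v' => ?_
    rw [jetPull_affineMom, hc0]
    simp
    rfl
  rw [h1] at hc
  exact hc

/-- The vertical vectors to be tested have no multimomentum component here, and that is the only
component which dΘ sees in a vector vertical over E. -/
theorem legendreGraph_mem_W1 (hvol : SmoothForm (IB k) vol) (hvol0 : ∀ x, vol x ≠ 0)
    (hL : ContMDiff (IVel k n) 𝓘(ℝ, ℝ) ∞ L) (p : VelPhase B) :
    legendreGraph vol L p ∈ W1 vol L := by
  refine ⟨legendreGraph_mem_W0 p, fun Y hY => ?_⟩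
  rw [tmap_prBar] at hY
  have h := eq_of_prBarL_eq_zero_of_tangent hvol hvol0 hL p hY Y.2
  have h1 := curryLeft_extD_thetaPont (legendreGraph vol L p) (Y := inclW0 vol L _ Y)
    (congrArg Prod.fst h)
  have h2 : (inclW0 vol L _ Y).2.2.1 = 0 := congrArg (fun q => q.2.2.1) h
  ext u
  have h3 := congrArg (fun T => T (fun i => inclW0 vol L _ (u i))) h1
  rw [h2] at h3
  refine Eq.trans ?_ (h3.trans ?_)
  · show extD (IPont k n) thetaPont _ (fun i => inclW0 vol L _ (Matrix.vecCons Y u i)) =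
      extD (IPont k n) thetaPont _ (Matrix.vecCons (inclW0 vol L _ Y) fun i => inclW0 vol L _ (u i))
    congr 1
    funext i
    refine Fin.cases ?_ (fun i => ?_) i <;> rfl
  · show -(0 : ℝ) = 0
    simp

/-- Write the multimomentum as `affineMom` with data ℓ and D at the given jet. Membership in `W0`
gives ℓ = L, and the test vectors of the definition of `W1` give D = ∂L. -/
theorem eq_legendreGraph_of_mem_W1 (hvol : SmoothForm (IB k) vol) (hvol0 : ∀ x, vol x ≠ 0)
    (hL : ContMDiff (IVel k n) 𝓘(ℝ, ℝ) ∞ L) {w : Pont B} (hw : w ∈ W1 vol L) :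
    legendreGraph vol L (pr w) = w := by
  have h0 := vol_apply_ne_zero (hvol0 (pontM w))
  obtain ⟨ℓ, D, hα⟩ := exists_eq_affineMom (hvol0 (pontM w)) (pontJet w) (pontMom w)
  have hℓ : ℓ = L (pr w) := by
    have h1 : jetPull (pontJet w) (pontMom w) = L (pr w) • vol (pontM w) := hw.1
    rw [hα, jetPull_affineMom, sub_self, map_zero, add_zero] at h1
    exact smul_left_injective ℝ (hvol0 (pontM w)) h1
  have hD : D = fibreDeriv L (pr w) := by
    ext a
    set c := D a - fibreDeriv L (pr w) a with hc
    -- The basic form -c vol balances the derivative `c` of the constraint along `a`, so (0, a, β,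
    -- 0) is tangent to `W0`. Being basic, it does not show in 𝒫*.
    let β := affineMom (n := n) (vol (pontM w)) (-c) 0 0
    have hT : ((0, (a, β, 0)) : PontV k n) ∈ tangentW0 vol L w := by
      rw [mem_tangentW0, tmap_constraintFun_vertical hvol hvol0 hL w hα, ← hc, jetPull_affineMom,
        ContinuousAlternatingMap.smul_apply, smul_eq_mul, mul_div_cancel_right₀ _ h0]
      simp
    have hres : resOfExt β = 0 := by
      have h1 : β = affineMom (n := n) (vol (pontM w)) (-c) 0 0 := rfl
      ext e u
      have h2 : β.form = (-c) • (vol (pontM w)).compContinuousLinearMap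
          (ContinuousLinearMap.fst ℝ (BaseV k) (FibV n)) := by
        show affineForm _ _ _ _ = _
        unfold affineForm contactForm
        ext u
        simp [wedgeOne, ContinuousAlternatingMap.alternatizeUncurryFin_apply]
      rw [resOfExt_apply, h2]
      show (-c) * vol (pontM w) (fun i => (Matrix.vecCons ((0, e) : TotV k n)
        (fun i => (u i, 0)) i).1) = 0
      rw [(vol (pontM w)).map_coord_zero 0 (by simp), mul_zero]
    have hY := hw.2 ⟨_, hT⟩ (by
      rw [tmap_prBar]
      show prBarL k n (0, (a, β, 0)) = 0
      rw [prBarL_apply]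
      simp only [hres]
      rfl)
    have h1 := curryLeft_extD_thetaPont w (Y := (0, (a, β, 0))) rfl
    -- The contraction may be evaluated only on vectors tangent to `W0`. Lifts of the coordinate
    -- vectors of the base are enough because `β` is basic, and they yield c vol = 0.
    choose u hu using fun i => surjective_fst_inclW0 hvol hvol0 hL w (baseVec i)
    have h2 := congrArg (fun T => T (fun i => inclW0 vol L w (u i))) h1
    have h3 := congrArg (fun T => T u) hY
    have h4 : -(β.form (fun i => (inclW0 vol L w (u i)).1)) = 0 := by
      refine h2.symm.trans (Eq.trans ?_ h3)
      show extD (IPont k n) thetaPont w (Matrix.vecCons (0, (a, β, 0))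
          fun i => inclW0 vol L w (u i)) =
        extD (IPont k n) thetaPont w (fun i => inclW0 vol L w (Matrix.vecCons ⟨_, hT⟩ u i))
      congr 1
      funext i
      refine Fin.cases ?_ (fun i => ?_) i <;> rfl
    rw [form_eq_of_resOfExt_eq_zero hres, jetPull_affineMom, neg_eq_zero] at h4
    have h5 : -c * vol (pontM w) baseVec = 0 := by
      refine Eq.trans ?_ h4
      show _ = (-c + (0 : Jet k n →L[ℝ] ℝ) (0 - 0)) *
        vol (pontM w) (fun i => (inclW0 vol L w (u i)).1.1)
      simp only [hu]
      simp
    have h6 : c = 0 := by simpa [h0] using h5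
    exact sub_eq_zero.1 h6
  have h : extLegendre vol L (pr w) = pontMom w := by
    rw [hα, hℓ, hD]; rfl
  show mkPont w.1 (pontJet w) (extLegendre vol L (pr w)) (pontAct w) = w
  rw [h]
  rfl

end Constraint

/-! ### The inverse function theorem on manifolds. -/

section InverseFunction

variable {V V' : Type*} [NormedAddCommGroup V] [NormedSpace ℝ V] [NormedAddCommGroup V']
  [NormedSpace ℝ V'] {H H' : Type*} [TopologicalSpace H] [TopologicalSpace H']
  {I : ModelWithCorners ℝ V H} {I' : ModelWithCorners ℝ V' H'}
  {Q Q' : Type*} [TopologicalSpace Q] [ChartedSpace H Q] [TopologicalSpace Q']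
  [ChartedSpace H' Q'] [IsManifold I ∞ Q] [I.Boundaryless] [IsManifold I' ∞ Q'] [I'.Boundaryless]

/-- A map is open at the points where its tangent map is invertible, and its local inverses are
smooth. -/
theorem image_mem_nhds_and_contMDiffAt_leftInverse [CompleteSpace V] [CompleteSpace V']
    {f : Q → Q'} (hf : ContMDiff I I' ∞ f) {p : Q} (hp : Function.Bijective (tmap I I' f p)) :
    (∀ N ∈ nhds p, f '' N ∈ nhds (f p)) ∧
      ∀ (U : Set Q) (g : Q' → Q), U ∈ nhds p → (∀ q ∈ U, g (f q) = q) →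
        ContMDiffAt I' I ∞ g (f p) := by
  set c := extChartAt I p with hc
  set c' := extChartAt I' (f p) with hc'
  set F : V → V' := fun z => c' (f (c.symm z)) with hF
  have hcp : c.symm (c p) = p := extChartAt_to_inv p
  have hsm : ContDiffAt ℝ ∞ F (c p) := by
    have h1 : ContMDiffAt 𝓘(ℝ, V) I ∞ c.symm (c p) :=
      (contMDiffOn_extChartAt_symm p).contMDiffAt
        ((isOpen_extChartAt_target p).mem_nhds (mem_extChartAt_target p))
    have h2 : ContMDiffAt I' 𝓘(ℝ, V') ∞ c' (f (c.symm (c p))) := by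
      rw [hcp]; exact contMDiffAt_extChartAt
    exact (h2.comp (c p) ((hf _).comp (c p) h1)).contDiffAt
  have hFd : fderiv ℝ F (c p) = tmap I I' f p := by
    have h1 : MDifferentiableAt 𝓘(ℝ, V) I c.symm (c p) :=
      mdifferentiableAt_extChart_symm (mem_extChartAt_target p)
    have h2 : MDifferentiableAt I' 𝓘(ℝ, V') c' (f (c.symm (c p))) := by
      rw [hcp]; exact mdifferentiableAt_extChart (mem_extChartAt_source _)
    have h3 : MDifferentiableAt I I' f (c.symm (c p)) := hf.mdifferentiable (by simp) _
    rw [← tmap_eq_fderiv, hF, tmap_comp (f := fun z => f (c.symm z)) h2 (h3.comp (c p) h1),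
      tmap_comp h3 h1, hcp, hc', tmap_extChartAt_self]
    have h4 := tmap_symm_comp_extChart (I := I) (mem_extChartAt_source (I := I) p)
    rw [tmap_extChartAt_self] at h4
    rw [show tmap 𝓘(ℝ, V) I c.symm (c p) = ContinuousLinearMap.id ℝ V from h4]
    rfl
  let e : V ≃L[ℝ] V' := ContinuousLinearEquiv.ofBijective (tmap I I' f p)
    (LinearMap.ker_eq_bot.2 hp.1) (LinearMap.range_eq_top.2 hp.2)
  have hstrict : HasStrictFDerivAt F (e : V →L[ℝ] V') (c p) := by
    have h1 := hsm.hasStrictFDerivAt (by simp)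
    rw [hFd] at h1
    exact h1
  have hfp : F (c p) = c' (f p) := by simp only [hF, hcp]
  have hopen : ∀ N ∈ nhds p, f '' N ∈ nhds (f p) := by
    intro N hN
    set N' : Set V := c.symm ⁻¹' (N ∩ f ⁻¹' c'.source) with hN'
    have hN'm : N' ∈ nhds (c p) := by
      have h1 : N ∩ f ⁻¹' c'.source ∈ nhds p := Filter.inter_mem hN
        (hf.continuous.continuousAt (extChartAt_source_mem_nhds (f p)))
      exact (continuousAt_extChartAt_symm p) (by rwa [hcp])
    have h2 : F '' N' ∈ nhds (c' (f p)) := by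
      rw [← hfp, ← hstrict.map_nhds_eq_of_equiv]
      exact Filter.image_mem_map hN'm
    filter_upwards [extChartAt_source_mem_nhds (I := I') (f p),
      (continuousAt_extChartAt (I := I') (f p)) h2] with q' hq' hq'2
    obtain ⟨z, hz, hzq⟩ := hq'2
    exact ⟨c.symm z, hz.1, c'.injOn hz.2 hq' hzq⟩
  refine ⟨hopen, fun U g hU hg => ?_⟩
  have hgp : g (f p) = p := hg p (mem_of_mem_nhds hU)
  -- Continuity comes from openness of `f`: the preimage of `N` under `g` contains the image of `N ∩
  -- U` under `f`.
  have hcont : ContinuousAt g (f p) := by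
    intro N hN
    rw [hgp] at hN
    show g ⁻¹' N ∈ nhds (f p)
    refine Filter.mem_of_superset (hopen _ (Filter.inter_mem hN hU)) ?_
    rintro _ ⟨q, hq, rfl⟩
    show g (f q) ∈ N
    rw [hg q hq.2]
    exact hq.1
  have hinv : ContDiffAt ℝ ∞ (hstrict.localInverse F e (c p)) (c' (f p)) := by
    rw [← hfp]
    exact hsm.to_localInverse (f' := e) hstrict.hasFDerivAt (by simp)
  have hloc : ContMDiffAt I' 𝓘(ℝ, V) ∞ (fun q' => hstrict.localInverse F e (c p) (c' q')) (f p) :=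
    hinv.contMDiffAt.comp (f p) contMDiffAt_extChartAt
  have hFz : hstrict.localInverse F e (c p) (c' (f p)) = c p := by
    rw [← hfp]; exact hstrict.localInverse_apply_image
  have hsym : ContMDiffAt 𝓘(ℝ, V) I ∞ c.symm (hstrict.localInverse F e (c p) (c' (f p))) := by
    rw [hFz]
    exact (contMDiffOn_extChartAt_symm p).contMDiffAt
      ((isOpen_extChartAt_target p).mem_nhds (mem_extChartAt_target p))
  -- Near `f p` the given left inverse agrees with the local inverse of `F` read in charts;
  -- continuity of `g` keeps its values where the latter inverts `F`.
  refine (hsym.comp (f p) hloc).congr_of_eventuallyEq ?_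
  have hl : ∀ᶠ q in nhds p, hstrict.localInverse F e (c p) (F (c q)) = c q :=
    (continuousAt_extChartAt (I := I) p).eventually hstrict.eventually_left_inverse
  have hev : ∀ᶠ q' in nhds (f p), hstrict.localInverse F e (c p) (F (c (g q'))) = c (g q') ∧
      g q' ∈ c.source :=
    hcont.tendsto.eventually (p := fun q => hstrict.localInverse F e (c p) (F (c q)) = c q ∧
      q ∈ c.source) (by rw [hgp]; exact hl.and (extChartAt_source_mem_nhds p))
  filter_upwards [hev, hopen U hU] with q' hq' hq'U
  obtain ⟨q, hq, rfl⟩ := hq'U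
  rw [hg q hq] at hq' ⊢
  have h1 : F (c q) = c' (f q) := by simp only [hF]; rw [c.left_inv hq'.2]
  rw [h1] at hq'
  simp only [Function.comp_apply]
  rw [hq'.1, c.left_inv hq'.2]

theorem isOpen_image_and_contMDiffOn_leftInverse [CompleteSpace V] [CompleteSpace V']
    {f : Q → Q'} (hf : ContMDiff I I' ∞ f) (hb : ∀ p, Function.Bijective (tmap I I' f p))
    {U : Set Q} (hU : IsOpen U) {g : Q' → Q} (hg : ∀ q ∈ U, g (f q) = q) :
    IsOpen (f '' U) ∧ ContMDiffOn I' I ∞ g (f '' U) := by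
  constructor
  · rw [isOpen_iff_mem_nhds]
    rintro _ ⟨p, hp, rfl⟩
    exact (image_mem_nhds_and_contMDiffAt_leftInverse hf (hb p)).1 U (hU.mem_nhds hp)
  · rintro _ ⟨p, hp, rfl⟩
    exact ((image_mem_nhds_and_contMDiffAt_leftInverse hf (hb p)).2 U g
      (hU.mem_nhds hp) hg).contMDiffWithinAt

theorem bijective_of_injective_of_finrank_le {T J R S : Type*} [NormedAddCommGroup T]
    [NormedSpace ℝ T] [NormedAddCommGroup J] [NormedSpace ℝ J] [NormedAddCommGroup R]
    [NormedSpace ℝ R] [NormedAddCommGroup S] [NormedSpace ℝ S] [FiniteDimensional ℝ T]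
    [FiniteDimensional ℝ J] [FiniteDimensional ℝ R] [FiniteDimensional ℝ S]
    (h : Module.finrank ℝ R ≤ Module.finrank ℝ J) (A : T × (J × S) →L[ℝ] T × (R × S))
    (hA : Function.Injective A) : Function.Bijective A := by
  refine ⟨hA, ?_⟩
  have h1 : Module.finrank ℝ (T × (R × S)) ≤ Module.finrank ℝ (T × (J × S)) := by
    simp only [Module.finrank_prod]
    omega
  exact (LinearMap.injective_iff_surjective_of_finrank_eq_finrank
    (f := (A : T × (J × S) →ₗ[ℝ] T × (R × S)))
    (le_antisymm (LinearMap.finrank_le_finrank_of_injective hA) h1)).1 hA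

end InverseFunction

/-! ### Regularity and the local invertibility of the Legendre map. -/

section Legendre

variable {k n : ℕ}
  {M : Type*} [TopologicalSpace M] [ChartedSpace (BaseV k) M] [IsManifold 𝓘(ℝ, BaseV k) ∞ M]
  {E : Type*} [TopologicalSpace E] [ChartedSpace (TotV k n) E] [IsManifold 𝓘(ℝ, TotV k n) ∞ E]
  {B : AdaptedBundle k n M E} {vol : M → Vol k} {L : VelPhase B → ℝ}

/-- The constraint C - L vanishes identically along the graph, so its differential kills the image
of the tangent map. -/
theorem tmap_legendreGraph_mem (hvol : SmoothForm (IB k) vol) (hvol0 : ∀ x, vol x ≠ 0)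
    (hL : ContMDiff (IVel k n) 𝓘(ℝ, ℝ) ∞ L) (p : VelPhase B) (u : VelV k n) :
    tmap (IVel k n) (IPont k n) (legendreGraph vol L) p u ∈
      tangentW0 vol L (legendreGraph vol L p) := by
  have h := tmap_comp (I := IVel k n) (g := constraintFun vol L) (f := legendreGraph vol L) (q := p)
    ((contMDiff_constraintFun hvol hvol0 hL).mdifferentiable (by simp) _)
    ((contMDiff_legendreGraph hvol hL).mdifferentiable (by simp) _)
  have h1 : (fun p => constraintFun vol L (legendreGraph vol L p)) = fun _ => (0 : ℝ) := by
    funext p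
    have h0 := vol_apply_ne_zero (hvol0 (velM p))
    have h2 : jetPull (velJet p) (extLegendre vol L p) = L p • vol (velM p) := legendreGraph_mem_W0 p
    show jetPull (velJet p) (extLegendre vol L p) baseVec / vol (velM p) baseVec - L p = 0
    rw [h2, ContinuousAlternatingMap.smul_apply, smul_eq_mul, mul_div_cancel_right₀ _ h0, sub_self]
  rw [h1] at h
  have h3 : tmap (IVel k n) 𝓘(ℝ, ℝ) (fun _ : VelPhase B => (0 : ℝ)) p = 0 := mfderiv_const
  rw [h3] at h
  exact (congrArg (fun T : VelV k n →L[ℝ] ℝ => T u) h).symm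

theorem prL_tmap_legendreGraph (hvol : SmoothForm (IB k) vol)
    (hL : ContMDiff (IVel k n) 𝓘(ℝ, ℝ) ∞ L) (p : VelPhase B) :
    (prL k n).comp (tmap (IVel k n) (IPont k n) (legendreGraph vol L) p) =
      ContinuousLinearMap.id ℝ _ := by
  rw [← tmap_pr (legendreGraph vol L p), ← tmap_comp (contMDiff_pr.mdifferentiable (by simp) _)
    ((contMDiff_legendreGraph hvol hL).mdifferentiable (by simp) _)]
  exact tmap_id p

theorem prBarL_tmap_legendreGraph (hvol : SmoothForm (IB k) vol)
    (hL : ContMDiff (IVel k n) 𝓘(ℝ, ℝ) ∞ L) (p : VelPhase B) (u : VelV k n) :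
    prBarL k n (tmap (IVel k n) (IPont k n) (legendreGraph vol L) p u) =
      tmap (IVel k n) (IMom k n) (legendre vol L) p u := by
  have h := tmap_comp (I := IVel k n) (g := prBar) (f := legendreGraph vol L) (q := p)
    (contMDiff_prBar.mdifferentiable (by simp) _)
    ((contMDiff_legendreGraph hvol hL).mdifferentiable (by simp) _)
  rw [tmap_prBar] at h
  exact (congrArg (fun T : VelV k n →L[ℝ] MomV k n => T u) h).symm

/-- A family of affine functions that does not change infinitesimally in the direction `a`. -/
theorem fderiv_apply_eq_zero_of_affine {W N : Type*} [NormedAddCommGroup W] [NormedSpace ℝ W]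
    [NormedAddCommGroup N] [NormedSpace ℝ N] {ℓ : W → ℝ} {D : W → W →L[ℝ] ℝ} {X : W → N} {v a : W}
    {c : ℝ} (hc : c ≠ 0) (hℓ : HasFDerivAt ℓ (D v) v) (hD : DifferentiableAt ℝ D v)
    (hX : DifferentiableAt ℝ X v) (hXa : fderiv ℝ X v a = 0)
    (h : ∀ w, ∃ T : N →L[ℝ] ℝ, ∀ v', T (X v') = (ℓ v' + D v' (w - v')) * c) :
    fderiv ℝ D v a = 0 := by
  ext b
  obtain ⟨T, hT⟩ := h (v + b)
  -- In the direction `a`, ℓ contributes D v a, while D v' (v + b - v') contributes the derivative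
  -- of D applied to `b` minus D v a. The terms D v a cancel and leave the second derivative.
  have h1 := (hℓ.add (hD.hasFDerivAt.clm_apply ((hasFDerivAt_id v).const_sub (v + b)))).mul_const c
  have h2 : HasFDerivAt (fun v' => T (X v')) (T.comp (fderiv ℝ X v)) v :=
    T.hasFDerivAt.comp v hX.hasFDerivAt
  rw [show (fun v' => T (X v')) = fun v' => (ℓ v' + D v' (v + b - v')) * c from funext hT] at h2
  have h3 := congrArg (fun T : W →L[ℝ] ℝ => T a) (h2.unique h1)
  simp [hXa, hc] at h3
  exact h3

theorem contDiff_fibreDeriv_jet (hL : ContMDiff (IVel k n) 𝓘(ℝ, ℝ) ∞ L) (y : E) (s : Act k) :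
    ContDiff ℝ ∞ (fun v : Jet k n => fibreDeriv L (mkVel y v s)) :=
  (contDiff_lagrangian_jet hL y s).fderiv_right (m := ∞) (by simp)

theorem contDiff_comp_fst_const {W A B C F : Type*} [NormedAddCommGroup W] [NormedSpace ℝ W]
    [NormedAddCommGroup A] [NormedSpace ℝ A] [NormedAddCommGroup B] [NormedSpace ℝ B]
    [NormedAddCommGroup C] [NormedSpace ℝ C] [NormedAddCommGroup F] [NormedSpace ℝ F]
    {f : A → B → C → W → F}
    (hf : ContDiff ℝ ∞ (fun p : A × B × C × W => f p.1 p.2.1 p.2.2.1 p.2.2.2)) {a : A} {b : W → B}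
    (hb : ContDiff ℝ ∞ b) {c : W → C} (hc : ContDiff ℝ ∞ c) :
    ContDiff ℝ ∞ (fun v => f a (b v) (c v) v) :=
  hf.comp (contDiff_const.prodMk (hb.prodMk (hc.prodMk contDiff_id)))

theorem contDiff_affineMom_jet (ν : Vol k) {ℓ : Jet k n → ℝ} (hℓ : ContDiff ℝ ∞ ℓ)
    {D : Jet k n → (Jet k n →L[ℝ] ℝ)} (hD : ContDiff ℝ ∞ D) :
    ContDiff ℝ ∞ (fun v : Jet k n => affineMom ν (ℓ v) (D v) v) :=
  contDiff_comp_fst_const contDiff_affineMom hℓ hD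

theorem contDiff_extLegendre_jet (hL : ContMDiff (IVel k n) 𝓘(ℝ, ℝ) ∞ L) (y : E) (s : Act k) :
    ContDiff ℝ ∞ (fun v : Jet k n => extLegendre vol L (mkVel y v s)) := by
  have h := contDiff_affineMom_jet (vol (B.proj y)) (contDiff_lagrangian_jet hL y s)
    (contDiff_fibreDeriv_jet hL y s)
  refine (congrArg (ContDiff ℝ ∞) (funext fun v => ?_)).mp h
  rfl

theorem tmap_mkVel_jet (y : E) (v : Jet k n) (s : Act k) :
    tmap 𝓘(ℝ, Jet k n) (IVel k n) (fun v : Jet k n => (mkVel y v s : VelPhase B)) v =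
      (ContinuousLinearMap.inr ℝ (TotV k n) (Jet k n × Act k)).comp
        (ContinuousLinearMap.inl ℝ (Jet k n) (Act k)) := by
  have hj : ContDiff ℝ ∞ (fun v : Jet k n => ((v, s) : Jet k n × Act k)) :=
    contDiff_id.prodMk contDiff_const
  have h1 := tmap_comp (I := 𝓘(ℝ, Jet k n))
    (g := fun f : Jet k n × Act k => (mkVel y f.1 f.2 : VelPhase B))
    (f := fun v : Jet k n => (v, s)) (q := v)
    ((contMDiff_mkVel y).mdifferentiable (by simp) _) (hj.contMDiff.mdifferentiable (by simp) _)
  rwa [tmap_mkVel, tmap_eq_fderiv, (hasFDerivAt_prodMk_left v s).fderiv] at h1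

theorem hasFDerivAt_prodMk_prodMk {W N S : Type*} [NormedAddCommGroup W] [NormedSpace ℝ W]
    [NormedAddCommGroup N] [NormedSpace ℝ N] [NormedAddCommGroup S] [NormedSpace ℝ S] {X : W → N}
    {v : W} (hX : DifferentiableAt ℝ X v) (s : S) :
    HasFDerivAt (fun v => (v, X v, s))
      ((ContinuousLinearMap.id ℝ W).prod ((fderiv ℝ X v).prod 0)) v :=
  (hasFDerivAt_id _).prodMk (hX.hasFDerivAt.prodMk (hasFDerivAt_const _ _))

theorem tmap_mkPont_jet (y : E) {X : Jet k n → ExtMom k n} (hX : ContDiff ℝ ∞ X) (v : Jet k n)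
    (s : Act k) :
    tmap 𝓘(ℝ, Jet k n) (IPont k n) (fun v : Jet k n => (mkPont y v (X v) s : Pont B)) v =
      (ContinuousLinearMap.inr ℝ (TotV k n) (Jet k n × ExtMom k n × Act k)).comp
        ((ContinuousLinearMap.id ℝ (Jet k n)).prod ((fderiv ℝ X v).prod 0)) := by
  have hj : ContDiff ℝ ∞ (fun v : Jet k n => ((v, X v, s) : Jet k n × ExtMom k n × Act k)) :=
    contDiff_id.prodMk (hX.prodMk contDiff_const)
  have h1 := tmap_comp (I := 𝓘(ℝ, Jet k n))
    (g := fun f : Jet k n × ExtMom k n × Act k => (mkPont y f.1 f.2.1 f.2.2 : Pont B))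
    (f := fun v : Jet k n => (v, X v, s)) (q := v)
    ((contMDiff_mkPont y).mdifferentiable (by simp) _) (hj.contMDiff.mdifferentiable (by simp) _)
  rwa [tmap_mkPont, tmap_eq_fderiv,
    (hasFDerivAt_prodMk_prodMk (hX.differentiable (by simp) v) s).fderiv] at h1

theorem tmap_legendreGraph_jet (hvol : SmoothForm (IB k) vol)
    (hL : ContMDiff (IVel k n) 𝓘(ℝ, ℝ) ∞ L) (p : VelPhase B) (a : Jet k n) :
    tmap (IVel k n) (IPont k n) (legendreGraph vol L) p (0, (a, 0)) =
      (0, (a, fderiv ℝ (fun v => extLegendre vol L (mkVel p.1 v (velAct p))) (velJet p) a, 0)) := by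
  have hj : ContDiff ℝ ∞ (fun v : Jet k n => ((v, velAct p) : Jet k n × Act k)) :=
    contDiff_id.prodMk contDiff_const
  have h3 := tmap_comp (I := 𝓘(ℝ, Jet k n)) (g := legendreGraph vol L)
    (f := fun v : Jet k n => (mkVel p.1 v (velAct p) : VelPhase B)) (q := velJet p)
    ((contMDiff_legendreGraph hvol hL).mdifferentiable (by simp) _)
    (((contMDiff_mkVel p.1).comp hj.contMDiff).mdifferentiable (by simp) _)
  have h4 := tmap_mkPont_jet (B := B) p.1 (contDiff_extLegendre_jet (vol := vol) hL p.1 (velAct p))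
    (velJet p) (velAct p)
  rw [tmap_mkVel_jet] at h3
  exact (congrArg (fun T : Jet k n →L[ℝ] PontV k n => T a) (h4.symm.trans h3)).symm

/-- For `u` in the kernel, its image under the tangent map of the graph is tangent to `W0` and
vertical over 𝒫*, hence a pure jet direction `a`. Then the extended multimomentum is stationary
along `a`, and so is the slope of its affine function: the Hessian of L annihilates `a`. -/
theorem tmap_legendre_injective (hvol : SmoothForm (IB k) vol) (hvol0 : ∀ x, vol x ≠ 0)
    (hL : ContMDiff (IVel k n) 𝓘(ℝ, ℝ) ∞ L) (hreg : RegularLagrangian L) (p : VelPhase B)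
    {u : VelV k n} (hu : tmap (IVel k n) (IMom k n) (legendre vol L) p u = 0) : u = 0 := by
  have hY := eq_of_prBarL_eq_zero_of_tangent hvol hvol0 hL p
    ((prBarL_tmap_legendreGraph hvol hL p u).trans hu) (tmap_legendreGraph_mem hvol hvol0 hL p u)
  have hpr : prL k n (tmap (IVel k n) (IPont k n) (legendreGraph vol L) p u) = u :=
    congrArg (fun T : VelV k n →L[ℝ] VelV k n => T u) (prL_tmap_legendreGraph hvol hL p)
  generalize hYu : tmap (IVel k n) (IPont k n) (legendreGraph vol L) p u = Y at hY hpr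
  obtain ⟨a, rfl⟩ : ∃ a : Jet k n, Y = (0, (a, 0, 0)) := ⟨Y.2.1, hY⟩
  have hua : u = (0, (a, 0)) := hpr.symm
  have h1 := hYu
  rw [hua, tmap_legendreGraph_jet hvol hL] at h1
  have hXa := congrArg (fun q => q.2.2.1) h1
  have hDa := fderiv_apply_eq_zero_of_affine (vol_apply_ne_zero (hvol0 (velM p)))
    (((contDiff_lagrangian_jet hL p.1 (velAct p)).differentiable (by simp) (velJet p)).hasFDerivAt)
    ((contDiff_fibreDeriv_jet hL p.1 (velAct p)).differentiable (by simp) (velJet p))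
    ((contDiff_extLegendre_jet (vol := vol) hL p.1 (velAct p)).differentiable (by simp) (velJet p))
    hXa (fun w => ⟨(ContinuousAlternatingMap.apply ℝ (BaseV k) ℝ baseVec).comp (jetPullL w), by
      intro v'
      show jetPull w (affineMom (vol (velM p)) (L (mkVel p.1 v' (velAct p)))
        (fibreDeriv L (mkVel p.1 v' (velAct p))) v') baseVec = _
      rw [jetPull_affineMom]
      rfl⟩)
  rw [hua, hreg p a hDa]
  rfl

theorem tmap_legendre_bijective (hvol : SmoothForm (IB k) vol) (hvol0 : ∀ x, vol x ≠ 0)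
    (hL : ContMDiff (IVel k n) 𝓘(ℝ, ℝ) ∞ L) (hreg : RegularLagrangian L) (p : VelPhase B) :
    Function.Bijective (tmap (IVel k n) (IMom k n) (legendre vol L) p) := by
  refine bijective_of_injective_of_finrank_le (finrank_resMom_le k n) _ fun u u' h => ?_
  rw [← sub_eq_zero]
  refine tmap_legendre_injective hvol hvol0 hL hreg p ?_
  exact (map_sub (tmap (IVel k n) (IMom k n) (legendre vol L) p) u u').trans (sub_eq_zero.2 h)

theorem legendreInv_legendre {U : Set (VelPhase B)} (hinj : InjOn (legendre vol L) U)
    {p : VelPhase B} (hp : p ∈ U) : legendreInv vol L U (legendre vol L p) = p := by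
  have h : ∃ p' ∈ U, legendre vol L p' = legendre vol L p := ⟨p, hp, rfl⟩
  rw [legendreInv, dif_pos h]
  exact hinj h.choose_spec.1 hp h.choose_spec.2

theorem isOpen_image_legendre (hvol : SmoothForm (IB k) vol) (hvol0 : ∀ x, vol x ≠ 0)
    (hL : ContMDiff (IVel k n) 𝓘(ℝ, ℝ) ∞ L) (hreg : RegularLagrangian L)
    {U : Set (VelPhase B)} (hU : IsOpen U) (hinj : InjOn (legendre vol L) U) :
    IsOpen (legendre vol L '' U) ∧
      ContMDiffOn (IMom k n) (IVel k n) ∞ (legendreInv vol L U) (legendre vol L '' U) :=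
  isOpen_image_and_contMDiffOn_leftInverse (contMDiff_legendre hvol hL)
    (tmap_legendre_bijective hvol hvol0 hL hreg) hU fun _ hp => legendreInv_legendre hinj hp

end Legendre

/-- The Leibniz rule i(Y)(σ ∧ β) = σ(Y) β - σ ∧ i(Y)β, in which the last term is absent. -/
theorem curryLeft_wedgeOne_of_curryLeft_eq_zero {V : Type*} [NormedAddCommGroup V]
    [NormedSpace ℝ V] {r : ℕ} (σ : V →L[ℝ] ℝ) {β : V [⋀^Fin (r + 1)]→L[ℝ] ℝ} {Y : V}
    (h : β.curryLeft Y = 0) : (wedgeOne σ β).curryLeft Y = σ Y • β := by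
  ext u
  show wedgeOne σ β (Matrix.vecCons Y u) = σ Y * β u
  rw [wedgeOne, ContinuousAlternatingMap.alternatizeUncurryFin_apply, Fin.sum_univ_succ,
    Finset.sum_eq_zero fun i _ => ?_]
  · simp
  · have h1 : β (i.succ.removeNth (Matrix.vecCons Y u)) = 0 := by
      have h2 : i.succ.removeNth (Matrix.vecCons Y u) = Matrix.vecCons Y (i.removeNth u) := by
        funext j
        refine Fin.cases ?_ (fun j => ?_) j
        · simp [Fin.removeNth]
        · simp [Fin.removeNth]
      rw [h2]
      exact congrArg (fun T : V [⋀^Fin r]→L[ℝ] ℝ => T (i.removeNth u)) h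
    simp [h1]

theorem FibredCorr.tmap_comp_tmap {V V' V'' H H' H'' Q Q' Q'' : Type*} [NormedAddCommGroup V]
    [NormedSpace ℝ V] [NormedAddCommGroup V'] [NormedSpace ℝ V'] [NormedAddCommGroup V'']
    [NormedSpace ℝ V''] [TopologicalSpace H] [TopologicalSpace H'] [TopologicalSpace H'']
    {I : ModelWithCorners ℝ V H} {I' : ModelWithCorners ℝ V' H'} {J : ModelWithCorners ℝ V'' H''}
    [TopologicalSpace Q] [ChartedSpace H Q] [TopologicalSpace Q'] [ChartedSpace H' Q']
    [TopologicalSpace Q''] [ChartedSpace H'' Q''] {τ : Q → Q''} {τ' : Q' → Q''} {f : Q → Q'}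
    {g : Q' → Q} {S : Set Q} {S' : Set Q'} (h : FibredCorr I I' J τ τ' f g S univ S' S') {q : Q'}
    (hq : q ∈ S') : (tmap I I' f (g q)).comp (tmap I' I g q) = ContinuousLinearMap.id ℝ V' := by
  rw [← tmap_comp (mdifferentiableAt_of_contMDiffOn h.smooth h.isOpen (mem_univ _))
    (mdifferentiableAt_of_contMDiffOn h.smooth' h.isOpen' hq), ← tmap_id (I := I') q]
  apply tmap_congr
  filter_upwards [h.isOpen'.mem_nhds hq] with x hx using h.rightInv x hx

/-! ### The Lagrangian and Hamiltonian forms as pull-backs. -/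

section Pullback

variable {k n : ℕ}
  {M : Type*} [TopologicalSpace M] [ChartedSpace (BaseV k) M] [IsManifold 𝓘(ℝ, BaseV k) ∞ M]
  {E : Type*} [TopologicalSpace E] [ChartedSpace (TotV k n) E] [IsManifold 𝓘(ℝ, TotV k n) ∞ E]
  {B : AdaptedBundle k n M E} {vol : M → Vol k} {L : VelPhase B → ℝ}
  {V H Q : Type*} [NormedAddCommGroup V] [NormedSpace ℝ V] [TopologicalSpace H]
  {I : ModelWithCorners ℝ V H} [TopologicalSpace Q] [ChartedSpace H Q] [IsManifold I ∞ Q]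
  [I.Boundaryless]

/-- The canonical form of the extended Pontryagin bundle pulled back along a map. -/
theorem thetaPont_pullback {φ : Q → Pont B} {O : Set Q} (hO : IsOpen O)
    (hφ : ContMDiffOn I (IPont k n) ∞ φ O) {πE : Q → E} {πM : Q → M} {act : Q → Act k}
    {α : Q → TotV k n [⋀^Fin (k + 1)]→L[ℝ] ℝ} (hE : ∀ q ∈ O, pontE (φ q) = πE q)
    (hM : ∀ q ∈ O, pontM (φ q) = πM q) (hact : ∀ q ∈ O, pontAct (φ q) = act q)
    (hα : ∀ q ∈ O, (pontMom (φ q)).form = α q) {q : Q} (hq : q ∈ O) :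
    -pullAlong I (IE k n) πE α q + extD I (pullAlong I (IB k) πM act) q =
      (thetaPont (φ q)).compContinuousLinearMap (tmap I (IPont k n) φ q) := by
  have hE' : ∀ q ∈ O, (tmap (IPont k n) (IE k n) pontE (φ q)).comp (tmap I (IPont k n) φ q) =
      tmap I (IE k n) πE q := by
    intro q hq
    rw [← tmap_comp (contMDiff_pontE.mdifferentiable (by simp) _)
      (mdifferentiableAt_of_contMDiffOn hφ hO hq)]
    apply tmap_congr
    filter_upwards [hO.mem_nhds hq] with x hx using hE x hx
  have hM' : ∀ q ∈ O, (tmap (IPont k n) (IB k) pontM (φ q)).comp (tmap I (IPont k n) φ q) =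
      tmap I (IB k) πM q := by
    intro q hq
    rw [← tmap_comp (contMDiff_pontM.mdifferentiable (by simp) _)
      (mdifferentiableAt_of_contMDiffOn hφ hO hq)]
    apply tmap_congr
    filter_upwards [hO.mem_nhds hq] with x hx using hM x hx
  -- The action form of `Q` is itself the pull-back of that of 𝒲, so the differential follows by
  -- naturality; the Liouville part needs no differentiation.
  have h1 : extD I (pullAlong I (IB k) πM act) q =
      (extD (IPont k n) actionPont (φ q)).compContinuousLinearMap (tmap I (IPont k n) φ q) := by
    refine extD_pullback hO hφ (fun q hq => ?_) hq (differentiableAt_formInChart_actionPont (φ q))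
    rw [pullAlong, ← hM' q hq, ← hact q hq]
    rfl
  rw [h1, pullAlong, ← hE' q hq, ← hα q hq]
  rfl

theorem thetaVel_eq (hvol : SmoothForm (IB k) vol) (hL : ContMDiff (IVel k n) 𝓘(ℝ, ℝ) ∞ L)
    (p : VelPhase B) : thetaVel vol L p = (thetaPont (legendreGraph vol L p)).compContinuousLinearMap
      (tmap (IVel k n) (IPont k n) (legendreGraph vol L) p) :=
  thetaPont_pullback (φ := legendreGraph vol L) isOpen_univ
    (contMDiff_legendreGraph hvol hL).contMDiffOn
    (fun _ _ => rfl) (fun _ _ => rfl) (fun _ _ => rfl) (fun _ _ => rfl) (mem_univ p)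

theorem thetaMom_eq (hvol : SmoothForm (IB k) vol) (hvol0 : ∀ x, vol x ≠ 0)
    (hL : ContMDiff (IVel k n) 𝓘(ℝ, ℝ) ∞ L) (hreg : RegularLagrangian L)
    {U : Set (VelPhase B)} (hU : IsOpen U) (hinj : InjOn (legendre vol L) U) {q : MomPhase B}
    (hq : q ∈ legendre vol L '' U) : thetaMom vol L U q =
      pullAlong (IMom k n) (IPont k n) (fun q => legendreGraph vol L (legendreInv vol L U q))
        (fun q => thetaPont (legendreGraph vol L (legendreInv vol L U q))) q := by
  obtain ⟨hO, hs⟩ := isOpen_image_legendre hvol hvol0 hL hreg hU hinj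
  refine thetaPont_pullback (φ := fun q => legendreGraph vol L (legendreInv vol L U q)) hO
    ((contMDiff_legendreGraph hvol hL).comp_contMDiffOn hs) ?_ ?_ ?_ (fun _ _ => rfl) hq
  all_goals
    rintro _ ⟨p, hp, rfl⟩
    simp only [legendreInv_legendre hinj hp]
    rfl

end Pullback

/-! ### The common mechanism of lifting and pushing forward. -/

section Model

variable {k n : ℕ}
  {M : Type*} [TopologicalSpace M] [ChartedSpace (BaseV k) M] [IsManifold 𝓘(ℝ, BaseV k) ∞ M]
  {E : Type*} [TopologicalSpace E] [ChartedSpace (TotV k n) E] [IsManifold 𝓘(ℝ, TotV k n) ∞ E]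
  {B : AdaptedBundle k n M E} {vol : M → Vol k} {L : VelPhase B → ℝ}
  {V H Q : Type*} [NormedAddCommGroup V] [NormedSpace ℝ V] [TopologicalSpace H]
  {I : ModelWithCorners ℝ V H} [TopologicalSpace Q] [ChartedSpace H Q]

/-- A parametrisation `φ : S → 𝒲₁` of the part of `𝒲₁` over `U` by an open set `S` of a manifold
over `M`, inverse to the restriction of a projection `π`, such that the form `Θ` is the pull-back of
the canonical form, and such that the tangent space of `S` is a quotient of that of `𝒲_∘` by
vectors that are vertical over the multimomentum phase bundle. -/
structure UnifiedModel (vol : M → Vol k) (L : VelPhase B → ℝ) (U : Set (VelPhase B))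
    (I : ModelWithCorners ℝ V H) (τ : Q → M) (π : Pont B → Q) (φ : Q → Pont B) (S : Set Q)
    (Θ : Q → V [⋀^Fin (k + 1)]→L[ℝ] ℝ) : Prop where
  corr : FibredCorr (IPont k n) I (IB k) pontM τ π φ (W1Over vol L U) univ S S
  theta : ∀ q ∈ S, Θ q = (thetaPont (φ q)).compContinuousLinearMap (tmap I (IPont k n) φ q)
  tangent : ∀ q ∈ S, ∀ u, tmap I (IPont k n) φ q u ∈ tangentW0 vol L (φ q)
  leftInverse : ∀ q ∈ S, ∃ b : TW0 vol L (φ q) →L[ℝ] V,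
    (∀ (u : V) (Y : TW0 vol L (φ q)), inclW0 vol L _ Y = tmap I (IPont k n) φ q u → b Y = u) ∧
      ∀ Y, b Y = 0 → prBarL k n (inclW0 vol L _ Y) = 0

/-- A linear map with values in the tangent space of `𝒲_∘`, as a map to that space. -/
def toTW0 {w : Pont B} (A : V →L[ℝ] PontV k n) (hA : ∀ u, A u ∈ tangentW0 vol L w) :
    V →L[ℝ] TW0 vol L w := A.codRestrict (tangentW0 vol L w) hA

theorem inclW0_comp_toTW0 {w : Pont B} (A : V →L[ℝ] PontV k n)
    (hA : ∀ u, A u ∈ tangentW0 vol L w) : (inclW0 vol L w).comp (toTW0 A hA) = A := rfl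

theorem inclW0_injective (w : Pont B) : Function.Injective (inclW0 vol L w) :=
  Subtype.val_injective

theorem curryLeft_resW0 {r : ℕ} (α : Pont B → PontV k n [⋀^Fin (r + 1)]→L[ℝ] ℝ) {w : Pont B}
    (Y : TW0 vol L w) : (resW0 vol L α w).curryLeft Y =
      ((α w).curryLeft (inclW0 vol L w Y)).compContinuousLinearMap (inclW0 vol L w) :=
  ContinuousAlternatingMap.curryLeft_compContinuousLinearMap _ _ _

/-- The form Θ and the volume form are killed by verticality alone. That dΘ is killed is the
condition which defines `W1`. -/
theorem curryLeft_resW0_eq_zero {w : Pont B} (hw : w ∈ W1 vol L) {Y : TW0 vol L w}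
    (hY : prBarL k n (inclW0 vol L w Y) = 0) :
    (resW0 vol L thetaPont w).curryLeft Y = 0 ∧
    (resW0 vol L (extD (IPont k n) thetaPont) w).curryLeft Y = 0 ∧
    (resW0 vol L (pullAlong (IPont k n) (IB k) pontM (fun w => vol (pontM w))) w).curryLeft Y =
      0 := by
  have h1 : (inclW0 vol L w Y).1 = 0 := congrArg Prod.fst hY
  have h3 : (inclW0 vol L w Y).2.2.2 = 0 := congrArg (fun q => q.2.2) hY
  refine ⟨?_, hw.2 Y (by rw [tmap_prBar]; exact hY), ?_⟩
  · rw [curryLeft_resW0, curryLeft_thetaPont w h1 h3]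
    rfl
  · ext u
    show vol (pontM w) (fun i => tmap (IPont k n) (IB k) pontM w
      (inclW0 vol L w (Matrix.vecCons Y u i))) = 0
    refine (vol (pontM w)).map_coord_zero 0 ?_
    rw [tmap_pontM]
    show (inclW0 vol L w Y).1.1 = 0
    rw [h1]
    rfl

variable {U : Set (VelPhase B)} {τ : Q → M} {π : Pont B → Q}
  {φ : Q → Pont B} {S : Set Q} {Θ : Q → V [⋀^Fin (k + 1)]→L[ℝ] ℝ}

/-- As `U` is open, a curve in `W1` that starts over `U` stays over `U` for small times. -/
theorem tangentToSet_W1Over (hU : IsOpen U) {w : Pont B} (hw : w ∈ W1Over vol L U) {u : PontV k n}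
    (hu : TangentToSet (IPont k n) (W1 vol L) w u) :
    TangentToSet (IPont k n) (W1Over vol L U) w u := by
  obtain ⟨γ, h0, hγ, hs, hu⟩ := hu
  refine ⟨γ, h0, ?_, hs, hu⟩
  have h1 : ContinuousAt (fun t => pr (γ t)) 0 :=
    contMDiff_pr.continuous.continuousAt.comp hs.continuousAt
  have h2 : ∀ᶠ t in nhds (0 : ℝ), pr (γ t) ∈ U :=
    h1 (by show U ∈ nhds (pr (γ 0)); rw [h0]; exact hU.mem_nhds hw.2)
  filter_upwards [hγ, h2] with t ht ht2 using ⟨ht, ht2⟩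

/-- A unified solution is determined by its push-forward. -/
theorem UnifiedModel.incl_eq (h : UnifiedModel vol L U I τ π φ S Θ) (hU : IsOpen U)
    {X : UnifiedField vol L} (hX : IsUnifiedSolution vol L U X) {q : Q} (hq : q ∈ S) :
    X.incl (φ q) = ((X.incl (φ q)).map (tmap (IPont k n) I π (φ q))).map
      (tmap I (IPont k n) φ q) := by
  have hw := h.corr.mapsTo' hq
  have hπ : π (φ q) = q := h.corr.rightInv q hq
  have hsφ : ContMDiffAt I (IPont k n) ∞ φ (π (φ q)) := by
    rw [hπ]; exact h.corr.smooth'.contMDiffAt (h.corr.isOpen'.mem_nhds hq)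
  have hsπ : ContMDiffAt (IPont k n) I ∞ π (φ q) :=
    h.corr.smooth.contMDiffAt (h.corr.isOpen.mem_nhds (mem_univ _))
  obtain ⟨u, hu, hXu⟩ := hX.tangent _ hw
  rw [hXu, map_wedgeVec, map_wedgeVec]
  congr 1
  funext i
  -- The map φ ∘ π is the identity on `W1` over `U`, so its tangent map fixes the factors of `X`,
  -- which are tangent to that set.
  have h1 := (tangentToSet_W1Over hU hw (hu i)).tmap_eq (f := fun w => φ (π w))
    (fun w hw => h.corr.leftInv w hw) (hsφ.comp (φ q) hsπ)
  rw [tmap_comp (hsφ.mdifferentiableAt (by simp)) (hsπ.mdifferentiableAt (by simp)), hπ] at h1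
  exact h1.symm

open Classical in
/-- The lift to `𝒲₁` of a multivector field, as a multivector field on `𝒲_∘`. -/
def liftField (vol : M → Vol k) (L : VelPhase B → ℝ) (I : ModelWithCorners ℝ V H) (π : Pont B → Q)
    (φ : Q → Pont B) (Y : Q → Multivector (k + 1) V) : UnifiedField vol L := fun w =>
  if h : ∀ u, tmap I (IPont k n) φ (π w) u ∈ tangentW0 vol L w then (Y (π w)).map (toTW0 _ h)
  else 0

theorem UnifiedModel.liftField_apply (h : UnifiedModel vol L U I τ π φ S Θ) {q : Q} (hq : q ∈ S)
    (Y : Q → Multivector (k + 1) V) : liftField vol L I π φ Y (φ q) =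
      (Y q).map (toTW0 (tmap I (IPont k n) φ q) (h.tangent q hq)) := by
  have hπ : π (φ q) = q := h.corr.rightInv q hq
  classical
  -- The condition and the lifted map both depend on `π (φ q)`; replacing it by a variable allows
  -- substitution.
  have h1 : ∀ q', q' = q → (if h : ∀ u, tmap I (IPont k n) φ q' u ∈ tangentW0 vol L (φ q) then
      (Y q').map (toTW0 _ h) else 0) =
      (Y q).map (toTW0 (tmap I (IPont k n) φ q) (h.tangent q hq)) := by
    rintro _ rfl
    rw [dif_pos (h.tangent _ hq)]
  rw [liftField]
  convert h1 _ hπ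

theorem UnifiedModel.incl_liftField (h : UnifiedModel vol L U I τ π φ S Θ) {q : Q} (hq : q ∈ S)
    (Y : Q → Multivector (k + 1) V) : (liftField vol L I π φ Y).incl (φ q) =
      (Y q).map (tmap I (IPont k n) φ q) := by
  rw [UnifiedField.incl, h.liftField_apply hq, Multivector.map_map, inclW0_comp_toTW0]

theorem UnifiedModel.push_liftField (h : UnifiedModel vol L U I τ π φ S Θ) {q : Q} (hq : q ∈ S)
    (Y : Q → Multivector (k + 1) V) : ((liftField vol L I π φ Y).incl (φ q)).map
      (tmap (IPont k n) I π (φ q)) = Y q := by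
  rw [h.incl_liftField hq, Multivector.map_map, h.corr.tmap_comp_tmap hq, Multivector.map_id]

variable [IsManifold I ∞ Q] [I.Boundaryless]

/-- The kernel of `b` consists of vectors vertical over 𝒫*, which annihilate all three forms on the
tangent space of `W0`. These forms are therefore the pull-backs along `b` of their restrictions to
the image of Tφ, that is, of the forms on `Q`, and `solvesFieldEq_map_iff` applies. -/
theorem UnifiedModel.solves_iff (h : UnifiedModel vol L U I τ π φ S Θ) {q : Q} (hq : q ∈ S) (X : Multivector (k + 1) V) :
    SolvesFieldEq (resW0 vol L thetaPont (φ q)) (resW0 vol L (extD (IPont k n) thetaPont) (φ q))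
      (resW0 vol L (pullAlong (IPont k n) (IB k) pontM (fun w => vol (pontM w))) (φ q))
      (X.map (toTW0 (tmap I (IPont k n) φ q) (h.tangent q hq))) ↔
    SolvesFieldEq (Θ q) (extD I Θ q) (pullAlong I (IB k) τ (fun q => vol (τ q)) q) X := by
  obtain ⟨b, hb, hb0⟩ := h.leftInverse q hq
  set a := toTW0 (tmap I (IPont k n) φ q) (h.tangent q hq) with ha
  have hab : ∀ u, b (a u) = u := fun u => hb u _ rfl
  have hker := fun Y hY => curryLeft_resW0_eq_zero (h.corr.mapsTo' hq).1 (hb0 Y hY)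
  have e1 : resW0 vol L thetaPont (φ q) = (Θ q).compContinuousLinearMap b := by
    rw [eq_comp_of_curryLeft_eq_zero hab fun Y hY => (hker Y hY).1, h.theta q hq]
    rfl
  have e2 : resW0 vol L (extD (IPont k n) thetaPont) (φ q) =
      (extD I Θ q).compContinuousLinearMap b := by
    rw [eq_comp_of_curryLeft_eq_zero hab fun Y hY => (hker Y hY).2.1,
      extD_pullback h.corr.isOpen' h.corr.smooth' h.theta hq
        (differentiableAt_formInChart_thetaPont (φ q))]
    rfl
  have e3 : resW0 vol L (pullAlong (IPont k n) (IB k) pontM (fun w => vol (pontM w))) (φ q) =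
      (pullAlong I (IB k) τ (fun q => vol (τ q)) q).compContinuousLinearMap b := by
    rw [eq_comp_of_curryLeft_eq_zero hab fun Y hY => (hker Y hY).2.2,
      ← h.corr.symm.pullAlong vol hq]
    rfl
  rw [e1, e2, e3]
  exact solvesFieldEq_map_iff hab _ _ _ X

/-- By `incl_eq` the unified field is the lift of its push-forward, so `solves_iff` transfers the
equations downwards. -/
theorem UnifiedModel.push_solution (h : UnifiedModel vol L U I τ π φ S Θ)
    (hU : IsOpen U) {X : UnifiedField vol L}
    (hX : IsUnifiedSolution vol L U X) {Y : Q → Multivector (k + 1) V}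
    (hY : ∀ q, Y q = (X.incl (φ q)).map (tmap (IPont k n) I π (φ q))) :
    TransverseOn I (IB k) τ vol Y S ∧ IntegrableOn I (IB k) τ Y S ∧
      ∀ q ∈ S, SolvesFieldEq (Θ q) (extD I Θ q) (pullAlong I (IB k) τ (fun q => vol (τ q)) q)
        (Y q) := by
  refine ⟨h.corr.transverseOn hX.transverse fun q _ => hY q,
    h.corr.integrableOn hX.integrable fun q _ => hY q, fun q hq => ?_⟩
  rw [← h.solves_iff hq]
  have h1 : X (φ q) = (Y q).map (toTW0 (tmap I (IPont k n) φ q) (h.tangent q hq)) := by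
    have := FiniteDimensional.of_injective (inclW0 vol L (φ q) : TW0 vol L (φ q) →ₗ[ℝ] PontV k n)
      (inclW0_injective _)
    refine Multivector.map_injective (inclW0 vol L (φ q)) (inclW0_injective _) ?_
    rw [Multivector.map_map, inclW0_comp_toTW0, hY q]
    exact h.incl_eq hU hX hq
  rw [← h1]
  exact hX.solves _ (h.corr.mapsTo' hq)

/-- Apart from `solves_iff`, the point is tangency: φ maps the open set `S` into `W1`, so Tφ turns
the local factors of `Y` into velocities of curves in `W1`. -/
theorem UnifiedModel.lift_solution (h : UnifiedModel vol L U I τ π φ S Θ)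
    {Y : Q → Multivector (k + 1) V}
    (hYt : TransverseOn I (IB k) τ vol Y S) (hYi : IntegrableOn I (IB k) τ Y S)
    (hYs : ∀ q ∈ S, SolvesFieldEq (Θ q) (extD I Θ q)
      (pullAlong I (IB k) τ (fun q => vol (τ q)) q) (Y q)) :
    IsUnifiedSolution vol L U (liftField vol L I π φ Y) := by
  have hφ : ∀ w ∈ W1Over vol L U, ∃ q ∈ S, φ q = w :=
    fun w hw => ⟨π w, h.corr.mapsTo hw, h.corr.leftInv w hw⟩
  have hincl : ∀ w ∈ W1Over vol L U, (liftField vol L I π φ Y).incl w =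
      (Y (π w)).map (tmap I (IPont k n) φ (π w)) := by
    intro w hw
    obtain ⟨q, hq, rfl⟩ := hφ w hw
    rw [h.incl_liftField hq, h.corr.rightInv q hq]
  refine ⟨h.corr.symm.transverseOn hYt hincl, h.corr.symm.integrableOn hYi hincl, ?_, ?_⟩
  · intro w hw
    obtain ⟨q, hq, rfl⟩ := hφ w hw
    obtain ⟨O, -, hqO, -, Z, -, hZ⟩ := hYi.1 q hq
    refine ⟨fun i => tmap I (IPont k n) φ q (Z i q), fun i => ?_, ?_⟩
    · refine TangentToSet.map (tangentToSet_of_isOpen h.corr.isOpen' hq (Z i q))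
        (fun x hx => (h.corr.mapsTo' hx).1) ?_
      exact h.corr.smooth'.contMDiffAt (h.corr.isOpen'.mem_nhds hq)
    · rw [h.incl_liftField hq, hZ q ⟨hqO, hq⟩, map_wedgeVec]
  · intro w hw
    obtain ⟨q, hq, rfl⟩ := hφ w hw
    rw [h.liftField_apply hq]
    exact (h.solves_iff hq (Y q)).2 (hYs q hq)

end Model

/-- The map `b` is the inverse of `A` composed with `c`. It is applied with the tangent Legendre map
as `A` and the projection from the tangent space of `W0` to that of 𝒫* as `c`. -/
theorem exists_comp_eq_of_bijective {V V' W : Type*} [NormedAddCommGroup V] [NormedSpace ℝ V]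
    [NormedAddCommGroup V'] [NormedSpace ℝ V'] [NormedAddCommGroup W] [NormedSpace ℝ W]
    [CompleteSpace V] [CompleteSpace V'] {A : V →L[ℝ] V'} (hA : Function.Bijective A)
    (c : W →L[ℝ] V') : ∃ b : W →L[ℝ] V, (∀ u Y, c Y = A u → b Y = u) ∧ ∀ Y, b Y = 0 → c Y = 0 := by
  let e : V ≃L[ℝ] V' := ContinuousLinearEquiv.ofBijective A
    (LinearMap.ker_eq_bot.2 hA.1) (LinearMap.range_eq_top.2 hA.2)
  refine ⟨(e.symm : V' →L[ℝ] V).comp c, fun u Y h => ?_, fun Y h => ?_⟩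
  · show e.symm (c Y) = u
    rw [h]
    exact e.symm_apply_apply u
  · exact e.symm.injective (h.trans (map_zero e.symm).symm)

/-! ### The Lagrangian and Hamiltonian models, and holonomy. -/

section Solutions

variable {k n : ℕ}
  {M : Type*} [TopologicalSpace M] [ChartedSpace (BaseV k) M] [IsManifold 𝓘(ℝ, BaseV k) ∞ M]
  {E : Type*} [TopologicalSpace E] [ChartedSpace (TotV k n) E] [IsManifold 𝓘(ℝ, TotV k n) ∞ E]
  {B : AdaptedBundle k n M E} {vol : M → Vol k} {L : VelPhase B → ℝ} {U : Set (VelPhase B)}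

theorem unifiedModel_vel (hvol : SmoothForm (IB k) vol) (hvol0 : ∀ x, vol x ≠ 0)
    (hL : ContMDiff (IVel k n) 𝓘(ℝ, ℝ) ∞ L) (hreg : RegularLagrangian L) (hU : IsOpen U) :
    UnifiedModel vol L U (IVel k n) velM pr (legendreGraph vol L) U (thetaVel vol L) where
  corr :=
    { isOpen := isOpen_univ
      isOpen' := hU
      subset := subset_univ _
      subset' := Subset.rfl
      smooth := contMDiff_pr.contMDiffOn
      smooth' := (contMDiff_legendreGraph hvol hL).contMDiffOn
      mapsTo := fun _ hw => hw.2
      mapsTo' := fun p hp => ⟨legendreGraph_mem_W1 hvol hvol0 hL p, hp⟩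
      leftInv := fun _ hw => eq_legendreGraph_of_mem_W1 hvol hvol0 hL hw.1
      rightInv := fun p _ => pr_legendreGraph p
      proj := fun _ _ => rfl
      proj' := fun _ _ => rfl
      smooth_proj := contMDiff_pontM
      smooth_proj' := contMDiff_velM }
  theta p _ := thetaVel_eq hvol hL p
  tangent p _ u := tmap_legendreGraph_mem hvol hvol0 hL p u
  leftInverse p _ := by
    -- The tangent map of `pr` is also a left inverse, but its kernel contains multimomentum
    -- directions that dΘ does not annihilate. The left inverse is therefore taken through 𝒫*, which
    -- requires the tangent Legendre map to be bijective.
    obtain ⟨b, hb, hb0⟩ := exists_comp_eq_of_bijective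
      (tmap_legendre_bijective hvol hvol0 hL hreg p)
      ((prBarL k n).comp (inclW0 vol L (legendreGraph vol L p)))
    refine ⟨b, fun u Y hY => hb u Y ?_, hb0⟩
    rw [← prBarL_tmap_legendreGraph hvol hL, ← hY]
    rfl

theorem fibredCorr_mom (hvol : SmoothForm (IB k) vol) (hvol0 : ∀ x, vol x ≠ 0)
    (hL : ContMDiff (IVel k n) 𝓘(ℝ, ℝ) ∞ L) (hreg : RegularLagrangian L) (hU : IsOpen U)
    (hinj : InjOn (legendre vol L) U) :
    FibredCorr (IPont k n) (IMom k n) (IB k) pontM momM prBar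
      (fun q => legendreGraph vol L (legendreInv vol L U q)) (W1Over vol L U) univ
      (legendre vol L '' U) (legendre vol L '' U) where
  isOpen := isOpen_univ
  isOpen' := (isOpen_image_legendre hvol hvol0 hL hreg hU hinj).1
  subset := subset_univ _
  subset' := Subset.rfl
  smooth := contMDiff_prBar.contMDiffOn
  smooth' := (contMDiff_legendreGraph hvol hL).comp_contMDiffOn
    (isOpen_image_legendre hvol hvol0 hL hreg hU hinj).2
  mapsTo w hw := by
    refine ⟨pr w, hw.2, ?_⟩
    conv_rhs => rw [← eq_legendreGraph_of_mem_W1 hvol hvol0 hL hw.1]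
    rfl
  mapsTo' := by
    rintro _ ⟨p, hp, rfl⟩
    simp only [legendreInv_legendre hinj hp]
    exact ⟨legendreGraph_mem_W1 hvol hvol0 hL p, hp⟩
  leftInv w hw := by
    have h : prBar w = legendre vol L (pr w) := by
      conv_lhs => rw [← eq_legendreGraph_of_mem_W1 hvol hvol0 hL hw.1]
      rfl
    rw [h, legendreInv_legendre hinj hw.2, eq_legendreGraph_of_mem_W1 hvol hvol0 hL hw.1]
  rightInv := by
    rintro _ ⟨p, hp, rfl⟩
    rw [legendreInv_legendre hinj hp]
    rfl
  proj _ _ := rfl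
  proj' := by
    rintro _ ⟨p, hp, rfl⟩
    rw [legendreInv_legendre hinj hp]
    rfl
  smooth_proj := contMDiff_pontM
  smooth_proj' := contMDiff_momM

theorem unifiedModel_mom (hvol : SmoothForm (IB k) vol) (hvol0 : ∀ x, vol x ≠ 0)
    (hL : ContMDiff (IVel k n) 𝓘(ℝ, ℝ) ∞ L) (hreg : RegularLagrangian L) (hU : IsOpen U)
    (hinj : InjOn (legendre vol L) U) :
    UnifiedModel vol L U (IMom k n) momM prBar
      (fun q => legendreGraph vol L (legendreInv vol L U q)) (legendre vol L '' U)
      (thetaMom vol L U) where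
  corr := fibredCorr_mom hvol hvol0 hL hreg hU hinj
  theta q hq := thetaMom_eq hvol hvol0 hL hreg hU hinj hq
  tangent q hq u := by
    rw [tmap_comp ((contMDiff_legendreGraph hvol hL).mdifferentiable (by simp) _)
      (mdifferentiableAt_of_contMDiffOn (isOpen_image_legendre hvol hvol0 hL hreg hU hinj).2
        (isOpen_image_legendre hvol hvol0 hL hreg hU hinj).1 hq)]
    exact tmap_legendreGraph_mem hvol hvol0 hL _ _
  leftInverse q hq := by
    -- Over 𝒫* the tangent map of the projection is itself the left inverse, and its kernel is the
    -- vertical space by definition.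
    refine ⟨(prBarL k n).comp (inclW0 vol L _), fun u Y hY => ?_, fun Y hY => hY⟩
    have h := (fibredCorr_mom hvol hvol0 hL hreg hU hinj).tmap_comp_tmap hq
    rw [tmap_prBar] at h
    show prBarL k n (inclW0 vol L _ Y) = u
    rw [hY]
    exact congrArg (fun T : MomV k n →L[ℝ] MomV k n => T u) h

/-- The push-forward of a unified solution satisfies the holonomy condition. -/
theorem holonomic_of_unified (hvol : SmoothForm (IB k) vol) (hvol0 : ∀ x, vol x ≠ 0)
    (hL : ContMDiff (IVel k n) 𝓘(ℝ, ℝ) ∞ L) (hreg : RegularLagrangian L) (hU : IsOpen U)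
    {X : UnifiedField vol L} (hX : IsUnifiedSolution vol L U X)
    (htrans : TransverseOn (IVel k n) (IB k) velM vol (pushVel X) U)
    {O : Set M} {ψ : M → VelPhase B}
    (hψ : IsIntegralSection (IVel k n) (IB k) velM (pushVel X) U O ψ) {x : M} (hx : x ∈ O) :
    tmap (IB k) (IE k n) (fun x' => velE (ψ x')) x =
      (ContinuousLinearMap.id ℝ (BaseV k)).prod (velJet (ψ x)) := by
  have hm := unifiedModel_vel hvol hvol0 hL hreg hU
  have hp := hψ.mapsTo x hx
  have hψd : MDifferentiableAt (IB k) (IVel k n) ψ x :=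
    mdifferentiableAt_of_contMDiffOn hψ.smooth hψ.isOpen hx
  obtain ⟨Z, hZ⟩ := hψ.integral x hx
  set T := tmap (IB k) (IE k n) (fun x' => velE (ψ x')) x with hT
  have hT1 : T = (tmap (IVel k n) (IE k n) velE (ψ x)).comp (tmap (IB k) (IVel k n) ψ x) :=
    tmap_comp (contMDiff_velE.mdifferentiable (by simp) _) hψd
  have hM : (tmap (IVel k n) (IB k) velM (ψ x)).comp (tmap (IB k) (IVel k n) ψ x) =
      ContinuousLinearMap.id ℝ (BaseV k) := by
    rw [← tmap_comp (contMDiff_velM.mdifferentiable (by simp) _) hψd, ← tmap_id (I := IB k) x]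
    apply tmap_congr
    filter_upwards [hψ.isOpen.mem_nhds hx] with x' hx' using hψ.isSection x' hx'
  have hTfst : (ContinuousLinearMap.fst ℝ (BaseV k) (FibV n)).comp T =
      ContinuousLinearMap.id ℝ (BaseV k) := by
    rw [← hM, hT1, tmap_velM, tmap_velE]
    rfl
  set v' : Jet k n := (ContinuousLinearMap.snd ℝ (BaseV k) (FibV n)).comp T with hv'
  have hTeq : T = (ContinuousLinearMap.id ℝ (BaseV k)).prod v' := by
    rw [← hTfst, hv']
    rfl
  have hZvol : Z (vol (velM (ψ x))) ≠ 0 := by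
    have h := htrans _ hp
    rw [hZ, Multivector.map_apply] at h
    have h1 : (pullAlong (IVel k n) (IB k) velM (fun p => vol (velM p)) (ψ x)
        ).compContinuousLinearMap (tmap (IB k) (IVel k n) ψ x) = vol (velM (ψ x)) := by
      show (vol (velM (ψ x))).compContinuousLinearMap
        ((tmap (IVel k n) (IB k) velM (ψ x)).comp (tmap (IB k) (IVel k n) ψ x)) = _
      rw [hM]
      rfl
    rwa [h1] at h
  suffices hvv : v' = velJet (ψ x) by rw [hTeq, hvv]
  refine jet_eq_of_forall fun D => ?_
  set p := ψ x with hpdef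
  set w := legendreGraph vol L p with hw
  -- The affine function of `β` vanishes at the jet of `p`, so (0, 0, β, 0) is tangent to `W0`,
  -- while its slope `D` is arbitrary.
  set β := affineMom (n := n) (vol (velM p)) 0 D (velJet p) with hβ
  have hYT : ((0, (0, β, 0)) : PontV k n) ∈ tangentW0 vol L w := by
    rw [mem_tangentW0, tmap_constraintFun_mom hvol hvol0 hL]
    show jetPull (velJet p) β baseVec / _ = 0
    rw [hβ, jetPull_affineMom]
    simp
  let Y : TW0 vol L w := ⟨_, hYT⟩
  obtain ⟨hX0, σ, -, hσ⟩ := hX.solves w ⟨legendreGraph_mem_W1 hvol hvol0 hL p, hp⟩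
  have hΘY : (resW0 vol L thetaPont w).curryLeft Y = 0 := by
    rw [curryLeft_resW0, curryLeft_thetaPont w (Y := inclW0 vol L w Y) rfl rfl]
    rfl
  have h1 := hσ Y
  rw [Multivector.contract, mul_eq_zero] at h1
  replace h1 := h1.resolve_left (pow_ne_zero _ (by norm_num))
  have h2 : (resW0 vol L (extD (IPont k n) thetaPont) w +
      wedgeOne σ (resW0 vol L thetaPont w)).curryLeft Y =
      (resW0 vol L (extD (IPont k n) thetaPont) w).curryLeft Y +
        σ Y • resW0 vol L thetaPont w := by
    rw [← curryLeft_wedgeOne_of_curryLeft_eq_zero σ hΘY]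
    rfl
  -- Since i(Y)Θ = 0, the dissipation term contracts to σ(Y) Θ, which the first field equation
  -- kills. What remains is that X annihilates i(Y)dΘ, minus the pull-back of `β`.
  rw [h2, map_add, map_smul, hX0, smul_zero, add_zero, curryLeft_resW0,
    curryLeft_extD_thetaPont w (Y := inclW0 vol L w Y) rfl] at h1
  have h3 : X.incl w (-(β.form.compContinuousLinearMap
      (ContinuousLinearMap.fst ℝ (TotV k n) (Jet k n × ExtMom k n × Act k)))) = 0 := h1
  rw [map_neg, neg_eq_zero, hm.incl_eq hU hX hp, Multivector.map_apply] at h3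
  have h4 : (tmap (IPont k n) (IE k n) pontE w).comp
      (tmap (IVel k n) (IPont k n) (legendreGraph vol L) p) = tmap (IVel k n) (IE k n) velE p :=
    (tmap_comp (contMDiff_pontE.mdifferentiable (by simp) _)
      ((contMDiff_legendreGraph hvol hL).mdifferentiable (by simp) _)).symm
  rw [tmap_pontE] at h4
  have h5 : (β.form.compContinuousLinearMap (ContinuousLinearMap.fst ℝ (TotV k n)
      (Jet k n × ExtMom k n × Act k))).compContinuousLinearMap
      (tmap (IVel k n) (IPont k n) (legendreGraph vol L) p) =
      β.form.compContinuousLinearMap (tmap (IVel k n) (IE k n) velE p) := by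
    rw [← h4]
    rfl
  have h6 : pushVel X p (β.form.compContinuousLinearMap (tmap (IVel k n) (IE k n) velE p)) = 0 := by
    rw [← h5]
    exact h3
  rw [hZ, Multivector.map_apply] at h6
  have h7 : (β.form.compContinuousLinearMap (tmap (IVel k n) (IE k n) velE p)
      ).compContinuousLinearMap (tmap (IB k) (IVel k n) ψ x) = jetPull v' β := by
    show β.form.compContinuousLinearMap ((tmap (IVel k n) (IE k n) velE p).comp
      (tmap (IB k) (IVel k n) ψ x)) = _
    rw [← hT1, hTeq]
    rfl
  -- On an integral section the field comes from a multivector `Z` of the base, and `β` pulls back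
  -- to D (v' - v) vol. Transversality makes Z(vol) nonzero.
  rw [h7, hβ, jetPull_affineMom, map_smul, zero_add, smul_eq_mul] at h6
  exact (mul_eq_zero.1 h6).resolve_right hZvol

/-- On the open set `U` the parametrisation of `W1` by 𝒫*, composed with the Legendre map, is the
graph. Hence the two ways of lifting agree. -/
theorem map_legendreGraph_legendreInv (hvol : SmoothForm (IB k) vol) (hvol0 : ∀ x, vol x ≠ 0)
    (hL : ContMDiff (IVel k n) 𝓘(ℝ, ℝ) ∞ L) (hreg : RegularLagrangian L) (hU : IsOpen U)
    (hinj : InjOn (legendre vol L) U) {p : VelPhase B} (hp : p ∈ U)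
    (X : Multivector (k + 1) (TotV k n × Jet k n × Act k)) :
    (X.map (tmap (IVel k n) (IMom k n) (legendre vol L) p)).map
      (tmap (IMom k n) (IPont k n) (fun q => legendreGraph vol L (legendreInv vol L U q))
        (legendre vol L p)) =
      X.map (tmap (IVel k n) (IPont k n) (legendreGraph vol L) p) := by
  have hc := fibredCorr_mom hvol hvol0 hL hreg hU hinj
  rw [Multivector.map_map,
    ← tmap_comp (mdifferentiableAt_of_contMDiffOn hc.smooth' hc.isOpen' ⟨p, hp, rfl⟩)
    ((contMDiff_legendre hvol hL).mdifferentiable (by simp) _)]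
  congr 1
  apply tmap_congr
  filter_upwards [hU.mem_nhds hp] with p' hp'
  rw [legendreInv_legendre hinj hp']

end Solutions

end Multicontact

end

/-! ### The theorem, from the two models. -/

theorem theorem2 {k n : ℕ}
    {M : Type*} [TopologicalSpace M] [ChartedSpace (BaseV k) M] [IsManifold 𝓘(ℝ, BaseV k) ∞ M]
    {E : Type*} [TopologicalSpace E] [ChartedSpace (TotV k n) E] [IsManifold 𝓘(ℝ, TotV k n) ∞ E]
    (B : AdaptedBundle k n M E)
    (vol : M → Vol k) (hvol : SmoothForm (IB k) vol) (hvol0 : ∀ x, vol x ≠ 0)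
    (L : VelPhase B → ℝ) (hL : ContMDiff (IVel k n) 𝓘(ℝ, ℝ) ∞ L) (hreg : RegularLagrangian L)
    (U : Set (VelPhase B)) (hU : IsOpen U) :
    -- the projection of `𝒲₁` to `𝒫` is bijective, with inverse the graph of the Legendre map
    ((∀ p : VelPhase B, legendreGraph vol L p ∈ W1 vol L ∧ pr (legendreGraph vol L p) = p) ∧
      ∀ w ∈ W1 vol L, legendreGraph vol L (pr w) = w) ∧
    -- from unified to Lagrangian solutions
    (∀ X : UnifiedField vol L, IsUnifiedSolution vol L U X →
      IsLagrangianSolution vol L U (pushVel X)) ∧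
    -- from unified to Hamiltonian solutions
    (InjOn (legendre vol L) U → ∀ X : UnifiedField vol L, IsUnifiedSolution vol L U X →
      IsHamiltonianSolution vol L U (pushMom U X)) ∧
    -- from Lagrangian to unified solutions
    (∀ XL : VelPhase B → Multivector (k + 1) (VelV k n), IsLagrangianSolution vol L U XL →
      ∃ X : UnifiedField vol L, IsUnifiedSolution vol L U X ∧
        ∀ p ∈ U, X.incl (legendreGraph vol L p) =
            (XL p).map (tmap (IVel k n) (IPont k n) (legendreGraph vol L) p) ∧
          pushVel X p = XL p) ∧
    -- from Hamiltonian to unified solutions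
    (InjOn (legendre vol L) U →
      ∀ XH : MomPhase B → Multivector (k + 1) (MomV k n), IsHamiltonianSolution vol L U XH →
        ∃ X : UnifiedField vol L, IsUnifiedSolution vol L U X ∧
          ∀ q ∈ legendre vol L '' U, X.incl (legendreGraph vol L (legendreInv vol L U q)) =
              (XH q).map (tmap (IMom k n) (IPont k n)
                (fun q' => legendreGraph vol L (legendreInv vol L U q')) q) ∧
            pushMom U X q = XH q) ∧
    -- a Lagrangian solution and a Hamiltonian solution that correspond to each other under the
    -- Legendre map have a common lift
    (InjOn (legendre vol L) U →
      ∀ (XL : VelPhase B → Multivector (k + 1) (VelV k n))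
        (XH : MomPhase B → Multivector (k + 1) (MomV k n)),
        IsLagrangianSolution vol L U XL → IsHamiltonianSolution vol L U XH →
        (∀ p ∈ U, XH (legendre vol L p) =
          (XL p).map (tmap (IVel k n) (IMom k n) (legendre vol L) p)) →
        ∃ X : UnifiedField vol L, IsUnifiedSolution vol L U X ∧
          ∀ p ∈ U,
            X.incl (legendreGraph vol L p) =
              (XL p).map (tmap (IVel k n) (IPont k n) (legendreGraph vol L) p) ∧
            X.incl (legendreGraph vol L p) =
              (XH (legendre vol L p)).map (tmap (IMom k n) (IPont k n)
                (fun q => legendreGraph vol L (legendreInv vol L U q)) (legendre vol L p)) ∧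
            pushVel X p = XL p ∧ pushMom U X (legendre vol L p) = XH (legendre vol L p)) := by
  refine ⟨⟨fun p => ⟨legendreGraph_mem_W1 hvol hvol0 hL p, pr_legendreGraph p⟩,
    fun w hw => eq_legendreGraph_of_mem_W1 hvol hvol0 hL hw⟩, ?_, ?_, ?_, ?_, ?_⟩
  · intro X hX
    obtain ⟨ht, hi, hs⟩ := (unifiedModel_vel hvol hvol0 hL hreg hU).push_solution hU hX
      (Y := pushVel X) fun _ => rfl
    exact ⟨⟨ht, hi, fun O ψ hψ x hx => holonomic_of_unified hvol hvol0 hL hreg hU hX ht hψ hx⟩, hs⟩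
  · intro hinj X hX
    obtain ⟨ht, hi, hs⟩ := (unifiedModel_mom hvol hvol0 hL hreg hU hinj).push_solution hU hX
      (Y := pushMom U X) fun _ => rfl
    exact ⟨ht, hi, hs⟩
  · intro XL hXL
    have hm := unifiedModel_vel hvol hvol0 hL hreg hU
    exact ⟨_, hm.lift_solution hXL.holonomic.transverse hXL.holonomic.integrable hXL.solves,
      fun p hp => ⟨hm.incl_liftField hp XL, hm.push_liftField hp XL⟩⟩
  · intro hinj XH hXH
    have hm := unifiedModel_mom hvol hvol0 hL hreg hU hinj
    exact ⟨_, hm.lift_solution hXH.transverse hXH.integrable hXH.solves,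
      fun q hq => ⟨hm.incl_liftField hq XH, hm.push_liftField hq XH⟩⟩
  · intro hinj XL XH hXL _ hLH
    have hm := unifiedModel_vel hvol hvol0 hL hreg hU
    -- The lift of the Lagrangian field serves for both: `legendre` is `prBar` after the graph, so
    -- by the chain rule the push-forward of this lift to 𝒫* is the Hamiltonian field.
    refine ⟨_, hm.lift_solution hXL.holonomic.transverse hXL.holonomic.integrable hXL.solves,
      fun p hp => ?_⟩
    have h1 := hm.incl_liftField hp XL
    refine ⟨h1, ?_, hm.push_liftField hp XL, ?_⟩
    · rw [h1, hLH p hp]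
      exact (map_legendreGraph_legendreInv hvol hvol0 hL hreg hU hinj hp _).symm
    · rw [pushMom, legendreInv_legendre hinj hp, h1, hLH p hp, Multivector.map_map]
      congr 1
      exact (tmap_comp (contMDiff_prBar.mdifferentiable (by simp) _)
        ((contMDiff_legendreGraph hvol hL).mdifferentiable (by simp) _)).symm
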